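/- **Symmetric multicategories.** A symmetric multicategory $Q$ consists of a small category $o(Q)$ (its objects and object-morphisms); for all objects $x_1,\dots,x_n,y$ ($n\ge 0$) a set $Q(x_1,\dots,x_n;y)$ of arrows; for every object-morphism $a\colon x\to y$ an arrow $\iota(a)\in Q(x;y)$; composites $f\circ(g_1,\dots,g_k)\in Q(u_{11},\dots,u_{km_k};y)$ for $f\in Q(x_1,\dots,x_k;y)$ and $g_i\in Q(u_{i1},\dots,u_{im_i};x_i)$; and maps $f\mapsto f\sigma$, $Q(x_1,\dots,x_n;y)\to Q(x_{\sigma(1)},\dots,x_{\sigma(n)};y)$ for $\sigma\in S_n$. Composition is associative with units $1_x=\iota(1_x)$; $f1=f$ and $(f\sigma)\sigma'=f(\sigma\sigma')$; $(f\sigma)\circ(g_{\sigma(1)},\dots,g_{\sigma(k)})$ and $f\circ(g_1\sigma_1,\dots,g_k\sigma_k)$ are obtained from $f\circ(g_1,\dots,g_k)$ by the action of the block permutation induced by $\sigma$ and of the juxtaposition of the $\sigma_i$, respectively; and $\iota(b)\circ\iota(a)=\iota(b\circ a)$. A morphism $F\colon Q\to R$ is a functor $o(Q)\to o(R)$ together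 with maps $Q(x_1,\dots,x_n;y)\to R(Fx_1,\dots,Fx_n;Fy)$ preserving $\iota$, composition and symmetric action. It is an *equivalence* if the functor is an equivalence of categories and all these maps are bijections. **Generalised multicategories.** A generalised multicategory $M$ consists of a set $o(M)$ of objects and a set $a(M)$ of arrows, each arrow $f$ having a source $s(f)=(x_1,\dots,x_k)$ and a target $t(f)$; an identity $1_x\colon (x)\to x$ for each object; for arrows $f,g$ and a position $p$ with $s(f)_p=t(g)$ a composite $f\circ_p g$ with target $t(f)$; and amalgamating maps $\psi[f,g,p]$ (from the positions $q\ne p$ of $s(f)$) and $\phi[f,g,p]$ (from the positions of $s(g)$) which preserve objects and together form a bijection onto the positions of $s(f\circ_p g)$. The unit laws hold; $(f\circ_p g)\circ_{\bar q}h=f\circ_p(g\circ_q h)$ with $\bar q=\phi[f,g,p](q)$; $(f\circ_p g)\circ_{\bar q}h=(f\circ_q h)\circ_{\bar p}g$ for $p\neq q$, with $\bar q=\psi[f,g,p](q)$, $\bar p=\psi[f,h,q](p)$; and in each of these laws the (composite) amalgamating maps of the two sides agree. **The symmetric multicategory $\xi(M)$.** Its category of objects is the discrete category on $o(M)$. The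 elements of $\xi(M)(x_1,\dots,x_n;y)$ are the pairs $(f,\sigma)$ with $f\colon(x_{\sigma(1)},\dots,x_{\sigma(n)})\to y$ in $M$, $\sigma\in S_n$. The action is $(f,\tau)\sigma=(f,\sigma^{-1}\tau)$, identities are $(1_x,1)$, and composition is the (iterated) composition $\circ_p$ of $M$, the permutation recording, via the amalgamating maps, where each source element goes. **The slice $Q^+$.** The objects of $Q^+$ are the arrows of $Q$; an object-morphism $g\to g'$, for $g\in Q(x_1,\dots,x_n;y)$ and $g'\in Q(x'_1,\dots,x'_n;y')$, is a triple of a permutation $\sigma$, morphisms $l_i\colon x'_{\sigma(i)}\to x_i$ and a morphism $r\colon y\to y'$ of $o(Q)$ such that $\iota(r)\circ g\circ(\iota(l_1),\dots,\iota(l_n))$, with its source permuted by $\sigma$ to $(x'_1,\dots,x'_n)$, is $g'$. The arrows $(f_1,\dots,f_n)\to f$ are the configurations $(T,\rho,\tau)$ for composing $f_1,\dots,f_n$ to $f$: $T$ is a planar tree with a bijection $\tau$ from its nodes to $\{1,\dots,n\}$; the node $N$ carries $f_{\tau(N)}$, its inputs being, in planar order, the source elements of $f_{\tau(N)}$; every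 edge carries an object-morphism from the object at its upper end to the object at its lower end (the leaves and the root ending at the source elements and at the target of $f$); and $\rho$ is a permutation of the leaves such that the composite in $Q$ of $T$ (edge labels acting through $\iota$), acted on by $\rho$, is $f$. Composition replaces nodes by trees, composing edge labels; $\iota(\sigma,l,r)$ is the tree with one node, edge labels $l_i$, $r$, and twist $\sigma$; and $(T,\rho,\tau)\sigma=(T,\rho,\sigma^{-1}\tau)$. **The slice $M_+$.** The objects of $M_+$ are the arrows of $M$. Its arrows are the configurations for composing arrows of $M$: planar trees $T$ whose nodes carry arrows of $M$, the inputs of a node carrying $f$ being the elements of $s(f)$ in order, and whose edges carry objects of $M$ in agreement with the sources and targets at the nodes. The source of $T$ is the sequence of the arrows at its nodes, listed in depth-first planar order, and its target is the composite of $T$ in $M$. The leaves of $T$ are identified with the source positions of this composite by the permutation which the amalgamating maps of $M$ induce. $T_1\circ_m T_2$ is the tree obtained by replacing the $m$-th node of $T_1$ by $T_2$, with the amalgamating maps given by the inclusions of the nodes; the identity of $f$ is the tree with the single node $f$. Put $Q^{0+}=Q$, $Q^{(k+1)+}=(Q^{k+})^+$, and $M_{0+}=M$, $M_{(k+1)+}=(M_{k+})_+$.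 Let $I$ be the symmetric multicategory with exactly one object, one (identity) object-morphism and one (identity) arrow, and let $J$ be the generalised multicategory with exactly one object and one (identity) arrow. **Proposition.** For each $k\ge 0$, $\ \xi(J_{k+})\simeq I^{k+}$: there are morphisms of symmetric multicategories $I^{k+}\to\xi(J_{k+})$ and $\xi(J_{k+})\to I^{k+}$ which are equivalences. -/

import Mathlib

open CategoryTheory

universe u

namespace Opetopic

/-! ### Sequences -/

/-- The concatenation of a sequence of sequences: `finSigmaFinEquiv` is the lexicographic
enumeration of the pairs `(i, j)`. -/
abbrev concat {C : Type*} {k : ℕ} {m : Fin k → ℕ} (u : ∀ i, Fin (m i) → C) :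
    Fin (∑ i, m i) → C :=
  fun j => u (finSigmaFinEquiv.symm j).1 (finSigmaFinEquiv.symm j).2

theorem concat_mk {C : Type*} {k : ℕ} {m : Fin k → ℕ} (u : ∀ i, Fin (m i) → C)
    (p : (i : Fin k) × Fin (m i)) : concat u (finSigmaFinEquiv p) = u p.1 p.2 := by
  have : ∀ s : (i : Fin k) × Fin (m i), s = p → u s.1 s.2 = u p.1 p.2 := by rintro _ rfl; rfl
  exact this _ (Equiv.symm_apply_apply _ _)

/-- The positions of a concatenation of one sequence of length `n` are the positions of it. -/
def oneSumEquiv (n : ℕ) : Fin (∑ _i : Fin 1, n) ≃ Fin n :=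
  finSigmaFinEquiv.symm.trans ((Equiv.sigmaEquivProd (Fin 1) (Fin n)).trans
    (Equiv.uniqueProd (Fin n) (Fin 1)))

/-- The positions of a concatenation of `n` sequences of length one. -/
def sumOneEquiv (n : ℕ) : Fin (∑ _i : Fin n, 1) ≃ Fin n :=
  finSigmaFinEquiv.symm.trans (Equiv.sigmaUnique (Fin n) (fun _ => Fin 1))

theorem oneSumEquiv_mk {n : ℕ} (i : Fin 1) (j : Fin n) :
    oneSumEquiv n (finSigmaFinEquiv ⟨i, j⟩) = j := by simp [oneSumEquiv]

theorem concat_one {C : Type*} {n : ℕ} (x : Fin n → C) (i : Fin (∑ _i : Fin 1, n)) :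
    concat (fun _ : Fin 1 => x) i = x (oneSumEquiv n i) := rfl

theorem concat_one_symm {C : Type*} {n : ℕ} (x : Fin n → C) (i : Fin n) :
    x i = concat (fun _ : Fin 1 => x) ((oneSumEquiv n).symm i) := by
  rw [concat_one, Equiv.apply_symm_apply]

theorem concat_sumOne {C : Type*} {n : ℕ} (x : Fin n → C) (i : Fin (∑ _i : Fin n, 1)) :
    concat (fun i (_ : Fin 1) => x i) i = x (sumOneEquiv n i) := rfl

theorem concat_sumOne_symm {C : Type*} {n : ℕ} (x : Fin n → C) (i : Fin n) :
    x i = concat (fun i (_ : Fin 1) => x i) ((sumOneEquiv n).symm i) := by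
  rw [concat_sumOne, Equiv.apply_symm_apply]

/-- The comparison `((i, j), r) ↦ (i, (j, r))` of the two ways of concatenating a triply indexed
family. Both sides are enumerated lexicographically, so this is the identity of positions. -/
def assocEquiv {k : ℕ} {m : Fin k → ℕ} (l : ∀ i, Fin (m i) → ℕ) :
    Fin (∑ q, concat l q) ≃ Fin (∑ i, ∑ j, l i j) :=
  finSigmaFinEquiv.symm.trans <|
    (Equiv.sigmaCongrLeft (β := fun p : (i : Fin k) × Fin (m i) => Fin (l p.1 p.2))
      finSigmaFinEquiv.symm).trans <|
    (Equiv.sigmaAssoc (fun i (j : Fin (m i)) => Fin (l i j))).trans <|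
    (Equiv.sigmaCongrRight fun _ => finSigmaFinEquiv).trans finSigmaFinEquiv

theorem concat_assocEquiv {C : Type*} {k : ℕ} {m : Fin k → ℕ} {l : ∀ i, Fin (m i) → ℕ}
    (v : ∀ i j, Fin (l i j) → C) (q : Fin (∑ q, concat l q)) :
    concat (fun i => concat (v i)) (assocEquiv l q)
      = concat (m := concat l)
          (fun q => v (finSigmaFinEquiv.symm q).1 (finSigmaFinEquiv.symm q).2) q :=
  (concat_mk (fun i => concat (v i)) ⟨_, finSigmaFinEquiv ⟨_, _⟩⟩).trans
    (concat_mk (v _) ⟨_, _⟩)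

theorem assocEquiv_mk {k : ℕ} {m : Fin k → ℕ} (l : ∀ i, Fin (m i) → ℕ) (q : Fin (∑ i, m i))
    (r : Fin (concat l q)) :
    finSigmaFinEquiv (n := fun i => ∑ j, l i j) ⟨(finSigmaFinEquiv.symm q).1,
        finSigmaFinEquiv ⟨(finSigmaFinEquiv.symm q).2, r⟩⟩
      = assocEquiv l (finSigmaFinEquiv ⟨q, r⟩) :=
  (congrArg (fun s : (q : Fin (∑ i, m i)) × Fin (concat l q) =>
    (finSigmaFinEquiv (n := fun i => ∑ j, l i j) ⟨(finSigmaFinEquiv.symm s.1).1,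
        finSigmaFinEquiv ⟨(finSigmaFinEquiv.symm s.1).2, s.2⟩⟩))
    (Equiv.symm_apply_apply finSigmaFinEquiv ⟨q, r⟩)).symm

/-- The block permutation `(i, j) ↦ (σ i, j)`. -/
def blockEquiv {k k' : ℕ} (m : Fin k → ℕ) (σ : Fin k' ≃ Fin k) :
    Fin (∑ i, m (σ i)) ≃ Fin (∑ i, m i) :=
  finSigmaFinEquiv.symm.trans <|
    (Equiv.sigmaCongrLeft (β := fun i => Fin (m i)) σ).trans finSigmaFinEquiv

theorem concat_block {C : Type*} {k k' : ℕ} {m : Fin k → ℕ} (u : ∀ i, Fin (m i) → C)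
    (σ : Fin k' ≃ Fin k) (j : Fin (∑ i, m (σ i))) :
    concat (fun i => u (σ i)) j = concat u (blockEquiv m σ j) :=
  (concat_mk u ⟨_, _⟩).symm

theorem blockEquiv_symm_mk {k k' : ℕ} (m : Fin k → ℕ) (σ : Fin k' ≃ Fin k) (i : Fin k')
    (j : Fin (m (σ i))) :
    (blockEquiv m σ).symm (finSigmaFinEquiv ⟨σ i, j⟩)
      = finSigmaFinEquiv (n := fun i => m (σ i)) ⟨i, j⟩ := by
  rw [Equiv.symm_apply_eq]
  simp only [blockEquiv, Equiv.trans_apply, Equiv.symm_apply_apply]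
  rfl

/-- The juxtaposition `(i, j) ↦ (i, σ i j)` of permutations. -/
def juxtEquiv {k : ℕ} {m m' : Fin k → ℕ} (σ : ∀ i, Fin (m' i) ≃ Fin (m i)) :
    Fin (∑ i, m' i) ≃ Fin (∑ i, m i) :=
  finSigmaFinEquiv.symm.trans <| (Equiv.sigmaCongrRight σ).trans finSigmaFinEquiv

theorem concat_juxt {C : Type*} {k : ℕ} {m m' : Fin k → ℕ} (u : ∀ i, Fin (m i) → C)
    (σ : ∀ i, Fin (m' i) ≃ Fin (m i)) (j : Fin (∑ i, m' i)) :
    concat (fun i j => u i (σ i j)) j = concat u (juxtEquiv σ j) :=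
  (concat_mk u ⟨_, _⟩).symm

/-! ### Symmetric multicategories -/

/-- The data of a symmetric multicategory with a category of objects. A bijection
`Fin m ≃ Fin n` exists only if `m = n`, so that `act` is the action of the symmetric groups;
allowing two names for the same arity avoids casts between equal arities. -/
structure SymMulticatData where
  Obj : Type u
  [cat : SmallCategory Obj]
  /-- `Hom x y` is the set of arrows with source `(x 0, …, x (n - 1))` and target `y`. -/
  Hom : {n : ℕ} → (Fin n → Obj) → Obj → Type u
  ι : {x y : Obj} → (x ⟶ y) → Hom (fun _ : Fin 1 => x) y
  comp : {k : ℕ} → {x : Fin k → Obj} → {y : Obj} → {m : Fin k → ℕ} →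
    {u : ∀ i, Fin (m i) → Obj} → Hom x y → (∀ i, Hom (u i) (x i)) → Hom (concat u) y
  act : {m n : ℕ} → {x : Fin n → Obj} → {y : Obj} → (σ : Fin m ≃ Fin n) → Hom x y →
    Hom (fun i => x (σ i)) y

attribute [instance] SymMulticatData.cat

/-- The action of `σ`, followed by the identification of the source with an equal sequence. -/
def SymMulticatData.reindex (Q : SymMulticatData.{u}) {m n : ℕ} {x : Fin n → Q.Obj}
    {x' : Fin m → Q.Obj} {y : Q.Obj} (σ : Fin m ≃ Fin n) (h : ∀ i, x' i = x (σ i))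
    (f : Q.Hom x y) : Q.Hom x' y :=
  cast (congrArg (fun w => Q.Hom w y) (funext h).symm) (Q.act σ f)

/-- Symmetric multicategories with a category of objects. In the unit laws, the associativity law
and the last axiom both sides have the same source, but this holds only up to a computation with
sums of natural numbers: `reindex` along the canonical identification of positions says so. -/
structure SymMulticat extends SymMulticatData.{u} where
  id_comp : ∀ {n : ℕ} {x : Fin n → Obj} {y : Obj} (f : Hom x y),
    comp (ι (𝟙 y)) (fun _ => f)
      = toSymMulticatData.reindex (oneSumEquiv n) (concat_one x) f
  comp_id : ∀ {n : ℕ} {x : Fin n → Obj} {y : Obj} (f : Hom x y),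
    comp f (fun i => ι (𝟙 (x i)))
      = toSymMulticatData.reindex (sumOneEquiv n) (concat_sumOne x) f
  assoc : ∀ {k : ℕ} {x : Fin k → Obj} {y : Obj} {m : Fin k → ℕ} {u : ∀ i, Fin (m i) → Obj}
    {l : ∀ i, Fin (m i) → ℕ} {v : ∀ i j, Fin (l i j) → Obj} (f : Hom x y)
    (g : ∀ i, Hom (u i) (x i)) (h : ∀ i j, Hom (v i j) (u i j)),
    comp (m := concat l) (comp f g)
        (fun q => h (finSigmaFinEquiv.symm q).1 (finSigmaFinEquiv.symm q).2)
      = toSymMulticatData.reindex (assocEquiv l)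
          (fun q => (concat_assocEquiv v q).symm)
          (comp f (fun i => comp (g i) (h i)))
  act_refl : ∀ {n : ℕ} {x : Fin n → Obj} {y : Obj} (f : Hom x y), act (Equiv.refl _) f = f
  act_act : ∀ {l m n : ℕ} {x : Fin n → Obj} {y : Obj} (f : Hom x y) (σ : Fin m ≃ Fin n)
    (σ' : Fin l ≃ Fin m), act σ' (act σ f) = act (σ'.trans σ) f
  act_comp : ∀ {k k' : ℕ} {x : Fin k → Obj} {y : Obj} {m : Fin k → ℕ}
    {u : ∀ i, Fin (m i) → Obj} (f : Hom x y) (g : ∀ i, Hom (u i) (x i)) (σ : Fin k' ≃ Fin k),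
    comp (act σ f) (fun i => g (σ i))
      = toSymMulticatData.reindex (blockEquiv m σ) (concat_block u σ) (comp f g)
  comp_act : ∀ {k : ℕ} {x : Fin k → Obj} {y : Obj} {m m' : Fin k → ℕ}
    {u : ∀ i, Fin (m i) → Obj} (f : Hom x y) (g : ∀ i, Hom (u i) (x i))
    (σ : ∀ i, Fin (m' i) ≃ Fin (m i)),
    comp f (fun i => act (σ i) (g i))
      = toSymMulticatData.reindex (juxtEquiv σ) (concat_juxt u σ) (comp f g)
  ι_comp : ∀ {x y z : Obj} (a : x ⟶ y) (b : y ⟶ z),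
    comp (ι b) (fun _ => ι a)
      = toSymMulticatData.reindex (oneSumEquiv 1) (concat_one _) (ι (a ≫ b))

/-- A morphism of symmetric multicategories. -/
structure SymMulticat.Mor (Q R : SymMulticat.{u}) where
  obj : Q.Obj ⥤ R.Obj
  map : {n : ℕ} → {x : Fin n → Q.Obj} → {y : Q.Obj} → Q.Hom x y →
    R.Hom (fun i => obj.obj (x i)) (obj.obj y)
  map_ι : ∀ {x y : Q.Obj} (a : x ⟶ y), map (Q.ι a) = R.ι (obj.map a)
  map_comp : ∀ {k : ℕ} {x : Fin k → Q.Obj} {y : Q.Obj} {m : Fin k → ℕ}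
    {u : ∀ i, Fin (m i) → Q.Obj} (f : Q.Hom x y) (g : ∀ i, Q.Hom (u i) (x i)),
    map (Q.comp f g) = R.comp (map f) (fun i => map (g i))
  map_act : ∀ {m n : ℕ} {x : Fin n → Q.Obj} {y : Q.Obj} (σ : Fin m ≃ Fin n) (f : Q.Hom x y),
    map (Q.act σ f) = R.act σ (map f)

/-- A morphism is an equivalence if it is an equivalence on the categories of objects and
bijective on each set of arrows. -/
def SymMulticat.Mor.IsEquivalence {Q R : SymMulticat.{u}} (F : Q.Mor R) : Prop :=
  F.obj.IsEquivalence ∧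
    ∀ (n : ℕ) (x : Fin n → Q.Obj) (y : Q.Obj),
      Function.Bijective (fun f : Q.Hom x y => F.map f)

/-! ### Generalised multicategories -/

/-- The data of a generalised multicategory. The amalgamating maps `ψ[f,g,p]` and `φ[f,g,p]` are
the two components of the bijection `amal`. -/
structure GenMulticatData where
  Obj : Type u
  Arr : Type u
  arity : Arr → ℕ
  src : ∀ f, Fin (arity f) → Obj
  tgt : Arr → Obj
  comp : ∀ (f g : Arr) (p : Fin (arity f)), tgt g = src f p → Arr
  amal : ∀ (f g : Arr) (p : Fin (arity f)) (h : tgt g = src f p),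
    {q : Fin (arity f) // q ≠ p} ⊕ Fin (arity g) ≃ Fin (arity (comp f g p h))
  tgt_comp : ∀ f g p h, tgt (comp f g p h) = tgt f
  src_inl : ∀ f g p h q, src (comp f g p h) (amal f g p h (.inl q)) = src f q.1
  src_inr : ∀ f g p h q, src (comp f g p h) (amal f g p h (.inr q)) = src g q
  id : Obj → Arr
  arity_id : ∀ x, arity (id x) = 1
  src_id : ∀ x i, src (id x) i = x
  tgt_id : ∀ x, tgt (id x) = x

namespace GenMulticatData

variable (M : GenMulticatData.{u})

def ψ (f g : M.Arr) (p : Fin (M.arity f)) (h : M.tgt g = M.src f p) (q : Fin (M.arity f))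
    (hq : q ≠ p) : Fin (M.arity (M.comp f g p h)) :=
  M.amal f g p h (.inl ⟨q, hq⟩)

def φ (f g : M.Arr) (p : Fin (M.arity f)) (h : M.tgt g = M.src f p) (q : Fin (M.arity g)) :
    Fin (M.arity (M.comp f g p h)) :=
  M.amal f g p h (.inr q)

theorem src_ψ {f g : M.Arr} {p : Fin (M.arity f)} (h : M.tgt g = M.src f p)
    (q : Fin (M.arity f)) (hq : q ≠ p) : M.src _ (M.ψ f g p h q hq) = M.src f q :=
  M.src_inl _ _ _ _ _

theorem src_φ {f g : M.Arr} {p : Fin (M.arity f)} (h : M.tgt g = M.src f p)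
    (q : Fin (M.arity g)) : M.src _ (M.φ f g p h q) = M.src g q :=
  M.src_inr _ _ _ _ _

theorem ψ_ne_φ {f g : M.Arr} {p : Fin (M.arity f)} (h : M.tgt g = M.src f p)
    (q : Fin (M.arity f)) (hq : q ≠ p) (r : Fin (M.arity g)) :
    M.ψ f g p h q hq ≠ M.φ f g p h r := by simp [ψ, φ]

theorem φ_ne_ψ {f g : M.Arr} {p : Fin (M.arity f)} (h : M.tgt g = M.src f p)
    (q : Fin (M.arity f)) (hq : q ≠ p) (r : Fin (M.arity g)) :
    M.φ f g p h r ≠ M.ψ f g p h q hq := by simp [ψ, φ]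

theorem ψ_ne_ψ {f g : M.Arr} {p : Fin (M.arity f)} (h : M.tgt g = M.src f p)
    (q q' : Fin (M.arity f)) (hq : q ≠ p) (hq' : q' ≠ p) (hne : q ≠ q') :
    M.ψ f g p h q hq ≠ M.ψ f g p h q' hq' := by simp [ψ, hne]

theorem φ_ne_φ {f g : M.Arr} {p : Fin (M.arity f)} (h : M.tgt g = M.src f p)
    (q q' : Fin (M.arity g)) (hne : q ≠ q') :
    M.φ f g p h q ≠ M.φ f g p h q' := by simp [φ, hne]

end GenMulticatData

/-- Generalised multicategories. Positions in the sources of equal arrows are compared by their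
values in `ℕ`. -/
structure GenMulticat extends GenMulticatData.{u} where
  id_comp : ∀ (y : Obj) (f : Arr) (p : Fin (arity (id y))) (h : tgt f = src (id y) p),
    comp (id y) f p h = f
  id_comp_φ : ∀ (y : Obj) (f : Arr) (p : Fin (arity (id y))) (h : tgt f = src (id y) p)
    (q : Fin (arity f)), (toGenMulticatData.φ (id y) f p h q : ℕ) = q
  comp_id : ∀ (f : Arr) (x : Obj) (p : Fin (arity f)) (h : tgt (id x) = src f p),
    comp f (id x) p h = f
  comp_id_ψ : ∀ (f : Arr) (x : Obj) (p : Fin (arity f)) (h : tgt (id x) = src f p)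
    (q : Fin (arity f)) (hq : q ≠ p), (toGenMulticatData.ψ f (id x) p h q hq : ℕ) = q
  comp_id_φ : ∀ (f : Arr) (x : Obj) (p : Fin (arity f)) (h : tgt (id x) = src f p)
    (q : Fin (arity (id x))), (toGenMulticatData.φ f (id x) p h q : ℕ) = p
  assoc : ∀ (f g h : Arr) (p : Fin (arity f)) (q : Fin (arity g)) (hg : tgt g = src f p)
    (hh : tgt h = src g q),
    comp (comp f g p hg) h (toGenMulticatData.φ f g p hg q)
        (hh.trans (toGenMulticatData.src_φ hg q).symm)
      = comp f (comp g h q hh) p ((tgt_comp g h q hh).trans hg)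
  assoc_ψψ : ∀ (f g h : Arr) (p : Fin (arity f)) (q : Fin (arity g)) (hg : tgt g = src f p)
    (hh : tgt h = src g q) (r : Fin (arity f)) (hr : r ≠ p),
    (toGenMulticatData.ψ (comp f g p hg) h (toGenMulticatData.φ f g p hg q)
        (hh.trans (toGenMulticatData.src_φ hg q).symm)
        (toGenMulticatData.ψ f g p hg r hr) (toGenMulticatData.ψ_ne_φ hg r hr q) : ℕ)
      = toGenMulticatData.ψ f (comp g h q hh) p ((tgt_comp g h q hh).trans hg) r hr
  assoc_ψφ : ∀ (f g h : Arr) (p : Fin (arity f)) (q : Fin (arity g)) (hg : tgt g = src f p)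
    (hh : tgt h = src g q) (r : Fin (arity g)) (hr : r ≠ q),
    (toGenMulticatData.ψ (comp f g p hg) h (toGenMulticatData.φ f g p hg q)
        (hh.trans (toGenMulticatData.src_φ hg q).symm)
        (toGenMulticatData.φ f g p hg r) (toGenMulticatData.φ_ne_φ hg r q hr) : ℕ)
      = toGenMulticatData.φ f (comp g h q hh) p ((tgt_comp g h q hh).trans hg)
          (toGenMulticatData.ψ g h q hh r hr)
  assoc_φ : ∀ (f g h : Arr) (p : Fin (arity f)) (q : Fin (arity g)) (hg : tgt g = src f p)
    (hh : tgt h = src g q) (r : Fin (arity h)),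
    (toGenMulticatData.φ (comp f g p hg) h (toGenMulticatData.φ f g p hg q)
        (hh.trans (toGenMulticatData.src_φ hg q).symm) r : ℕ)
      = toGenMulticatData.φ f (comp g h q hh) p ((tgt_comp g h q hh).trans hg)
          (toGenMulticatData.φ g h q hh r)
  comm : ∀ (f g h : Arr) (p q : Fin (arity f)) (hpq : p ≠ q) (hg : tgt g = src f p)
    (hh : tgt h = src f q),
    comp (comp f g p hg) h (toGenMulticatData.ψ f g p hg q hpq.symm)
        (hh.trans (toGenMulticatData.src_ψ hg q hpq.symm).symm)
      = comp (comp f h q hh) g (toGenMulticatData.ψ f h q hh p hpq)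
        (hg.trans (toGenMulticatData.src_ψ hh p hpq).symm)
  comm_ψψ : ∀ (f g h : Arr) (p q : Fin (arity f)) (hpq : p ≠ q) (hg : tgt g = src f p)
    (hh : tgt h = src f q) (r : Fin (arity f)) (hp : r ≠ p) (hq : r ≠ q),
    (toGenMulticatData.ψ (comp f g p hg) h (toGenMulticatData.ψ f g p hg q hpq.symm)
        (hh.trans (toGenMulticatData.src_ψ hg q hpq.symm).symm)
        (toGenMulticatData.ψ f g p hg r hp)
        (toGenMulticatData.ψ_ne_ψ hg r q hp hpq.symm hq) : ℕ)
      = toGenMulticatData.ψ (comp f h q hh) g (toGenMulticatData.ψ f h q hh p hpq)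
        (hg.trans (toGenMulticatData.src_ψ hh p hpq).symm)
        (toGenMulticatData.ψ f h q hh r hq)
        (toGenMulticatData.ψ_ne_ψ hh r p hq hpq hp)
  comm_ψφ : ∀ (f g h : Arr) (p q : Fin (arity f)) (hpq : p ≠ q) (hg : tgt g = src f p)
    (hh : tgt h = src f q) (r : Fin (arity g)),
    (toGenMulticatData.ψ (comp f g p hg) h (toGenMulticatData.ψ f g p hg q hpq.symm)
        (hh.trans (toGenMulticatData.src_ψ hg q hpq.symm).symm)
        (toGenMulticatData.φ f g p hg r)
        (toGenMulticatData.φ_ne_ψ hg q hpq.symm r) : ℕ)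
      = toGenMulticatData.φ (comp f h q hh) g (toGenMulticatData.ψ f h q hh p hpq)
        (hg.trans (toGenMulticatData.src_ψ hh p hpq).symm) r
  comm_φψ : ∀ (f g h : Arr) (p q : Fin (arity f)) (hpq : p ≠ q) (hg : tgt g = src f p)
    (hh : tgt h = src f q) (r : Fin (arity h)),
    (toGenMulticatData.φ (comp f g p hg) h (toGenMulticatData.ψ f g p hg q hpq.symm)
        (hh.trans (toGenMulticatData.src_ψ hg q hpq.symm).symm) r : ℕ)
      = toGenMulticatData.ψ (comp f h q hh) g (toGenMulticatData.ψ f h q hh p hpq)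
        (hg.trans (toGenMulticatData.src_ψ hh p hpq).symm)
        (toGenMulticatData.φ f h q hh r)
        (toGenMulticatData.φ_ne_ψ hh p hpq r)

/-! ### Composition of labelled arrows of a generalised multicategory -/

/-- An arrow of `M` whose source elements carry labels in `Y`; the label `y` stands for the
object `ob y`. -/
structure GenMulticat.Lab (M : GenMulticat.{u}) {Y : Type} (ob : Y → M.Obj) where
  arr : M.Arr
  lab : Fin (M.arity arr) → Y
  src_eq : ∀ p, M.src arr p = ob (lab p)

namespace GenMulticat

namespace Lab

variable {M : GenMulticat.{u}} {Y Y' : Type} {ob : Y → M.Obj} {ob' : Y' → M.Obj}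

theorem ext_lab {A B : M.Lab ob} (h : A.arr = B.arr)
    (hl : ∀ (p : Fin (M.arity A.arr)) (q : Fin (M.arity B.arr)), (p : ℕ) = q →
      A.lab p = B.lab q) : A = B := by
  obtain ⟨f, l, s⟩ := A
  obtain ⟨f', l', s'⟩ := B
  obtain rfl : f = f' := h
  obtain rfl : l = l' := funext fun p => hl p p rfl
  rfl

/-- Change of labels. -/
@[reducible] def map (g : Y → Y') (hg : ∀ y, ob y = ob' (g y)) (A : M.Lab ob) : M.Lab ob' where
  arr := A.arr
  lab p := g (A.lab p)
  src_eq p := (A.src_eq p).trans (hg _)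

theorem map_congr {g g' : Y → Y'} (h : ∀ y, g y = g' y) (hg : ∀ y, ob y = ob' (g y))
    (hg' : ∀ y, ob y = ob' (g' y)) (A : M.Lab ob) : A.map g hg = A.map g' hg' := by
  obtain rfl : g = g' := funext h
  rfl

/-- The composite `A ∘_p B` in `M`, with the labels carried along the amalgamating maps. -/
def ins (A B : M.Lab ob) (p : Fin (M.arity A.arr)) (h : M.tgt B.arr = ob (A.lab p)) :
    M.Lab ob where
  arr := M.comp A.arr B.arr p (h.trans (A.src_eq p).symm)
  lab r := Sum.elim (fun q => A.lab q.1) B.lab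
    ((M.amal A.arr B.arr p (h.trans (A.src_eq p).symm)).symm r)
  src_eq r := by
    obtain ⟨s, rfl⟩ := (M.amal A.arr B.arr p (h.trans (A.src_eq p).symm)).surjective r
    rcases s with q | q
    · simp only [Equiv.symm_apply_apply, Sum.elim_inl, M.src_inl, A.src_eq]
    · simp only [Equiv.symm_apply_apply, Sum.elim_inr, M.src_inr, B.src_eq]

/-- The position `ψ q` in `A ∘_p B`. -/
def posL (A B : M.Lab ob) (p : Fin (M.arity A.arr)) (h : M.tgt B.arr = ob (A.lab p))
    (q : Fin (M.arity A.arr)) (hq : q ≠ p) : Fin (M.arity (A.ins B p h).arr) :=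
  M.ψ A.arr B.arr p (h.trans (A.src_eq p).symm) q hq

/-- The position `φ q` in `A ∘_p B`. -/
def posR (A B : M.Lab ob) (p : Fin (M.arity A.arr)) (h : M.tgt B.arr = ob (A.lab p))
    (q : Fin (M.arity B.arr)) : Fin (M.arity (A.ins B p h).arr) :=
  M.φ A.arr B.arr p (h.trans (A.src_eq p).symm) q

@[simp]
theorem lab_posL (A B : M.Lab ob) (p : Fin (M.arity A.arr)) (h : M.tgt B.arr = ob (A.lab p))
    (q : Fin (M.arity A.arr)) (hq : q ≠ p) : (A.ins B p h).lab (A.posL B p h q hq) = A.lab q := by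
  simp [ins, posL, GenMulticatData.ψ]

@[simp]
theorem lab_posR (A B : M.Lab ob) (p : Fin (M.arity A.arr)) (h : M.tgt B.arr = ob (A.lab p))
    (q : Fin (M.arity B.arr)) : (A.ins B p h).lab (A.posR B p h q) = B.lab q := by
  simp [ins, posR, GenMulticatData.φ]

theorem pos_cases (A B : M.Lab ob) (p : Fin (M.arity A.arr)) (h : M.tgt B.arr = ob (A.lab p))
    (r : Fin (M.arity (A.ins B p h).arr)) :
    (∃ q hq, r = A.posL B p h q hq) ∨ ∃ q, r = A.posR B p h q := by
  obtain ⟨s, rfl⟩ := (M.amal A.arr B.arr p (h.trans (A.src_eq p).symm)).surjective r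
  rcases s with ⟨q, hq⟩ | q
  · exact .inl ⟨q, hq, rfl⟩
  · exact .inr ⟨q, rfl⟩

/-- Two labelled arrows that agree along compatible enumerations of their positions. -/
theorem ext_of {A B : M.Lab ob} (h : A.arr = B.arr)
    (hl : ∀ p : Fin (M.arity A.arr), ∃ q : Fin (M.arity B.arr), (p : ℕ) = q ∧
      A.lab p = B.lab q) : A = B := by
  refine ext_lab h fun p q hpq => ?_
  obtain ⟨q', h1, h2⟩ := hl p
  rw [h2, Fin.ext (h1.symm.trans hpq)]

theorem ins_map (g : Y → Y') (hg : ∀ y, ob y = ob' (g y)) (A B : M.Lab ob)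
    (p : Fin (M.arity A.arr)) (h : M.tgt B.arr = ob (A.lab p)) :
    (A.ins B p h).map g hg = (A.map g hg).ins (B.map g hg) p (h.trans (hg _)) := by
  refine ext_of rfl fun r => ⟨r, rfl, ?_⟩
  rcases pos_cases A B p h r with ⟨q, hq, rfl⟩ | ⟨q, rfl⟩
  · refine Eq.trans ?_ (lab_posL (A.map g hg) (B.map g hg) p (h.trans (hg _)) q hq).symm
    exact congrArg g (lab_posL A B p h q hq)
  · refine Eq.trans ?_ (lab_posR (A.map g hg) (B.map g hg) p (h.trans (hg _)) q).symm
    exact congrArg g (lab_posR A B p h q)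

theorem ins_assoc (A B C : M.Lab ob) (p : Fin (M.arity A.arr)) (q : Fin (M.arity B.arr))
    (h : M.tgt B.arr = ob (A.lab p)) (h' : M.tgt C.arr = ob (B.lab q)) :
    (A.ins B p h).ins C (A.posR B p h q) (by simpa using h')
      = A.ins (B.ins C q h') p ((M.tgt_comp _ _ _ _).trans h) := by
  have hB := h.trans (A.src_eq p).symm
  have hC := h'.trans (B.src_eq q).symm
  refine ext_of (M.assoc A.arr B.arr C.arr p q hB hC) fun r => ?_
  rcases pos_cases _ _ _ _ r with ⟨r, hr, rfl⟩ | ⟨r, rfl⟩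
  · rcases pos_cases A B p h r with ⟨r, hr', rfl⟩ | ⟨r, rfl⟩
    · exact ⟨posL _ _ _ _ r hr', M.assoc_ψψ _ _ _ p q hB hC r hr',
        (lab_posL ..).trans <| (lab_posL ..).trans (lab_posL ..).symm⟩
    · have hrq : r ≠ q := fun e => hr (by rw [e])
      exact ⟨posR _ _ _ _ (posL _ _ _ _ r hrq), M.assoc_ψφ _ _ _ p q hB hC r hrq,
        (lab_posL ..).trans <| (lab_posR ..).trans <|
          ((lab_posR ..).trans (lab_posL ..)).symm⟩
  · exact ⟨posR _ _ _ _ (posR _ _ _ _ r), M.assoc_φ _ _ _ p q hB hC r,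
      (lab_posR ..).trans ((lab_posR ..).trans (lab_posR ..)).symm⟩

theorem ins_comm (A B C : M.Lab ob) (p q : Fin (M.arity A.arr)) (hpq : p ≠ q)
    (h : M.tgt B.arr = ob (A.lab p)) (h' : M.tgt C.arr = ob (A.lab q)) :
    (A.ins B p h).ins C (A.posL B p h q hpq.symm) (by simpa using h')
      = (A.ins C q h').ins B (A.posL C q h' p hpq) (by simpa using h) := by
  have hB := h.trans (A.src_eq p).symm
  have hC := h'.trans (A.src_eq q).symm
  refine ext_of (M.comm A.arr B.arr C.arr p q hpq hB hC) fun r => ?_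
  rcases pos_cases _ _ _ _ r with ⟨r, hr, rfl⟩ | ⟨r, rfl⟩
  · rcases pos_cases A B p h r with ⟨r, hr', rfl⟩ | ⟨r, rfl⟩
    · have hrq : r ≠ q := by rintro rfl; exact hr rfl
      refine ⟨posL _ _ _ _ (posL _ _ _ _ r hrq) (M.ψ_ne_ψ hC r p hrq hpq hr'),
        M.comm_ψψ _ _ _ p q hpq hB hC r hr' hrq,
        (lab_posL ..).trans <| (lab_posL ..).trans <|
          ((lab_posL ..).trans (lab_posL ..)).symm⟩
    · exact ⟨posR _ _ _ _ r, M.comm_ψφ _ _ _ p q hpq hB hC r,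
        (lab_posL ..).trans <| (lab_posR ..).trans (lab_posR ..).symm⟩
  · exact ⟨posL _ _ _ _ (posR _ _ _ _ r) (M.φ_ne_ψ hC p hpq r),
      M.comm_φψ _ _ _ p q hpq hB hC r,
      (lab_posR ..).trans ((lab_posL ..).trans (lab_posR ..)).symm⟩

/-- The identity arrow of the object that the label `y` stands for. -/
@[reducible] def one (ob : Y → M.Obj) (y : Y) : M.Lab ob where
  arr := M.id (ob y)
  lab _ := y
  src_eq p := M.src_id _ p

theorem one_ins (y : Y) (B : M.Lab ob) (p) (h : M.tgt B.arr = ob ((one ob y).lab p)) :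
    (one ob y).ins B p h = B := by
  refine ext_of (M.id_comp _ _ p _) fun r => ?_
  rcases pos_cases _ _ _ _ r with ⟨r, hr, rfl⟩ | ⟨r, rfl⟩
  · refine (hr ?_).elim
    have : M.arity (one ob y).arr = 1 := M.arity_id _
    ext; omega
  · exact ⟨r, M.id_comp_φ _ _ p _ r, by simp⟩

theorem ins_one (A : M.Lab ob) (p : Fin (M.arity A.arr)) (y : Y)
    (h : M.tgt (one ob y).arr = ob (A.lab p)) (hy : y = A.lab p) :
    A.ins (one ob y) p h = A := by
  have h' := h.trans (A.src_eq p).symm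
  refine ext_of (M.comp_id _ _ p h') fun r => ?_
  rcases pos_cases _ _ _ _ r with ⟨r, hr, rfl⟩ | ⟨r, rfl⟩
  · exact ⟨r, M.comp_id_ψ _ _ p h' r hr, by simp⟩
  · exact ⟨p, M.comp_id_φ _ _ p h' r, (lab_posR ..).trans hy⟩

open scoped Classical in
/-- The number of source elements whose label satisfies `P`. -/
noncomputable def cnt (A : M.Lab ob) (P : Y → Prop) : ℕ := ∑ p, if P (A.lab p) then 1 else 0

open scoped Classical in
theorem cnt_ins (A B : M.Lab ob) (p : Fin (M.arity A.arr)) (h : M.tgt B.arr = ob (A.lab p))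
    (P : Y → Prop) :
    (A.ins B p h).cnt P + (if P (A.lab p) then 1 else 0) = A.cnt P + B.cnt P := by
  have e : (A.ins B p h).cnt P = ∑ s : {q : Fin (M.arity A.arr) // q ≠ p} ⊕ Fin (M.arity B.arr),
      if P (Sum.elim (fun q => A.lab q.1) B.lab s) then 1 else 0 := by
    rw [cnt]
    refine Fintype.sum_equiv (M.amal A.arr B.arr p (h.trans (A.src_eq p).symm)).symm _ _ ?_
    intro r
    rfl
  rw [e, Fintype.sum_sum_type]
  have e2 : A.cnt P = (if P (A.lab p) then 1 else 0)
      + ∑ q : {q : Fin (M.arity A.arr) // q ≠ p}, if P (A.lab q.1) then 1 else 0 := by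
    rw [cnt, Fintype.sum_eq_add_sum_subtype_ne _ p]
  have e3 : B.cnt P = ∑ q, if P (B.lab q) then 1 else 0 := by rw [cnt]
  simp only [Sum.elim_inl, Sum.elim_inr]
  rw [e2, e3, add_comm, add_assoc]
  congr!

theorem bijective_iff (A : M.Lab ob) :
    Function.Bijective A.lab ↔ ∀ y, A.cnt (· = y) = 1 := by
  classical
  rw [Function.bijective_iff_existsUnique]
  refine forall_congr' fun y => ?_
  rw [cnt, Finset.sum_boole, Nat.cast_id, Finset.card_eq_one]
  simp only [Finset.eq_singleton_iff_unique_mem, ExistsUnique]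
  simp

/-- Labelled arrows with labels in `X'` and prescribed targets, one for each label in `X`. -/
abbrev Family (M : GenMulticat.{u}) {X X' : Type} (ob : X → M.Obj) (ob' : X' → M.Obj) :=
  ∀ x : X, {B : M.Lab ob' // M.tgt B.arr = ob x}

section fill

variable {X X' : Type} {ob : X → M.Obj} {ob' : X' → M.Obj}

abbrev inr (ob : X → M.Obj) (B : M.Lab ob') : M.Lab (Sum.elim ob ob') :=
  B.map Sum.inr fun _ => rfl

abbrev inl (A : M.Lab ob) (ob' : X' → M.Obj) : M.Lab (Sum.elim ob ob') :=
  A.map Sum.inl fun _ => rfl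

/-- One step of the simultaneous composition: fill a source element labelled `x` by `S x`. -/
abbrev step (S : Family M ob ob') (A : M.Lab (Sum.elim ob ob')) (p : Fin (M.arity A.arr)) (x : X)
    (h : A.lab p = .inl x) : M.Lab (Sum.elim ob ob') :=
  A.ins (inr ob (S x).1) p ((S x).2.trans (by rw [h]; rfl))

theorem cnt_step_lt (S : Family M ob ob') (A : M.Lab (Sum.elim ob ob'))
    (p : Fin (M.arity A.arr)) (x : X) (h : A.lab p = .inl x) :
    (A.step S p x h).cnt (fun y => y.isLeft) < A.cnt (fun y => y.isLeft) := by
  have e := A.cnt_ins (inr ob (S x).1) p ((S x).2.trans (by rw [h]; rfl)) (fun y => y.isLeft)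
  have e0 : (inr ob (S x).1).cnt (fun y => y.isLeft = true) = 0 :=
    Finset.sum_eq_zero fun _ _ => if_neg Bool.false_ne_true
  rw [e0, if_pos (by rw [h]; rfl)] at e
  exact Nat.lt_of_lt_of_eq (Nat.lt_succ_self _) e

/-- Fill all source elements with labels `x : X` by the arrows `S x`, one after the other. -/
noncomputable def fill (S : Family M ob ob') (A : M.Lab (Sum.elim ob ob')) : M.Lab ob' :=
  open scoped Classical in
  if h : ∃ p x, A.lab p = .inl x then
    fill S (A.step S h.choose h.choose_spec.choose h.choose_spec.choose_spec)
  else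
    { arr := A.arr
      lab := fun p => (A.lab p).getRight (by
        cases e : A.lab p with
        | inl x => exact (h ⟨p, x, e⟩).elim
        | inr x => rfl)
      src_eq := fun p => (A.src_eq p).trans
        (congrArg (Sum.elim ob ob') (Sum.inr_getRight (A.lab p) _).symm) }
termination_by A.cnt (fun y => y.isLeft)
decreasing_by exact cnt_step_lt _ _ _ _ _

/-- The simultaneous composite `A ∘ (S x)` in `M`, iterating the composition `∘_p`. -/
noncomputable def bind (S : Family M ob ob') (A : M.Lab ob) : M.Lab ob' := fill S (A.inl ob')

theorem fill_inr (S : Family M ob ob') (B : M.Lab ob') : fill S (inr ob B) = B := by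
  rw [fill, dif_neg (by rintro ⟨p, x, h⟩; exact Sum.inr_ne_inl h)]
  rfl

theorem exists_inr (A : M.Lab (Sum.elim ob ob')) (h : ¬ ∃ p x, A.lab p = .inl x) :
    ∃ B : M.Lab ob', A = inr ob B := by
  have h' : ∀ p, ∃ x, A.lab p = .inr x := fun p => by
    cases e : A.lab p with
    | inl x => exact (h ⟨p, x, e⟩).elim
    | inr x => exact ⟨x, rfl⟩
  choose l hl using h'
  refine ⟨⟨A.arr, l, fun p => by rw [A.src_eq, hl]; rfl⟩, ?_⟩
  refine ext_of rfl fun p => ⟨p, rfl, hl p⟩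

theorem fill_induct (S : Family M ob ob') {P : M.Lab (Sum.elim ob ob') → Prop}
    (base : ∀ B, P (inr ob B)) (hstep : ∀ A p x h, P (A.step S p x h) → P A) (A) : P A := by
  induction hn : A.cnt (fun y => y.isLeft) using Nat.strong_induction_on generalizing A with
  | _ n ih =>
    by_cases h : ∃ p x, A.lab p = .inl x
    · obtain ⟨p, x, h⟩ := h
      exact hstep A p x h (ih _ (hn ▸ cnt_step_lt S A p x h) _ rfl)
    · obtain ⟨B, rfl⟩ := exists_inr A h
      exact base B

/-- The order in which the source elements are filled does not matter. -/
theorem fill_step (S : Family M ob ob') (A : M.Lab (Sum.elim ob ob')) (p : Fin (M.arity A.arr))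
    (x : X) (h : A.lab p = .inl x) : fill S (A.step S p x h) = fill S A := by
  induction hn : A.cnt (fun y => y.isLeft) using Nat.strong_induction_on generalizing A x with
  | _ n ih =>
    have key : ∀ p' x' (h' : A.lab p' = .inl x'),
        fill S (A.step S p x h) = fill S (A.step S p' x' h') := by
      intro p' x' h'
      by_cases hp : p = p'
      · subst hp
        obtain rfl : x = x' := Sum.inl_injective (h.symm.trans h')
        rfl
      · have c := ins_comm A (inr ob (S x).1) (inr ob (S x').1) p p' hp
          ((S x).2.trans (by rw [h]; rfl)) ((S x').2.trans (by rw [h']; rfl))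
        have i1 := ih _ (hn ▸ cnt_step_lt S A p x h) (A.step S p x h)
          (A.posL _ p _ p' (Ne.symm hp)) x' ((lab_posL ..).trans h') rfl
        have i2 := ih _ (hn ▸ cnt_step_lt S A p' x' h') (A.step S p' x' h')
          (A.posL _ p' _ p hp) x ((lab_posL ..).trans h) rfl
        exact i1.symm.trans ((congrArg (fill S) c).trans i2)
    have hex : ∃ p x, A.lab p = .inl x := ⟨p, x, h⟩
    rw [fill.eq_def S A, dif_pos hex]
    exact key _ _ _

theorem tgt_fill (S : Family M ob ob') (A : M.Lab (Sum.elim ob ob')) :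
    M.tgt (fill S A).arr = M.tgt A.arr := by
  refine fill_induct S (P := fun A => M.tgt (fill S A).arr = M.tgt A.arr) ?_ ?_ A
  · intro B
    rw [fill_inr]
  · intro A p x h ih
    rw [fill_step] at ih
    exact ih.trans (M.tgt_comp _ _ _ _)

theorem tgt_bind (S : Family M ob ob') (A : M.Lab ob) :
    M.tgt (bind S A).arr = M.tgt A.arr := tgt_fill S _

theorem fill_map {Z Z' : Type} {oz : Z → M.Obj} {oz' : Z' → M.Obj} (S : Family M ob ob')
    (R : Family M oz oz') (g : X → Z) (g' : X' → Z')
    (hg' : ∀ x, ob' x = oz' (g' x)) (hR : ∀ x, (R (g x)).1 = (S x).1.map g' hg')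
    (A : M.Lab (Sum.elim ob ob'))
    (h : ∀ y, Sum.elim ob ob' y = Sum.elim oz oz' (Sum.map g g' y)) :
    fill R (A.map (Sum.map g g') h) = (fill S A).map g' hg' := by
  refine fill_induct S
    (P := fun A => fill R (A.map (Sum.map g g') h) = (fill S A).map g' hg') ?_ ?_ A
  · intro B
    rw [fill_inr]
    exact fill_inr R (B.map g' hg')
  · intro A p x hp ih
    rw [fill_step] at ih
    rw [← ih, step, ins_map]
    have hp' : (A.map (Sum.map g g') h).lab p = .inl (g x) := congrArg (Sum.map g g') hp
    rw [← fill_step R (A.map (Sum.map g g') h) p (g x) hp']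
    congr 1
    simp only [step, hR]
    rfl

theorem bind_map_left {Z : Type} {oz : Z → M.Obj} (R : Family M oz ob') (g : X → Z)
    (hg : ∀ x, ob x = oz (g x)) (A : M.Lab ob) :
    bind R (A.map g hg) = bind (fun x => ⟨(R (g x)).1, (R (g x)).2.trans (hg x).symm⟩) A :=
  fill_map (fun x => ⟨(R (g x)).1, (R (g x)).2.trans (hg x).symm⟩) R g id (fun _ => rfl)
    (fun _ => rfl) (A.inl ob') (by rintro (x | x); exacts [hg x, rfl])

theorem map_bind {Z' : Type} {oz' : Z' → M.Obj} (S : Family M ob ob') (g' : X' → Z')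
    (hg' : ∀ x, ob' x = oz' (g' x)) (A : M.Lab ob) :
    (bind S A).map g' hg' = bind (fun x => ⟨(S x).1.map g' hg', (S x).2⟩) A :=
  (fill_map S (fun x => ⟨(S x).1.map g' hg', (S x).2⟩) id g' hg'
    (fun _ => rfl) (A.inl ob') (by rintro (x | x); exacts [rfl, hg' x])).symm

theorem bind_one_left (S : Family M ob ob') (x : X) : bind S (one ob x) = (S x).1 := by
  have p : Fin (M.arity ((one ob x).inl ob').arr) :=
    ⟨0, Nat.lt_of_lt_of_eq Nat.one_pos (M.arity_id (ob x)).symm⟩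
  rw [bind, ← fill_step S ((one ob x).inl ob') p x rfl]
  exact (congrArg (fill S) (one_ins (ob := Sum.elim ob ob') (.inl x) _ p _)).trans
    (fill_inr S _)

theorem bind_one_right (A : M.Lab ob) :
    bind (fun x => ⟨one ob x, M.tgt_id _⟩) A = A := by
  have h : ∀ y, Sum.elim ob ob y = ob (Sum.elim id id y) := by rintro (x | x) <;> rfl
  refine fill_induct (fun x => ⟨one ob x, M.tgt_id _⟩)
    (P := fun A => fill (fun x => ⟨one ob x, M.tgt_id _⟩) A = A.map (Sum.elim id id) h)
    ?_ ?_ (A.inl ob)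
  · intro B
    rw [fill_inr]
    rfl
  · intro A p x hp ih
    rw [fill_step, step, ins_map] at ih
    rw [ih]
    exact ins_one (A.map (Sum.elim id id) h) p x _ (congrArg (Sum.elim id id) hp).symm

theorem fill_ins (S : Family M ob ob') (A B : M.Lab (Sum.elim ob ob'))
    (p : Fin (M.arity A.arr)) (h : M.tgt B.arr = Sum.elim ob ob' (A.lab p)) :
    fill S (A.ins B p h) = fill S (A.ins (inr ob (fill S B)) p ((tgt_fill S B).trans h)) := by
  revert h
  refine fill_induct S (P := fun B => ∀ h : M.tgt B.arr = Sum.elim ob ob' (A.lab p),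
    fill S (A.ins B p h)
      = fill S (A.ins (inr ob (fill S B)) p ((tgt_fill S B).trans h))) ?_ ?_ B
  · intro B h
    simp only [fill_inr]
  · intro B q x hq ih h
    have ih := ih ((M.tgt_comp _ _ _ _).trans h)
    simp only [fill_step] at ih
    rw [← ih, ← fill_step S (A.ins B p h) (A.posR B p h q) x ((lab_posR ..).trans hq)]
    exact congrArg (fill S) (ins_assoc A B (inr ob (S x).1) p q h _)

theorem bind_bind {X'' : Type} {ob'' : X'' → M.Obj} (S : Family M ob ob')
    (R : Family M ob' ob'') (A : M.Lab ob) :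
    bind R (bind S A)
      = bind (fun x => ⟨bind R (S x).1, (tgt_bind R _).trans (S x).2⟩) A := by
  let V : Family M (Sum.elim ob ob') ob'' := fun y => match y with
    | .inl x => ⟨bind R (S x).1, (tgt_bind R _).trans (S x).2⟩
    | .inr x => R x
  have key : ∀ A : M.Lab (Sum.elim ob ob'), bind R (fill S A) = bind V A := by
    refine fill_induct S ?_ ?_
    · intro B
      rw [fill_inr]
      exact (bind_map_left V Sum.inr (fun _ => rfl) B).symm
    · intro A p x hp ih
      rw [fill_step] at ih
      rw [ih, bind, bind, step, inl, ins_map, fill_ins]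
      have e : fill V (((S x).1.map Sum.inr fun _ => rfl : M.Lab (Sum.elim ob ob')).inl ob'')
          = (V (.inl x)).1 := by
        exact bind_map_left V Sum.inr (fun _ => rfl) (S x).1
      simp only [inr] at e ⊢
      simp only [e]
      exact fill_step V (A.inl ob'') p (.inl x) (congrArg Sum.inl hp)
  exact (key (A.inl ob')).trans (bind_map_left V Sum.inl (fun _ => rfl) A)

open scoped Classical in
theorem cnt_fill [Fintype X] (S : Family M ob ob') (A : M.Lab (Sum.elim ob ob'))
    (P : X' → Prop) :
    (fill S A).cnt P = A.cnt (Sum.elim (fun _ => False) P)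
      + ∑ x, A.cnt (· = .inl x) * (S x).1.cnt P := by
  refine fill_induct S (P := fun A => (fill S A).cnt P = A.cnt (Sum.elim (fun _ => False) P)
      + ∑ x, A.cnt (· = .inl x) * (S x).1.cnt P) ?_ ?_ A
  · intro B
    rw [fill_inr]
    have : ∀ x : X, (inr ob B).cnt (· = .inl x) = 0 := fun x =>
      Finset.sum_eq_zero fun _ _ => if_neg Sum.inr_ne_inl
    simp only [this, zero_mul, Finset.sum_const_zero, add_zero]
    rfl
  · intro A p x hp ih
    rw [fill_step] at ih
    rw [ih]
    have h1 := A.cnt_ins (inr ob (S x).1) p ((S x).2.trans (by rw [hp]; rfl))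
      (Sum.elim (fun _ => False) P)
    have h2 := fun y => A.cnt_ins (inr ob (S x).1) p ((S x).2.trans (by rw [hp]; rfl))
      (· = .inl y)
    have h3 : ∀ y : X, (inr ob (S x).1).cnt (· = .inl y) = 0 := fun x =>
      Finset.sum_eq_zero fun _ _ => if_neg Sum.inr_ne_inl
    have h4 : (inr ob (S x).1).cnt (Sum.elim (fun _ => False) P) = (S x).1.cnt P := rfl
    simp only [hp, Sum.elim_inl, if_false, add_zero, h4] at h1
    simp only [hp, Sum.inl.injEq, h3, add_zero] at h2
    rw [h1]
    simp only [← h2, add_mul, Finset.sum_add_distrib, ite_mul, one_mul, zero_mul,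
      Finset.sum_ite_eq, Finset.mem_univ, if_true]
    ring

theorem cnt_bind [Fintype X] (S : Family M ob ob') (A : M.Lab ob) (P : X' → Prop) :
    (bind S A).cnt P = ∑ x, A.cnt (· = x) * (S x).1.cnt P := by
  rw [bind, cnt_fill]
  have : (A.inl ob').cnt (Sum.elim (fun _ => False) P) = 0 :=
    Finset.sum_eq_zero fun _ _ => if_neg id
  rw [this, zero_add]
  refine Finset.sum_congr rfl fun x _ => ?_
  congr 1
  classical exact Finset.sum_congr rfl fun p _ => by simp only [Sum.inl.injEq]

theorem bind_congr {S S' : Family M ob ob'} (h : ∀ x, (S x).1 = (S' x).1) (A : M.Lab ob) :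
    bind S A = bind S' A := by
  obtain rfl : S = S' := funext fun x => Subtype.ext (h x)
  rfl

end fill

end Lab

end GenMulticat

/-! ### The symmetric multicategory of a generalised multicategory -/

namespace GenMulticat

variable (M : GenMulticat.{u})

/-- The data of `ξ(M)`. An arrow `(x 0, …, x (n - 1)) ⟶ y` is a pair `(f, σ)` of an arrow `f` of
`M` with target `y` and a permutation `σ` (here `lab`) such that the source of `f` is
`(x (σ 0), …, x (σ (n - 1)))`. -/
noncomputable def xiData : SymMulticatData.{u} where
  Obj := Discrete M.Obj
  Hom {n} x y := {A : M.Lab (fun i : Fin n => (x i).as) //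
    Function.Bijective A.lab ∧ M.tgt A.arr = y.as}
  ι {x _} a := ⟨Lab.one (fun _ : Fin 1 => x.as) 0,
    (Fintype.bijective_iff_injective_and_card _).2
      ⟨fun p q _ => by
        have : M.arity (Lab.one (fun _ : Fin 1 => x.as) 0).arr = 1 := M.arity_id _
        ext; omega,
      by simp [M.arity_id]⟩,
    (M.tgt_id _).trans (Discrete.eq_of_hom a)⟩
  comp {k x y m u'} f g := ⟨Lab.bind
      (fun i => ⟨(g i).1.map (fun j => finSigmaFinEquiv ⟨i, j⟩)
        (fun j => (congrArg Discrete.as (concat_mk u' ⟨i, j⟩)).symm), (g i).2.2⟩) f.1,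
    (Lab.bijective_iff _).2 fun q => by
      obtain ⟨⟨i, j⟩, rfl⟩ := finSigmaFinEquiv.surjective q
      rw [Lab.cnt_bind, Finset.sum_eq_single i]
      · rw [(Lab.bijective_iff _).1 f.2.1, one_mul]
        have e : (fun j' => finSigmaFinEquiv (⟨i, j'⟩ : (i : Fin k) × Fin (m i))
            = finSigmaFinEquiv ⟨i, j⟩) = (· = j) := funext fun j' => propext (by simp)
        exact (congrArg (Lab.cnt (g i).1) e).trans ((Lab.bijective_iff _).1 (g i).2.1 j)
      · intro i' _ hne
        refine Nat.mul_eq_zero.2 (.inr (Finset.sum_eq_zero fun _ _ => if_neg ?_))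
        simp [hne]
      · simp,
    (Lab.tgt_bind _ _).trans f.2.2⟩
  act {m n x y} σ f := ⟨f.1.map σ.symm (by simp),
    σ.symm.bijective.comp f.2.1, f.2.2⟩

theorem xi_ext_reindex {m n : ℕ} {x : Fin n → M.xiData.Obj} {x' : Fin m → M.xiData.Obj}
    {y : M.xiData.Obj} (σ : Fin m ≃ Fin n) (h : ∀ i, x' i = x (σ i)) (f : M.xiData.Hom x y)
    (g : M.xiData.Hom x' y) (hg : g.1 = f.1.map σ.symm (by simp [h])) :
    g = M.xiData.reindex σ h f := by
  obtain rfl : x' = fun i => x (σ i) := funext h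
  exact Subtype.ext hg

/-- The symmetric multicategory `ξ(M)`. -/
noncomputable def xi : SymMulticat.{u} where
  toSymMulticatData := M.xiData
  id_comp f := by
    refine xi_ext_reindex _ _ _ _ _ ((Lab.bind_one_left _ _).trans ?_)
    exact Lab.ext_of rfl fun p => ⟨p, rfl, rfl⟩
  comp_id {n x y} f := by
    refine xi_ext_reindex _ _ _ _ _ ?_
    refine Eq.trans ?_ (congrArg (fun A => Lab.map (sumOneEquiv n).symm _ A)
      (Lab.bind_one_right f.1))
    refine Eq.trans ?_ (Lab.map_bind _ _ _ _).symm
    refine Lab.bind_congr (fun i => ?_) _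
    refine Lab.ext_of rfl fun p => ⟨p, rfl, ?_⟩
    rfl
  assoc {k x y m u' l v} f g h := by
    refine xi_ext_reindex _ _ _ _ _ ((Lab.bind_bind _ _ _).trans ?_)
    refine Eq.trans ?_ (Lab.map_bind _ _ _ _).symm
    refine Lab.bind_congr (fun i => ?_) _
    dsimp only [xiData]
    refine (Lab.bind_map_left _ _ _ _).trans ?_
    refine Eq.trans ?_ (congrArg (fun A => Lab.map (assocEquiv l).symm _ A)
      (Lab.map_bind _ _ _ _)).symm
    refine Eq.trans ?_ (Lab.map_bind _ _ _ _).symm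
    refine Lab.bind_congr (fun j => ?_) _
    have hG : ∀ i j (r : Fin (l i j)), (v i j r).as
        = (concat (m := concat l)
            (fun q => v (finSigmaFinEquiv.symm q).1 (finSigmaFinEquiv.symm q).2)
            ((assocEquiv l).symm (finSigmaFinEquiv ⟨i, finSigmaFinEquiv ⟨j, r⟩⟩))).as := by
      intro i j r
      rw [← concat_assocEquiv v, Equiv.apply_symm_apply]
      exact congrArg Discrete.as
        ((concat_mk (fun i => concat (v i)) ⟨i, _⟩).trans (concat_mk (v i) ⟨j, r⟩)).symm
    refine Eq.trans ?_ (concat_mk (fun i j => (h i j).1.map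
      (fun r => (assocEquiv l).symm (finSigmaFinEquiv ⟨i, finSigmaFinEquiv ⟨j, r⟩⟩))
      (hG i j)) ⟨i, j⟩)
    refine Lab.ext_of rfl fun p => ⟨p, rfl, ?_⟩
    refine ((assocEquiv l).symm_apply_eq.2 ?_).symm
    exact assocEquiv_mk l _ _
  act_refl f := rfl
  act_act f σ σ' := rfl
  act_comp {k k' x y m u'} f g σ := by
    refine xi_ext_reindex _ _ _ _ _ ?_
    dsimp only [xiData]
    refine ((Lab.bind_map_left _ _ _ _).trans ?_)
    refine Eq.trans ?_ (Lab.map_bind _ _ _ _).symm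
    refine Lab.bind_congr (fun i => ?_) _
    obtain ⟨i, rfl⟩ := σ.surjective i
    have h1 : ∀ i' (j : Fin (m (σ i'))), (u' (σ i') j).as
        = (concat (fun i => u' (σ i)) (finSigmaFinEquiv ⟨i', j⟩)).as := fun i' j =>
      (congrArg Discrete.as (concat_mk (fun i => u' (σ i)) ⟨i', j⟩)).symm
    have key : ∀ i' (_ : i' = i),
        (g (σ i')).1.map (ob' := fun q => (concat (fun i => u' (σ i)) q).as)
          (fun j => finSigmaFinEquiv ⟨i', j⟩) (h1 i')
        = (g (σ i)).1.map (fun j => (blockEquiv m σ).symm (finSigmaFinEquiv ⟨σ i, j⟩))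
          (fun j => by rw [blockEquiv_symm_mk]; exact h1 i j) := by
      rintro _ rfl
      exact Lab.map_congr (fun j => (blockEquiv_symm_mk _ _ _ _).symm) _ _ _
    exact key _ (σ.symm_apply_apply i)
  comp_act f g σ := by
    refine xi_ext_reindex _ _ _ _ _ ?_
    refine Eq.trans ?_ (Lab.map_bind _ _ _ _).symm
    refine Lab.bind_congr (fun i => ?_) _
    refine Lab.ext_of rfl fun p => ⟨p, rfl, ?_⟩
    dsimp only [xiData]
    exact ((juxtEquiv σ).symm_apply_eq.2 (by simp [juxtEquiv])).symm
  ι_comp a b := by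
    refine xi_ext_reindex _ _ _ _ _ ((Lab.bind_one_left _ _).trans ?_)
    exact Lab.ext_of rfl fun p => ⟨p, rfl, rfl⟩

end GenMulticat

/-! ### Calculus of arrows of a symmetric multicategory -/

namespace SymMulticat

variable (Q : SymMulticat.{u})

theorem reindex_refl {n : ℕ} {x : Fin n → Q.Obj} {y : Q.Obj} (f : Q.Hom x y) (h) :
    Q.reindex (Equiv.refl _) h f = f := Q.act_refl f

theorem reindex_reindex {l m n : ℕ} {x : Fin n → Q.Obj} {x' : Fin m → Q.Obj}
    {x'' : Fin l → Q.Obj} {y : Q.Obj} (σ : Fin m ≃ Fin n) (h : ∀ i, x' i = x (σ i))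
    (σ' : Fin l ≃ Fin m) (h' : ∀ i, x'' i = x' (σ' i)) (f : Q.Hom x y) :
    Q.reindex σ' h' (Q.reindex σ h f)
      = Q.reindex (σ'.trans σ) (fun i => (h' i).trans (h _)) f := by
  obtain rfl : x' = fun i => x (σ i) := funext h
  obtain rfl : x'' = fun i => x (σ (σ' i)) := funext h'
  exact Q.act_act f σ σ'

theorem reindex_congr {m n : ℕ} {x : Fin n → Q.Obj} {x' : Fin m → Q.Obj} {y : Q.Obj}
    {σ σ' : Fin m ≃ Fin n} (hσ : ∀ i, σ i = σ' i) (h : ∀ i, x' i = x (σ i))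
    (h' : ∀ i, x' i = x (σ' i)) (f : Q.Hom x y) : Q.reindex σ h f = Q.reindex σ' h' f := by
  obtain rfl : σ = σ' := Equiv.ext hσ
  rfl

theorem reindex_symm_reindex {m n : ℕ} {x : Fin n → Q.Obj} {x' : Fin m → Q.Obj} {y : Q.Obj}
    (σ : Fin m ≃ Fin n) (h : ∀ i, x' i = x (σ i)) (h') (f : Q.Hom x y) :
    Q.reindex σ.symm h' (Q.reindex σ h f) = f := by
  rw [reindex_reindex]
  exact (Q.reindex_congr (σ' := Equiv.refl _) (by simp) _ (fun _ => rfl) f).trans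
    (Q.reindex_refl f _)

theorem reindex_reindex_symm {m n : ℕ} {x : Fin n → Q.Obj} {x' : Fin m → Q.Obj} {y : Q.Obj}
    (σ : Fin n ≃ Fin m) (h : ∀ i, x' i = x (σ.symm i)) (h') (f : Q.Hom x y) :
    Q.reindex σ h' (Q.reindex σ.symm h f) = f := by
  rw [reindex_reindex]
  exact (Q.reindex_congr (σ' := Equiv.refl _) (by simp) _ (fun _ => rfl) f).trans
    (Q.reindex_refl f _)

theorem comp_reindex {k : ℕ} {x : Fin k → Q.Obj} {y : Q.Obj} {m m' : Fin k → ℕ}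
    {u : ∀ i, Fin (m i) → Q.Obj} {u' : ∀ i, Fin (m' i) → Q.Obj} (f : Q.Hom x y)
    (g : ∀ i, Q.Hom (u i) (x i)) (σ : ∀ i, Fin (m' i) ≃ Fin (m i))
    (h : ∀ i j, u' i j = u i (σ i j)) :
    Q.comp f (fun i => Q.reindex (σ i) (h i) (g i))
      = Q.reindex (juxtEquiv σ) (fun j => (h _ _).trans (concat_juxt u σ j))
          (Q.comp f g) := by
  obtain rfl : u' = fun i j => u i (σ i j) := funext fun i => funext (h i)
  exact Q.comp_act f g σ

theorem reindex_comp {k k' : ℕ} {x : Fin k → Q.Obj} {x' : Fin k' → Q.Obj} {y : Q.Obj}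
    {m : Fin k → ℕ} {u : ∀ i, Fin (m i) → Q.Obj} (f : Q.Hom x y)
    (g : ∀ i, Q.Hom (u i) (x i)) (σ : Fin k' ≃ Fin k) (h : x' = fun i => x (σ i))
    (g' : ∀ i, Q.Hom (u (σ i)) (x' i)) (hg : ∀ i, HEq (g' i) (g (σ i))) :
    Q.comp (Q.reindex σ (congrFun h) f) g'
      = Q.reindex (blockEquiv m σ) (concat_block u σ) (Q.comp f g) := by
  subst h
  obtain rfl : g' = fun i => g (σ i) := funext fun i => eq_of_heq (hg i)
  exact Q.act_comp f g σ

/-- The composite `ι(a) ∘ f`. -/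
def post {n : ℕ} {x : Fin n → Q.Obj} {y z : Q.Obj} (a : y ⟶ z) (f : Q.Hom x y) : Q.Hom x z :=
  Q.reindex (oneSumEquiv n).symm (concat_one_symm x)
    (Q.comp (Q.ι a) (fun _ => f))

theorem comp_ι {n : ℕ} {x : Fin n → Q.Obj} {y z : Q.Obj} (a : y ⟶ z) (f : Q.Hom x y) :
    Q.comp (Q.ι a) (fun _ => f) = Q.reindex (oneSumEquiv n) (concat_one x) (Q.post a f) := by
  rw [post, reindex_reindex_symm]

theorem post_id {n : ℕ} {x : Fin n → Q.Obj} {y : Q.Obj} (f : Q.Hom x y) :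
    Q.post (𝟙 y) f = f := by
  rw [post, Q.id_comp, reindex_symm_reindex]

theorem post_ι {x y z : Q.Obj} (a : x ⟶ y) (b : y ⟶ z) :
    Q.post b (Q.ι a) = Q.ι (a ≫ b) := by
  rw [post, Q.ι_comp, reindex_symm_reindex]

theorem post_reindex {m n : ℕ} {x : Fin n → Q.Obj} {x' : Fin m → Q.Obj} {y z : Q.Obj}
    (a : y ⟶ z) (σ : Fin m ≃ Fin n) (h : ∀ i, x' i = x (σ i)) (f : Q.Hom x y) :
    Q.post a (Q.reindex σ h f) = Q.reindex σ h (Q.post a f) := by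
  have e := Q.comp_reindex (Q.ι a) (fun _ => f) (fun _ : Fin 1 => σ) (fun _ => h)
  rw [post, e, post, reindex_reindex, reindex_reindex]
  refine Q.reindex_congr (fun i => ?_) _ _ _
  simp [juxtEquiv, oneSumEquiv]

theorem post_comp {k : ℕ} {x : Fin k → Q.Obj} {y z : Q.Obj} {m : Fin k → ℕ}
    {u : ∀ i, Fin (m i) → Q.Obj} (a : y ⟶ z) (f : Q.Hom x y) (g : ∀ i, Q.Hom (u i) (x i)) :
    Q.post a (Q.comp f g) = Q.comp (Q.post a f) g := by
  have h1 := Q.assoc (Q.ι a) (fun _ => f) (fun _ => g)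
  rw [Q.comp_ι a (Q.comp f g), reindex_reindex] at h1
  have h2 := Q.reindex_comp (Q.post a f) g (oneSumEquiv k) rfl
    (fun q => g (oneSumEquiv k q)) (fun _ => HEq.rfl)
  have h3 : Q.reindex (blockEquiv m (oneSumEquiv k)) (concat_block u (oneSumEquiv k))
      (Q.comp (Q.post a f) g) = Q.reindex (blockEquiv m (oneSumEquiv k))
        (concat_block u (oneSumEquiv k)) (Q.post a (Q.comp f g)) := by
    refine (h2.symm.trans ?_).trans (h1.trans (Q.reindex_congr (fun j => ?_) _ _ _))
    · exact congrArg (fun w => Q.comp (m := fun q => m (oneSumEquiv k q)) w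
        (fun q => g (oneSumEquiv k q))) (Q.comp_ι a f).symm
    · obtain ⟨⟨q, r⟩, rfl⟩ := finSigmaFinEquiv.surjective j
      simp only [Equiv.trans_apply]
      rw [← assocEquiv_mk]
      refine Eq.trans ?_ ((Equiv.symm_apply_eq _).1 (blockEquiv_symm_mk m (oneSumEquiv k) q r))
      exact oneSumEquiv_mk _ _
  have h4 := congrArg (Q.reindex (blockEquiv m (oneSumEquiv k)).symm
    (x' := concat u) (fun j => by rw [concat_block, Equiv.apply_symm_apply])) h3
  rw [reindex_symm_reindex, reindex_symm_reindex] at h4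
  exact h4.symm

theorem post_post {n : ℕ} {x : Fin n → Q.Obj} {y z w : Q.Obj} (a : y ⟶ z) (b : z ⟶ w)
    (f : Q.Hom x y) : Q.post b (Q.post a f) = Q.post (a ≫ b) f := by
  have h : Q.post a f = Q.reindex (oneSumEquiv n).symm
    (concat_one_symm x) (Q.comp (Q.ι a) (fun _ => f)) := rfl
  rw [h, post_reindex, post_comp, post_ι]
  rfl

end SymMulticat

namespace SymMulticat

/-! ### The category of elements -/

variable (Q : SymMulticat.{u})

/-- The arrows of `Q`, with their sources and targets. -/
structure Elt where
  arity : ℕ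
  src : Fin arity → Q.Obj
  tgt : Q.Obj
  hom : Q.Hom src tgt

variable {Q}

/-- The action of the arrow `(σ, l; r) : (x; y) ⟶ (x'; y')`, where `l i : x' (σ i) ⟶ x i` and
`r : y ⟶ y'`, on an arrow `g` of `Q`: the composite `ι(r) ∘ g ∘ (ι(l 0), …, ι(l (n - 1)))` has
source `(x' (σ 0), …, x' (σ (n - 1)))`, and this is permuted to `x'`. -/
def transport {n n' : ℕ} {x : Fin n → Q.Obj} {x' : Fin n' → Q.Obj} {y y' : Q.Obj}
    (σ : Fin n ≃ Fin n') (l : ∀ i, x' (σ i) ⟶ x i) (r : y ⟶ y') (g : Q.Hom x y) :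
    Q.Hom x' y' :=
  Q.reindex (σ.symm.trans (sumOneEquiv n).symm)
    (fun i => by
      rw [Equiv.trans_apply, ← concat_sumOne_symm (fun i => x' (σ i)), Equiv.apply_symm_apply])
    (Q.post r (Q.comp g (fun i => Q.ι (l i))))

/-- The morphisms of the category of elements of `Q`. -/
@[ext]
structure Elt.Mor (g g' : Q.Elt) where
  perm : Fin g.arity ≃ Fin g'.arity
  left : ∀ i, g'.src (perm i) ⟶ g.src i
  right : g.tgt ⟶ g'.tgt
  w : transport perm left right g.hom = g'.hom

/-! ### Configurations -/

/-- Planar trees, presented as follows. Nodes carry labels in `N` and leaves carry labels in `L`.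
The node label `ν` stands for the arrow `F ν` of `Q`, the leaf label `ℓ` for the object `x ℓ`.
The inputs of a node labelled `ν` are the source elements of `F ν`, in their order. Every edge
carries an object-morphism `a`, from the object at its upper end to the object at its lower end;
`Tree F x z` consists of the trees whose root edge ends at `z`. -/
inductive Tree {N L : Type} (F : N → Q.Elt) (x : L → Q.Obj) : Q.Obj → Type u
  | edge (ℓ : L) {z : Q.Obj} (a : x ℓ ⟶ z) : Tree F x z
  | node (ν : N) {z : Q.Obj} (a : (F ν).tgt ⟶ z) (t : ∀ i, Tree F x ((F ν).src i)) : Tree F x z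

namespace Tree

variable {N L : Type} {F : N → Q.Elt} {x : L → Q.Obj} {z : Q.Obj}

/-- The labels of the nodes, in depth-first planar order. -/
def nodes : {z : Q.Obj} → Tree F x z → List N
  | _, edge _ _ => []
  | _, node ν _ t => ν :: (List.ofFn fun i => (t i).nodes).flatten

/-- The number of leaves. -/
def numLeaves : {z : Q.Obj} → Tree F x z → ℕ
  | _, edge _ _ => 1
  | _, node _ _ t => ∑ i, (t i).numLeaves

/-- The labels of the leaves, in planar order. -/
def leaf : {z : Q.Obj} → (T : Tree F x z) → Fin T.numLeaves → L
  | _, edge ℓ _ => fun _ => ℓ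
  | _, node _ _ t => concat fun i => (t i).leaf

/-- The composite in `Q` of the arrows at the nodes, the edge labels acting through `ι`. Its
source lists the leaves in planar order. -/
def eval : {z : Q.Obj} → (T : Tree F x z) → Q.Hom (fun i => x (T.leaf i)) z
  | _, edge _ a => Q.ι a
  | _, node ν a t => Q.post a (Q.comp (F ν).hom fun i => (t i).eval)

/-- `T.EvalsTo l f` holds if `f` is the composite of `T` with the leaves reordered by a
permutation `ρ` such that their labels become `(l 0, …, l (n - 1))`. -/
def EvalsTo (T : Tree F x z) {n : ℕ} (l : Fin n → L) (f : Q.Hom (fun i => x (l i)) z) : Prop :=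
  ∃ (ρ : Fin n ≃ Fin T.numLeaves) (h : ∀ i, l i = T.leaf (ρ i)),
    f = Q.reindex ρ (fun i => congrArg x (h i)) T.eval

theorem EvalsTo.eval (T : Tree F x z) : T.EvalsTo T.leaf T.eval :=
  ⟨Equiv.refl _, fun _ => rfl, (Q.reindex_refl _ _).symm⟩

theorem EvalsTo.reindex {T : Tree F x z} {n m : ℕ} {l : Fin n → L} {l' : Fin m → L}
    {f : Q.Hom (fun i => x (l i)) z} (hf : T.EvalsTo l f) (σ : Fin m ≃ Fin n)
    (h : ∀ i, l' i = l (σ i)) :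
    T.EvalsTo l' (Q.reindex σ (fun i => congrArg x (h i)) f) := by
  obtain ⟨ρ, hρ, rfl⟩ := hf
  exact ⟨σ.trans ρ, fun i => (h i).trans (hρ _), Q.reindex_reindex _ _ _ _ _⟩

/-- Composition of the root edge with an object-morphism. -/
def post : {z w : Q.Obj} → Tree F x z → (z ⟶ w) → Tree F x w
  | _, _, edge ℓ a, b => edge ℓ (a ≫ b)
  | _, _, node ν a t, b => node ν (a ≫ b) t

theorem post_id (T : Tree F x z) : T.post (𝟙 z) = T := by
  cases T <;> simp [post]

theorem post_post {w v : Q.Obj} (T : Tree F x z) (a : z ⟶ w) (b : w ⟶ v) :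
    (T.post a).post b = T.post (a ≫ b) := by
  cases T <;> simp [post]

theorem nodes_post {w : Q.Obj} (T : Tree F x z) (a : z ⟶ w) : (T.post a).nodes = T.nodes := by
  cases T <;> simp [post, nodes]

theorem EvalsTo.edge (ℓ : L) (a : x ℓ ⟶ z) :
    (Tree.edge ℓ a : Tree F x z).EvalsTo (fun _ : Fin 1 => ℓ) (Q.ι a) :=
  EvalsTo.eval (F := F) (Tree.edge ℓ a)

theorem EvalsTo.node (ν : N) (a : (F ν).tgt ⟶ z) (t : ∀ i, Tree F x ((F ν).src i))
    {m : Fin (F ν).arity → ℕ} {l : ∀ i, Fin (m i) → L}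
    {f : ∀ i, Q.Hom (fun j => x (l i j)) ((F ν).src i)} (hf : ∀ i, (t i).EvalsTo (l i) (f i)) :
    (Tree.node ν a t).EvalsTo (concat l) (Q.post a (Q.comp (F ν).hom f)) := by
  choose ρ hρ e using hf
  obtain rfl := funext e
  have e1 := Q.comp_reindex (F ν).hom (fun i => (t i).eval) ρ (fun i j => congrArg x (hρ i j))
  have e2 := congrArg (Q.post a) e1
  have e3 := Q.post_reindex a (juxtEquiv ρ)
    (fun j => (congrArg x (hρ _ _)).trans (concat_juxt (fun i j => x ((t i).leaf j)) ρ j))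
    (Q.comp (F ν).hom fun i => (t i).eval)
  have h := (EvalsTo.eval (Tree.node ν a t)).reindex (juxtEquiv ρ)
    (fun i => (hρ _ _).trans (concat_juxt (fun i => (t i).leaf) ρ i))
  exact (e2.trans e3) ▸ h

theorem EvalsTo.post {w : Q.Obj} {T : Tree F x z} {n : ℕ} {l : Fin n → L}
    {f : Q.Hom (fun i => x (l i)) z} (hf : T.EvalsTo l f) (a : z ⟶ w) :
    (T.post a).EvalsTo l (Q.post a f) := by
  obtain ⟨ρ, hρ, rfl⟩ := hf
  rw [Q.post_reindex]
  cases T with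
  | edge ℓ b =>
    have h := (EvalsTo.edge (F := F) ℓ (b ≫ a)).reindex ρ hρ
    rw [← Q.post_ι] at h
    exact h
  | node ν b t =>
    have h := (EvalsTo.eval (Tree.node ν (b ≫ a) t)).reindex ρ hρ
    have e : (Tree.node ν (b ≫ a) t).eval = Q.post a (Tree.node ν b t).eval :=
      (Q.post_post _ _ _).symm
    rw [e] at h
    exact h

/-- Replacement of the leaves labelled `ℓ` by the tree `s ℓ`, for all `ℓ`. -/
def graft {L' : Type} {x' : L' → Q.Obj} :
    {z : Q.Obj} → Tree F x z → (∀ ℓ, Tree F x' (x ℓ)) → Tree F x' z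
  | _, edge ℓ a, s => (s ℓ).post a
  | _, node ν a t, s => node ν a fun i => (t i).graft s

theorem graft_post {L' : Type} {x' : L' → Q.Obj} {w : Q.Obj} (T : Tree F x z) (a : z ⟶ w)
    (s : ∀ ℓ, Tree F x' (x ℓ)) : (T.post a).graft s = (T.graft s).post a := by
  cases T with
  | edge ℓ b => exact (post_post _ _ _).symm
  | node ν b t => rfl

theorem graft_edge (T : Tree F x z) : T.graft (fun ℓ => edge ℓ (𝟙 (x ℓ))) = T := by
  induction T with
  | edge ℓ a => simp [graft, post]
  | node ν a t ih => simp [graft, ih]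

theorem graft_graft {L' L'' : Type} {x' : L' → Q.Obj} {x'' : L'' → Q.Obj} (T : Tree F x z)
    (s : ∀ ℓ, Tree F x' (x ℓ)) (s' : ∀ ℓ, Tree F x'' (x' ℓ)) :
    (T.graft s).graft s' = T.graft (fun ℓ => (s ℓ).graft s') := by
  induction T with
  | edge ℓ a => simp [graft, graft_post]
  | node ν a t ih => simp [graft, ih]

theorem EvalsTo.graft {L' : Type} {x' : L' → Q.Obj} {T : Tree F x z} {n : ℕ} {l : Fin n → L}
    {f : Q.Hom (fun i => x (l i)) z} (hf : T.EvalsTo l f) {s : ∀ ℓ, Tree F x' (x ℓ)}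
    {m : Fin n → ℕ} {l' : ∀ i, Fin (m i) → L'}
    {f' : ∀ i, Q.Hom (fun j => x' (l' i j)) (x (l i))}
    (hs : ∀ i, (s (l i)).EvalsTo (l' i) (f' i)) :
    (T.graft s).EvalsTo (concat l') (Q.comp f f') := by
  have key : (T.graft s).EvalsTo (concat fun i => (s (T.leaf i)).leaf)
      (Q.comp T.eval fun i => (s (T.leaf i)).eval) := by
    clear hf hs f f' l'
    induction T with
    | edge ℓ a =>
      have h := ((EvalsTo.eval (s ℓ)).post a).reindex (oneSumEquiv _)
        (concat_one (s ℓ).leaf)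
      have e := Q.comp_ι a (s ℓ).eval
      exact e ▸ h
    | node ν a t ih =>
      have h := (EvalsTo.node ν a _ ih).reindex
        (assocEquiv fun i j => (s ((t i).leaf j)).numLeaves)
        (fun q => (concat_assocEquiv (fun i j => (s ((t i).leaf j)).leaf) q).symm)
      rw [← Q.post_reindex] at h
      have e := Q.assoc (F ν).hom (fun i => (t i).eval) (fun i j => (s ((t i).leaf j)).eval)
      have e' := Q.post_comp a (Q.comp (F ν).hom (fun i => (t i).eval))
        (fun q => (s ((Tree.node ν a t).leaf q)).eval)
      have h2 := (congrArg (Q.post a) e).symm.trans e'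
      exact h2 ▸ h
  obtain ⟨ρ, hρ, rfl⟩ := hf
  obtain rfl : l = fun i => T.leaf (ρ i) := funext hρ
  choose ρ' hρ' e using hs
  obtain rfl := funext e
  have e1 := Q.comp_reindex (Q.reindex ρ (fun i => congrArg x (hρ i)) T.eval)
    (fun i => (s (T.leaf (ρ i))).eval) ρ' (fun i j => congrArg x' (hρ' i j))
  have e2 := Q.reindex_comp T.eval (fun i => (s (T.leaf i)).eval) ρ rfl
    (fun i => (s (T.leaf (ρ i))).eval) (fun _ => HEq.rfl)
  have e3 := e1.trans (congrArg (Q.reindex (juxtEquiv ρ') _) e2)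
  have h := (key.reindex (blockEquiv _ ρ) (concat_block (fun i => (s (T.leaf i)).leaf) ρ)).reindex
    (juxtEquiv ρ') (fun i => (hρ' _ _).trans
      (concat_juxt (fun i => (s (T.leaf (ρ i))).leaf) ρ' i))
  exact e3 ▸ h

/-- Replacement of the nodes labelled `ν` by the tree `S ν`, for all `ν`. The source elements of
`F ν` are the labels of the leaves of `S ν`: the subtree above the `i`-th input of a node labelled
`ν` is grafted onto the leaf labelled `i`. -/
def subst {N' : Type} {F' : N' → Q.Elt} (S : ∀ ν, Tree F' (F ν).src (F ν).tgt) :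
    {z : Q.Obj} → Tree F x z → Tree F' x z
  | _, edge ℓ a => edge ℓ a
  | _, node ν a t => ((S ν).graft fun i => (t i).subst S).post a

theorem subst_post {N' : Type} {F' : N' → Q.Elt} (S : ∀ ν, Tree F' (F ν).src (F ν).tgt)
    {w : Q.Obj} (T : Tree F x z) (a : z ⟶ w) :
    (T.post a).subst S = (T.subst S).post a := by
  cases T with
  | edge ℓ b => rfl
  | node ν b t => exact (post_post _ _ _).symm

theorem subst_graft {N' : Type} {F' : N' → Q.Elt} (S : ∀ ν, Tree F' (F ν).src (F ν).tgt)
    {L' : Type} {x' : L' → Q.Obj} (T : Tree F x z) (s : ∀ ℓ, Tree F x' (x ℓ)) :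
    (T.graft s).subst S = (T.subst S).graft (fun ℓ => (s ℓ).subst S) := by
  induction T with
  | edge ℓ a => simp [graft, subst, subst_post]
  | node ν a t ih => simp [graft, subst, ih, graft_post, graft_graft]

theorem subst_subst {N' N'' : Type} {F' : N' → Q.Elt} {F'' : N'' → Q.Elt}
    (S : ∀ ν, Tree F' (F ν).src (F ν).tgt) (S' : ∀ ν, Tree F'' (F' ν).src (F' ν).tgt)
    (T : Tree F x z) : (T.subst S).subst S' = T.subst (fun ν => (S ν).subst S') := by
  induction T with
  | edge ℓ a => simp [subst]
  | node ν a t ih => simp [subst, ih, subst_post, subst_graft]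

/-- The tree with one node and with identities as edge labels. -/
def corolla (F : N → Q.Elt) (ν : N) : Tree F (F ν).src (F ν).tgt :=
  node ν (𝟙 _) fun i => edge i (𝟙 _)

theorem corolla_subst {N' : Type} {F' : N' → Q.Elt} (S : ∀ ν, Tree F' (F ν).src (F ν).tgt)
    (ν : N) : (corolla F ν).subst S = S ν := by
  simp [corolla, subst, graft_edge, post_id]

theorem subst_corolla (T : Tree F x z) : T.subst (corolla F) = T := by
  induction T with
  | edge ℓ a => simp [subst]
  | node ν a t ih =>
    have h : (fun i => ((t i).subst (corolla F)).post (𝟙 _)) = t :=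
      funext fun i => (post_id _).trans (ih i)
    exact (congrArg (node ν _) h).trans (congrArg (fun a => node ν a t) (Category.id_comp a))

theorem EvalsTo.subst {N' : Type} {F' : N' → Q.Elt} {S : ∀ ν, Tree F' (F ν).src (F ν).tgt}
    (hS : ∀ ν, (S ν).EvalsTo id (F ν).hom) {T : Tree F x z} {n : ℕ} {l : Fin n → L}
    {f : Q.Hom (fun i => x (l i)) z} (hf : T.EvalsTo l f) : (T.subst S).EvalsTo l f := by
  have key : (T.subst S).EvalsTo T.leaf T.eval := by
    clear hf f
    induction T with
    | edge ℓ a => exact EvalsTo.edge ℓ a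
    | node ν a t ih =>
      exact (EvalsTo.graft (s := fun i => (t i).subst S) (l := id) (hS ν) ih).post a
  obtain ⟨ρ, hρ, rfl⟩ := hf
  exact key.reindex ρ hρ

theorem evalsTo_node_edge (e' : Q.Elt) {F : N → Q.Elt} (ν : N)
    (σ : Fin (F ν).arity ≃ Fin e'.arity)
    (l : ∀ i, e'.src (σ i) ⟶ (F ν).src i) (r : (F ν).tgt ⟶ e'.tgt) :
    (node ν r (fun i => edge (σ i) (l i)) : Tree F e'.src e'.tgt).EvalsTo id
      (transport σ l r (F ν).hom) :=
  ⟨σ.symm.trans (sumOneEquiv _).symm, fun i => by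
      refine Eq.trans ?_ (concat_sumOne_symm (fun i => σ i) _)
      simp, rfl⟩

end Tree

end SymMulticat

namespace SymMulticat

variable {Q : SymMulticat.{u}}

theorem transport_id {n : ℕ} {x : Fin n → Q.Obj} {y : Q.Obj} (g : Q.Hom x y) :
    transport (Equiv.refl (Fin n)) (fun i => 𝟙 (x i)) (𝟙 y) g = g := by
  refine Eq.trans (congrArg (Q.reindex _ _)
    ((Q.post_id _).trans (Q.comp_id g))) ((Q.reindex_reindex _ _ _ _ _).trans ?_)
  exact (Q.reindex_congr (σ' := Equiv.refl _) (by simp) _ (fun _ => rfl) _).trans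
    (Q.reindex_refl _ _)

theorem sum_concat {A : Type*} [AddCommMonoid A] {k : ℕ} {m : Fin k → ℕ}
    (v : ∀ i, Fin (m i) → A) : ∑ p, concat v p = ∑ i, ∑ j, v i j := by
  rw [← finSigmaFinEquiv.sum_comp, Fintype.sum_sigma]
  exact Finset.sum_congr rfl fun i _ => Finset.sum_congr rfl fun j _ => concat_mk v ⟨i, j⟩

theorem coe_flatten {A : Type*} {n : ℕ} (f : Fin n → List A) :
    ((List.ofFn f).flatten : Multiset A) = ∑ i, (f i : Multiset A) := by
  induction n with
  | zero => simp
  | succ n ihn =>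
    rw [List.ofFn_succ, List.flatten_cons, ← Multiset.coe_add, ihn, Fin.sum_univ_succ]

theorem sum_bind {A B ι : Type*} (s : Finset ι) (v : ι → Multiset A) (f : A → Multiset B) :
    ∑ i ∈ s, (v i).bind f = (∑ i ∈ s, v i).bind f := by
  classical
  induction s using Finset.induction_on with
  | empty => simp
  | insert a s ha ih => rw [Finset.sum_insert ha, Finset.sum_insert ha, Multiset.add_bind, ih]

namespace Tree

variable {N L : Type} {F : N → Q.Elt} {x : L → Q.Obj} {z : Q.Obj}

theorem EvalsTo.unique {T : Tree F x z} {n : ℕ} {l : Fin n → L} (hl : Function.Injective l)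
    {f f' : Q.Hom (fun i => x (l i)) z} (hf : T.EvalsTo l f) (hf' : T.EvalsTo l f') : f = f' := by
  obtain ⟨ρ, hρ, rfl⟩ := hf
  obtain ⟨ρ', hρ', rfl⟩ := hf'
  refine Q.reindex_congr (fun i => ?_) _ _ _
  obtain ⟨j, hj⟩ := ρ.surjective (ρ' i)
  have : l j = l i := by rw [hρ, hρ', hj]
  rw [← hj, hl this]

theorem subst_congr {N' : Type} {F' : N' → Q.Elt} {S S' : ∀ ν, Tree F' (F ν).src (F ν).tgt}
    (T : Tree F x z) (h : ∀ ν ∈ T.nodes, S ν = S' ν) : T.subst S = T.subst S' := by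
  induction T with
  | edge ℓ a => rfl
  | node ν a t ih =>
    have h1 : S ν = S' ν := h ν (by simp [nodes])
    have h2 : (fun i => (t i).subst S) = fun i => (t i).subst S' := funext fun i =>
      ih i fun ν' hν' => h ν' <| by
        simp only [nodes, List.mem_cons, List.mem_flatten, List.mem_ofFn']
        exact .inr ⟨_, ⟨i, rfl⟩, hν'⟩
    simp only [subst, h1, h2]

/-- The identification of trees whose boundaries are given by equal arrows. -/
def castT {e e' : Q.Elt} (h : e = e') (T : Tree F e.src e.tgt) : Tree F e'.src e'.tgt :=
  cast (congrArg (fun e : Q.Elt => Tree F e.src e.tgt) h) T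

theorem castT_castT {e e' e'' : Q.Elt} (h : e = e') (h' : e' = e'') (T : Tree F e.src e.tgt) :
    castT h' (castT h T) = castT (h.trans h') T := by subst h h'; rfl

theorem castT_subst {N' : Type} {F' : N' → Q.Elt} (S : ∀ ν, Tree F' (F ν).src (F ν).tgt)
    {e e' : Q.Elt} (h : e = e') (T : Tree F e.src e.tgt) :
    (castT h T).subst S = castT h (T.subst S) := by subst h; rfl

theorem nodes_castT {e e' : Q.Elt} (h : e = e') (T : Tree F e.src e.tgt) :
    (castT h T).nodes = T.nodes := by subst h; rfl

theorem EvalsTo.castT {e e' : Q.Elt} (h : e = e') {T : Tree F e.src e.tgt}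
    (hT : T.EvalsTo id e.hom) : (castT h T).EvalsTo id e'.hom := by subst h; exact hT

theorem evalsTo_corolla (F : N → Q.Elt) (ν : N) : (corolla F ν).EvalsTo id (F ν).hom := by
  have h := evalsTo_node_edge (F ν) (F := F) ν (Equiv.refl _) (fun _ => 𝟙 _) (𝟙 _)
  exact transport_id (F ν).hom ▸ h

/-- The change of the node labels along `φ`. -/
def reN {N' : Type} {F' : N' → Q.Elt} (φ : N → N') (h : ∀ ν, F ν = F' (φ ν)) (T : Tree F x z) :
    Tree F' x z :=
  T.subst fun ν => castT (h ν).symm (corolla F' (φ ν))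

theorem subst_reN {N' N'' : Type} {F' : N' → Q.Elt} {F'' : N'' → Q.Elt} (φ : N → N')
    (h : ∀ ν, F ν = F' (φ ν)) (S : ∀ ν, Tree F'' (F' ν).src (F' ν).tgt) (T : Tree F x z) :
    (T.reN φ h).subst S = T.subst (fun ν => castT (h ν).symm (S (φ ν))) := by
  rw [reN, subst_subst]
  congr 1
  funext ν
  rw [castT_subst, corolla_subst]

theorem reN_subst {N' N'' : Type} {F' : N' → Q.Elt} {F'' : N'' → Q.Elt} (φ : N' → N'')
    (h : ∀ ν, F' ν = F'' (φ ν)) (S : ∀ ν, Tree F' (F ν).src (F ν).tgt) (T : Tree F x z) :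
    (T.subst S).reN φ h = T.subst (fun ν => (S ν).reN φ h) := subst_subst _ _ _

theorem reN_congr {N' : Type} {F' : N' → Q.Elt} {φ φ' : N → N'} (hφ : ∀ ν, φ ν = φ' ν)
    (h : ∀ ν, F ν = F' (φ ν)) (h' : ∀ ν, F ν = F' (φ' ν)) (T : Tree F x z) :
    T.reN φ h = T.reN φ' h' := by
  obtain rfl : φ = φ' := funext hφ
  rfl

theorem reN_reN {N' N'' : Type} {F' : N' → Q.Elt} {F'' : N'' → Q.Elt} (φ : N → N')
    (h : ∀ ν, F ν = F' (φ ν)) (φ' : N' → N'') (h' : ∀ ν, F' ν = F'' (φ' ν)) (T : Tree F x z) :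
    (T.reN φ h).reN φ' h' = T.reN (fun ν => φ' (φ ν)) (fun ν => (h ν).trans (h' _)) := by
  refine (subst_reN _ _ _ _).trans (congrArg (fun S => T.subst S) (funext fun ν => ?_))
  exact castT_castT _ _ _

theorem reN_id (T : Tree F x z) (h) : T.reN (F' := F) (fun ν => ν) h = T := subst_corolla T

theorem reN_corolla {N' : Type} {F' : N' → Q.Elt} (φ : N → N') (h : ∀ ν, F ν = F' (φ ν))
    (ν : N) : (corolla F ν).reN φ h = castT (h ν).symm (corolla F' (φ ν)) := corolla_subst _ _

theorem castT_reN {N' : Type} {F' : N' → Q.Elt} (φ : N → N') (h : ∀ ν, F ν = F' (φ ν))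
    {e e' : Q.Elt} (he : e = e') (T : Tree F e.src e.tgt) :
    (castT he T).reN φ h = castT he (T.reN φ h) := castT_subst _ _ _

theorem EvalsTo.reN {N' : Type} {F' : N' → Q.Elt} (φ : N → N') (h : ∀ ν, F ν = F' (φ ν))
    {T : Tree F x z} {n : ℕ} {l : Fin n → L} {f : Q.Hom (fun i => x (l i)) z}
    (hf : T.EvalsTo l f) : (T.reN φ h).EvalsTo l f :=
  EvalsTo.subst (fun ν => (evalsTo_corolla F' (φ ν)).castT (h ν).symm) hf

theorem reN_node {N' : Type} {F' : N' → Q.Elt} (φ : N → N') (ν : N)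
    (a : (F' (φ ν)).tgt ⟶ z) (t : ∀ i, Tree (fun ν => F' (φ ν)) x ((F' (φ ν)).src i)) :
    (node (F := fun ν => F' (φ ν)) ν a t).reN (F' := F') φ (fun _ => rfl)
      = node (φ ν) a (fun i => (t i).reN φ (fun _ => rfl)) := by
  have h : (fun i => ((t i).reN (F' := F') φ (fun _ => rfl)).post (𝟙 _))
      = fun i => (t i).reN φ (fun _ => rfl) := funext fun i => post_id _
  exact (congrArg (node (φ ν) _) h).trans
    (congrArg (fun a => node (φ ν) a _) (Category.id_comp a))

theorem nodes_reN {N' : Type} {F' : N' → Q.Elt} (φ : N → N') (h : ∀ ν, F ν = F' (φ ν))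
    (T : Tree F x z) : (T.reN φ h).nodes = T.nodes.map φ := by
  obtain rfl : F = fun ν => F' (φ ν) := funext h
  induction T with
  | edge ℓ a => rfl
  | node ν a t ih =>
    rw [reN_node]
    simp only [nodes, List.map_cons, List.map_flatten, List.map_ofFn, ih]
    rfl

theorem reN_injective {N' : Type} {F' : N' → Q.Elt} {φ : N → N'} (hφ : Function.Injective φ)
    (h : ∀ ν, F ν = F' (φ ν)) {T T' : Tree F x z} (e : T.reN φ h = T'.reN φ h) : T = T' := by
  obtain rfl : F = fun ν => F' (φ ν) := funext h
  induction T with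
  | edge ℓ a =>
    cases T' with
    | edge ℓ' a' => injection e with h1 _ h2; subst h1; exact congrArg (edge ℓ) (eq_of_heq h2)
    | node ν' a' t' => rw [reN_node] at e; cases e
  | node ν a t ih =>
    cases T' with
    | edge ℓ' a' => rw [reN_node] at e; cases e
    | node ν' a' t' =>
      rw [reN_node, reN_node] at e
      have hν : φ ν = φ ν' := by injection e
      obtain rfl := hφ hν
      injection e with _ _ h1 h2
      subst h1
      have h3 : t = t' := funext fun i => ih i (congrFun h2 i)
      subst h3
      rfl

theorem nodes_corolla (F : N → Q.Elt) (ν : N) : (corolla F ν).nodes = [ν] := by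
  simp [corolla, nodes]

theorem nodes_graft {L' : Type} {x' : L' → Q.Obj} (T : Tree F x z) (s : ∀ ℓ, Tree F x' (x ℓ)) :
    ((T.graft s).nodes : Multiset N) = T.nodes + ∑ p, ((s (T.leaf p)).nodes : Multiset N) := by
  induction T with
  | edge ℓ a =>
    refine (congrArg _ (nodes_post (s ℓ) a)).trans ?_
    refine ((zero_add _).trans ?_).symm
    exact Fin.sum_univ_one (fun _ => ((s ℓ).nodes : Multiset N))
  | node ν a t ih =>
    have h2 : ∑ p, ((s ((node ν a t).leaf p)).nodes : Multiset N)
        = ∑ i, ∑ j, ((s ((t i).leaf j)).nodes : Multiset N) :=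
      sum_concat fun i j => ((s ((t i).leaf j)).nodes : Multiset N)
    simp only [graft, nodes, ← Multiset.cons_coe, coe_flatten, ih, Finset.sum_add_distrib]
    rw [h2, Multiset.cons_add]

theorem EvalsTo.sum_leaf {T : Tree F x z} {n : ℕ} {l : Fin n → L}
    {f : Q.Hom (fun i => x (l i)) z} (hf : T.EvalsTo l f) {A : Type} [AddCommMonoid A]
    (v : L → A) : ∑ p, v (T.leaf p) = ∑ i, v (l i) := by
  obtain ⟨ρ, hρ, -⟩ := hf
  rw [← ρ.sum_comp]
  exact Finset.sum_congr rfl fun i _ => congrArg v (hρ i).symm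

theorem nodes_subst {N' : Type} {F' : N' → Q.Elt} {S : ∀ ν, Tree F' (F ν).src (F ν).tgt}
    (hS : ∀ ν, (S ν).EvalsTo id (F ν).hom) (T : Tree F x z) :
    ((T.subst S).nodes : Multiset N')
      = (T.nodes : Multiset N).bind fun ν => ((S ν).nodes : Multiset N') := by
  induction T with
  | edge ℓ a => rfl
  | node ν a t ih =>
    simp only [subst, nodes_post, nodes, ← Multiset.cons_coe, coe_flatten, Multiset.cons_bind]
    rw [nodes_graft, (hS ν).sum_leaf (fun i => (((t i).subst S).nodes : Multiset N'))]
    simp only [ih, id]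
    congr 1
    exact sum_bind _ _ _

/-- Every label occurs at exactly one node. -/
def Full (T : Tree F x z) : Prop := T.nodes.Nodup ∧ ∀ ν, ν ∈ T.nodes

theorem Full.reN {N' : Type} {F' : N' → Q.Elt} (φ : N ≃ N') (h : ∀ ν, F ν = F' (φ ν))
    {T : Tree F x z} (hT : T.Full) : (T.reN φ h).Full := by
  rw [Full, nodes_reN]
  exact ⟨hT.1.map φ.injective, fun ν => List.mem_map.2 ⟨φ.symm ν, hT.2 _, by simp⟩⟩

theorem Full.subst {N' : Type} {F' : N' → Q.Elt} {S : ∀ ν, Tree F' (F ν).src (F ν).tgt}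
    (hS : ∀ ν, (S ν).EvalsTo id (F ν).hom) {T : Tree F x z} (hT : T.Full)
    (h1 : ∀ ν, (S ν).nodes.Nodup) (h2 : ∀ ν', ∃ ν, ν' ∈ (S ν).nodes)
    (h3 : ∀ ν₁ ν₂ ν', ν' ∈ (S ν₁).nodes → ν' ∈ (S ν₂).nodes → ν₁ = ν₂) : (T.subst S).Full := by
  have e := nodes_subst hS T
  constructor
  · rw [← Multiset.coe_nodup, e, Multiset.nodup_bind]
    refine ⟨fun ν _ => h1 ν, ⟨_, rfl, ?_⟩⟩
    · refine hT.1.imp fun {a b} hab => ?_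
      refine Multiset.disjoint_left.2 fun ha hb => hab (h3 a b _ ha hb)
  · intro ν'
    obtain ⟨ν, hν⟩ := h2 ν'
    rw [← Multiset.mem_coe, e]
    exact Multiset.mem_bind.2 ⟨ν, hT.2 ν, hν⟩

theorem full_node_edge [Subsingleton N] (ν : N) (a : (F ν).tgt ⟶ z) (l : Fin (F ν).arity → L)
    (b : ∀ i, x (l i) ⟶ (F ν).src i) :
    (node ν a (fun i => edge (l i) (b i)) : Tree F x z).Full := by
  have : (node ν a (fun i => edge (l i) (b i)) : Tree F x z).nodes = [ν] := by
    simp [nodes]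
  rw [Full, this]
  exact ⟨List.nodup_singleton ν, fun ν' => List.mem_singleton.2 (Subsingleton.elim _ _)⟩

end Tree

end SymMulticat

namespace SymMulticat

variable {Q : SymMulticat.{u}}

/-! ### The category of elements and the slice of a symmetric multicategory -/

theorem transport_transport {n n' n'' : ℕ} {x : Fin n → Q.Obj} {x' : Fin n' → Q.Obj}
    {x'' : Fin n'' → Q.Obj} {y y' y'' : Q.Obj} (σ : Fin n ≃ Fin n') (l : ∀ i, x' (σ i) ⟶ x i)
    (r : y ⟶ y') (σ' : Fin n' ≃ Fin n'') (l' : ∀ i, x'' (σ' i) ⟶ x' i) (r' : y' ⟶ y'')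
    (g : Q.Hom x y) :
    transport σ' l' r' (transport σ l r g)
      = transport (σ.trans σ') (fun i => l' (σ i) ≫ l i) (r ≫ r') g := by
  have hS : ∀ _ : Fin 1, (Tree.node (0 : Fin 1) r (fun i => .edge (σ i) (l i)) :
      Tree (fun _ : Fin 1 => (⟨n, x, y, g⟩ : Q.Elt)) x' y').EvalsTo id (transport σ l r g) :=
    fun _ => Tree.evalsTo_node_edge ⟨n', x', y', transport σ l r g⟩
      (F := fun _ : Fin 1 => ⟨n, x, y, g⟩) 0 σ l r
  have h1 := Tree.EvalsTo.subst (F := fun _ : Fin 1 => ⟨n', x', y', transport σ l r g⟩) hS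
    (Tree.evalsTo_node_edge ⟨n'', x'', y'', transport σ' l' r' (transport σ l r g)⟩
      (F := fun _ : Fin 1 => ⟨n', x', y', transport σ l r g⟩) 0 σ' l' r')
  have h2 := Tree.evalsTo_node_edge
    ⟨n'', x'', y'', transport (σ.trans σ') (fun i => l' (σ i) ≫ l i) (r ≫ r') g⟩
    (F := fun _ : Fin 1 => ⟨n, x, y, g⟩) 0 (σ.trans σ') (fun i => l' (σ i) ≫ l i) (r ≫ r')
  exact Tree.EvalsTo.unique Function.injective_id h1 h2

/-- The category of elements of `Q`. -/
instance : SmallCategory Q.Elt where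
  Hom := Elt.Mor
  id g := ⟨Equiv.refl _, fun _ => 𝟙 _, 𝟙 _, transport_id _⟩
  comp α β := ⟨α.perm.trans β.perm, fun i => β.left (α.perm i) ≫ α.left i, α.right ≫ β.right, by
    rw [← transport_transport α.perm α.left α.right β.perm β.left β.right, α.w, β.w]⟩
  id_comp α := Elt.Mor.ext rfl (heq_of_eq (funext fun _ => Category.comp_id _))
    (Category.id_comp _)
  comp_id α := Elt.Mor.ext rfl (heq_of_eq (funext fun _ => Category.id_comp _))
    (Category.comp_id _)
  assoc α β γ := Elt.Mor.ext rfl (heq_of_eq (funext fun _ => (Category.assoc _ _ _).symm))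
    (Category.assoc _ _ _)

variable (Q) in
/-- The data of the slice `Q⁺`. An arrow `(F 0, …, F (n - 1)) ⟶ f` is a configuration: a tree in
which each of `0, …, n - 1` labels exactly one node and whose composite is `f`. Labelling the
leaves by the positions of the source of `f` is the same as specifying the permutation of the
leaves, and labelling the nodes by `0, …, n - 1` includes specifying the bijection `τ`. -/
def sliceData : SymMulticatData.{u} where
  Obj := Q.Elt
  Hom {n} F f := {T : Tree F f.src f.tgt // T.Full ∧ T.EvalsTo id f.hom}
  ι {g g'} (α : Elt.Mor g g') := ⟨.node 0 α.right fun i => .edge (α.perm i) (α.left i),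
    Tree.full_node_edge _ _ _ _, by
      have h := Tree.evalsTo_node_edge g' (F := fun _ : Fin 1 => g) 0 α.perm α.left α.right
      rw [α.w] at h
      exact h⟩
  comp {k F f m G} f' g := ⟨Tree.subst (fun i => (g i).1.reN
      (fun j => finSigmaFinEquiv ⟨i, j⟩) (fun j => (concat_mk G ⟨i, j⟩).symm)) f'.1, by
    have hn : ∀ i, ((g i).1.reN (F' := concat G) (fun j => finSigmaFinEquiv ⟨i, j⟩)
        (fun j => (concat_mk G ⟨i, j⟩).symm)).nodes
          = (g i).1.nodes.map (fun j => finSigmaFinEquiv ⟨i, j⟩) :=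
      fun i => Tree.nodes_reN _ _ _
    have hS : ∀ i, ((g i).1.reN (F' := concat G) (fun j => finSigmaFinEquiv ⟨i, j⟩)
        (fun j => (concat_mk G ⟨i, j⟩).symm)).EvalsTo id (F i).hom := fun i => (g i).2.2.reN _ _
    refine ⟨Tree.Full.subst hS f'.2.1 (fun i => ?_) (fun q => ?_) (fun i i' q h h' => ?_),
      f'.2.2.subst hS⟩
    · rw [hn]
      exact (g i).2.1.1.map fun j j' h => by simpa using h
    · obtain ⟨⟨i, j⟩, rfl⟩ := finSigmaFinEquiv.surjective q
      refine ⟨i, ?_⟩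
      rw [hn]
      exact List.mem_map.2 ⟨j, (g i).2.1.2 j, rfl⟩
    · rw [hn, List.mem_map] at h h'
      obtain ⟨j, -, rfl⟩ := h
      obtain ⟨j', -, h⟩ := h'
      exact (congrArg Sigma.fst (finSigmaFinEquiv.injective h)).symm⟩
  act {m n F f} σ f' := ⟨f'.1.reN σ.symm (by simp), f'.2.1.reN σ.symm (by simp),
    f'.2.2.reN _ _⟩

theorem slice_ext_reindex {m n : ℕ} {x : Fin n → Q.sliceData.Obj} {x' : Fin m → Q.sliceData.Obj}
    {y : Q.sliceData.Obj} (σ : Fin m ≃ Fin n) (h : ∀ i, x' i = x (σ i)) (f : Q.sliceData.Hom x y)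
    (g : Q.sliceData.Hom x' y)
    (hg : g.1 = f.1.reN σ.symm (fun ν => by rw [h, Equiv.apply_symm_apply])) :
    g = Q.sliceData.reindex σ h f := by
  obtain rfl : x' = fun i => x (σ i) := funext h
  exact Subtype.ext hg

theorem reN_node_edge {n n' : ℕ} (e : Q.Elt) (φ : Fin n → Fin n') {L : Type} {w : L → Q.Obj}
    {o : Q.Obj} (ν : Fin n) (r : e.tgt ⟶ o) (ℓ : Fin e.arity → L) (l : ∀ i, w (ℓ i) ⟶ e.src i) :
    (Tree.node ν r (fun i => .edge (ℓ i) (l i)) : Tree (fun _ : Fin n => e) w o).reN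
        (F' := fun _ : Fin n' => e) φ (fun _ => rfl)
      = .node (φ ν) r (fun i => .edge (ℓ i) (l i)) :=
  Tree.reN_node (F' := fun _ : Fin n' => e) φ ν r _

variable (Q) in
/-- The slice `Q⁺`. -/
def slice : SymMulticat.{u} where
  toSymMulticatData := Q.sliceData
  id_comp {n x y} f := by
    have h : ∀ (i : Fin 1) j, x j = concat (fun _ : Fin 1 => x) (finSigmaFinEquiv ⟨i, j⟩) :=
      fun i j => (concat_mk (fun _ : Fin 1 => x) ⟨i, j⟩).symm
    have e := Tree.corolla_subst (F := fun _ : Fin 1 => y) (fun i => f.1.reN _ (h i)) 0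
    refine slice_ext_reindex _ _ _ _ (Eq.trans e ?_)
    refine Tree.reN_congr (fun j => ?_) _ _ _
    exact (Equiv.eq_symm_apply _).2 (oneSumEquiv_mk 0 j)
  comp_id {n x y} f := by
    refine slice_ext_reindex _ _ _ _ (congrArg (fun S => f.1.subst S) (funext fun i => ?_))
    exact Tree.reN_corolla (F := fun _ : Fin 1 => x i) _ _ 0
  assoc {k x y m u' l v} f g h := by
    have hu : ∀ i j, u' i j = concat u' (finSigmaFinEquiv ⟨i, j⟩) :=
      fun i j => (concat_mk u' ⟨i, j⟩).symm
    have hv : ∀ i j r, v i j r = concat (v i) (finSigmaFinEquiv ⟨j, r⟩) :=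
      fun i j r => (concat_mk (v i) ⟨j, r⟩).symm
    have hv' : ∀ i r, concat (v i) r = concat (fun i => concat (v i)) (finSigmaFinEquiv ⟨i, r⟩) :=
      fun i r => (concat_mk (fun i => concat (v i)) ⟨i, r⟩).symm
    let v' : ∀ q, Fin (concat l q) → Q.Elt :=
      fun q => v (finSigmaFinEquiv.symm q).1 (finSigmaFinEquiv.symm q).2
    have ha : ∀ r, concat (fun i => concat (v i)) r = concat v' ((assocEquiv l).symm r) :=
      fun r => by rw [← concat_assocEquiv v, Equiv.apply_symm_apply]
    have hw : ∀ q r, v' q r = concat v' (finSigmaFinEquiv ⟨q, r⟩) :=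
      fun q r => (concat_mk v' ⟨q, r⟩).symm
    let h' : ∀ q, Tree (concat v') (concat u' q).src (concat u' q).tgt := fun q =>
      (h (finSigmaFinEquiv.symm q).1 (finSigmaFinEquiv.symm q).2).1.reN _ (hw q)
    let c : ∀ p : (i : Fin k) × Fin (m i), Tree (concat v') (u' p.1 p.2).src (u' p.1 p.2).tgt :=
      fun p => (((h p.1 p.2).1.reN _ (hv p.1 p.2)).reN _ (hv' p.1)).reN _ ha
    have key : ∀ i j, Tree.castT (hu i j).symm (h' (finSigmaFinEquiv ⟨i, j⟩)) = c ⟨i, j⟩ := by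
      intro i j
      have k1 : ∀ q, h' q = c (finSigmaFinEquiv.symm q) := by
        intro q
        refine Eq.symm ((congrArg (Tree.reN _ ha) (Tree.reN_reN _ _ _ _ _)).trans
          ((Tree.reN_reN _ _ _ _ _).trans ?_))
        refine Tree.reN_congr (fun r => ?_) _ _ _
        exact (Equiv.symm_apply_eq _).2 (assocEquiv_mk l q r)
      rw [k1]
      have k2 : ∀ p (e : p = ⟨i, j⟩), Tree.castT (congrArg
          (fun p : (i : Fin k) × Fin (m i) => u' p.1 p.2) e) (c p) = c ⟨i, j⟩ := by
        rintro _ rfl; rfl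
      exact k2 _ (Equiv.symm_apply_apply _ _)
    have e1 := Tree.subst_subst (fun i => (g i).1.reN _ (hu i)) h' f.1
    have e2 := Tree.reN_subst _ ha
      (fun i => ((g i).1.subst fun j => (h i j).1.reN _ (hv i j)).reN _ (hv' i)) f.1
    refine slice_ext_reindex _ _ _ _ (Eq.trans e1 (Eq.trans ?_ e2.symm))
    refine congrArg (fun S => f.1.subst S) (funext fun i => ?_)
    refine (Tree.subst_reN _ _ _ _).trans ?_
    refine Eq.trans ?_ (congrArg (Tree.reN _ ha) (Tree.reN_subst _ _ _ _)).symm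
    refine Eq.trans ?_ (Tree.reN_subst _ _ _ _).symm
    exact congrArg (fun S => (g i).1.subst S) (funext fun j => key i j)
  act_refl f := Subtype.ext (Tree.reN_id f.1 fun _ => rfl)
  act_act {l m n x y} f σ σ' := Subtype.ext (Tree.reN_reN (F' := fun i => x (σ i)) σ.symm
    (fun i => by rw [Equiv.apply_symm_apply]) σ'.symm
    (fun i => by rw [Equiv.apply_symm_apply]) f.1)
  act_comp {k k' x y m u'} f g σ := by
    have h : ∀ i j, u' i j = concat u' (finSigmaFinEquiv ⟨i, j⟩) :=
      fun i j => (concat_mk u' ⟨i, j⟩).symm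
    have h' : ∀ i j, u' (σ i) j = concat (fun i => u' (σ i)) (finSigmaFinEquiv ⟨i, j⟩) :=
      fun i j => (concat_mk (fun i => u' (σ i)) ⟨i, j⟩).symm
    have e1 := Tree.subst_reN (F := x) σ.symm (fun i => by rw [Equiv.apply_symm_apply])
      (fun i => (g (σ i)).1.reN _ (h' i)) f.1
    have e2 := Tree.reN_subst (F'' := concat fun i => u' (σ i)) (blockEquiv m σ).symm
      (fun j => by rw [concat_block, Equiv.apply_symm_apply]) (fun i => (g i).1.reN _ (h i)) f.1
    refine slice_ext_reindex _ _ _ _ (e1.trans (Eq.trans ?_ e2.symm))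
    refine congrArg (fun S => f.1.subst S) (funext fun i => ?_)
    obtain ⟨i, rfl⟩ := σ.surjective i
    have key : ∀ i' (e : i' = i), Tree.castT (congrArg (fun i => x (σ i)) e)
        ((g (σ i')).1.reN _ (h' i')) = (g (σ i)).1.reN _ (h' i) := by rintro _ rfl; rfl
    refine (key _ (σ.symm_apply_apply i)).trans (Eq.trans ?_ (Tree.reN_reN _ _ _ _ _).symm)
    exact Tree.reN_congr (fun j => (blockEquiv_symm_mk _ _ _ _).symm) _ _ _
  comp_act {k x y m m' u'} f g σ := by
    have h : ∀ i j, u' i j = concat u' (finSigmaFinEquiv ⟨i, j⟩) :=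
      fun i j => (concat_mk u' ⟨i, j⟩).symm
    have e2 := Tree.reN_subst (F'' := concat fun i j => u' i (σ i j)) (juxtEquiv σ).symm
      (fun j => by rw [concat_juxt, Equiv.apply_symm_apply]) (fun i => (g i).1.reN _ (h i)) f.1
    refine slice_ext_reindex _ _ _ _ (Eq.trans ?_ e2.symm)
    refine congrArg (fun S => f.1.subst S) (funext fun i => ?_)
    have e3 := Tree.reN_reN (F' := fun j => u' i (σ i j))
      (F'' := concat fun i j => u' i (σ i j)) (σ i).symm
      (fun j => by rw [Equiv.apply_symm_apply]) _
      (fun j => (concat_mk (fun i j => u' i (σ i j)) ⟨i, j⟩).symm) (g i).1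
    refine Eq.trans e3 (Eq.trans ?_ (Tree.reN_reN _ _ _ _ _).symm)
    refine Tree.reN_congr (fun j => ?_) _ _ _
    refine (Equiv.eq_symm_apply _).2 ?_
    simp [juxtEquiv]
  ι_comp {x y z} (a : Elt.Mor x y) (b : Elt.Mor y z) := by
    refine slice_ext_reindex _ _ _ _ ?_
    have e1 := reN_node_edge x (fun j : Fin 1 => finSigmaFinEquiv
      (⟨0, j⟩ : (_ : Fin 1) × Fin 1)) 0 a.right (fun i => a.perm i) a.left
    have e2 := reN_node_edge x (oneSumEquiv 1).symm 0 (a.right ≫ b.right)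
      (fun i => b.perm (a.perm i)) (fun i => b.left (a.perm i) ≫ a.left i)
    have hp : (finSigmaFinEquiv (⟨0, 0⟩ : (_ : Fin 1) × Fin 1)) = (oneSumEquiv 1).symm 0 :=
      (Equiv.eq_symm_apply _).2 (oneSumEquiv_mk 0 0)
    refine Eq.trans (congrArg (fun t => Tree.post (Tree.graft t
      (fun i => (.edge (b.perm i) (b.left i) : Tree _ z.src _))) b.right) e1)
      (Eq.trans ?_ e2.symm)
    rw [hp]
    rfl

end SymMulticat

namespace GenMulticat

open SymMulticat SymMulticat.Tree

/-! ### The slice of a generalised multicategory -/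

/-- The arrow `f` of `M` as the arrow `(f, 1)` of `ξ(M)`. -/
@[reducible] noncomputable def elt (M : GenMulticat.{u}) (f : M.Arr) : M.xi.Elt :=
  ⟨M.arity f, fun p => ⟨M.src f p⟩, ⟨M.tgt f⟩, ⟨⟨f, id, fun _ => rfl⟩, Function.bijective_id, rfl⟩⟩

/-- The configurations for composing arrows of `M`. The edges of the trees are labelled by
identities since `ξ(M)` has a discrete category of objects. The permutation of the leaves is the
one induced by the amalgamating maps; the bijection `τ` is the depth-first planar order of the
nodes. -/
structure Conf (M : GenMulticat.{u}) where
  n : ℕ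
  label : Fin n → M.Arr
  res : M.Arr
  tree : Tree (fun i => M.elt (label i)) (M.elt res).src (M.elt res).tgt
  nodes_eq : tree.nodes = List.finRange n
  evalsTo : tree.EvalsTo id (M.elt res).hom

variable {M : GenMulticat.{u}}

theorem Conf.full (A : Conf M) : A.tree.Full := by
  rw [Full, A.nodes_eq]
  exact ⟨List.nodup_finRange _, List.mem_finRange⟩

section Number

variable {Y : Type} [DecidableEq Y] (G : Y → M.Arr) (f : M.Arr)
  (D : Tree (fun y => M.elt (G y)) (M.elt f).src (M.elt f).tgt) (hD : D.Full)

/-- The numbering of the node labels. -/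
noncomputable def number : Fin D.nodes.length ≃ Y := hD.1.getEquivOfForallMemList D.nodes hD.2

/-- The configuration obtained from a tree by numbering its nodes. -/
@[reducible] noncomputable def Conf.ofTree (hf : D.EvalsTo id (M.elt f).hom) : Conf M where
  n := D.nodes.length
  label i := G (number G f D hD i)
  res := f
  tree := D.reN (number G f D hD).symm (fun y => by rw [Equiv.apply_symm_apply])
  nodes_eq := by
    rw [nodes_reN]
    have h : D.nodes = (List.finRange D.nodes.length).map (number G f D hD) :=
      (List.map_get_finRange D.nodes).symm
    refine (congrArg (List.map (number G f D hD).symm) h).trans ?_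
    simp
  evalsTo := hf.reN _ _

end Number

/-- The arrows at the nodes of `A ∘_p B`. -/
def compLabel (A B : Conf M) (p : Fin A.n) : {q // q ≠ p} ⊕ Fin B.n → M.Arr :=
  Sum.elim (fun q => A.label q.1) B.label

theorem elt_compLabel_inl (A B : Conf M) (p : Fin A.n) (q : {q // q ≠ p}) :
    M.elt (compLabel A B p (.inl q)) = M.elt (A.label q.1) := rfl

theorem elt_compLabel_inr (A B : Conf M) (p : Fin A.n) (r : Fin B.n) :
    M.elt (B.label r) = M.elt (compLabel A B p (.inr r)) := rfl

/-- The trees replacing the node `p` of `A` by the tree of `B` and the other nodes by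
themselves. -/
noncomputable def compStep (A B : Conf M) (p : Fin A.n) (h : B.res = A.label p) (ν : Fin A.n) :
    Tree (fun y => M.elt (compLabel A B p y)) (M.elt (A.label ν)).src (M.elt (A.label ν)).tgt :=
  if e : ν = p then castT (congrArg M.elt (h.trans (congrArg A.label e.symm)))
    (B.tree.reN Sum.inr (elt_compLabel_inr A B p))
  else castT (elt_compLabel_inl A B p ⟨ν, e⟩)
    (corolla (fun y => M.elt (compLabel A B p y)) (Sum.inl ⟨ν, e⟩))

theorem compStep_self (A B : Conf M) (p : Fin A.n) (h : B.res = A.label p) :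
    compStep A B p h p = castT (congrArg M.elt h)
      (B.tree.reN Sum.inr (elt_compLabel_inr A B p)) := dif_pos rfl

theorem compStep_ne (A B : Conf M) (p : Fin A.n) (h : B.res = A.label p) {ν : Fin A.n}
    (e : ν ≠ p) : compStep A B p h ν = castT (elt_compLabel_inl A B p ⟨ν, e⟩)
      (corolla (fun y => M.elt (compLabel A B p y)) (Sum.inl ⟨ν, e⟩)) := dif_neg e

/-- The tree for `A ∘_p B`. -/
noncomputable def compTree (A B : Conf M) (p : Fin A.n) (h : B.res = A.label p) :
    Tree (fun y => M.elt (compLabel A B p y)) (M.elt A.res).src (M.elt A.res).tgt :=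
  A.tree.subst (compStep A B p h)

theorem compTree_aux (A B : Conf M) (p : Fin A.n) (h : B.res = A.label p) :
    (compTree A B p h).Full ∧ (compTree A B p h).EvalsTo id (M.elt A.res).hom := by
  have hS : ∀ ν, (compStep A B p h ν).EvalsTo id (M.elt (A.label ν)).hom := by
    intro ν
    rcases eq_or_ne ν p with rfl | e
    · rw [compStep_self]
      exact (B.evalsTo.reN _ _).castT _
    · rw [compStep_ne A B p h e]
      exact (evalsTo_corolla _ _).castT _
  have hn : ∀ ν, (compStep A B p h ν).nodes = if e : ν = p then (List.finRange B.n).map Sum.inr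
        else [Sum.inl ⟨ν, e⟩] := by
    intro ν
    rcases eq_or_ne ν p with rfl | e
    · rw [compStep_self, nodes_castT, nodes_reN, B.nodes_eq, dif_pos rfl]
    · rw [compStep_ne A B p h e, nodes_castT, nodes_corolla, dif_neg e]
  refine ⟨Full.subst hS A.full (fun ν => ?_) (fun y => ?_) (fun ν ν' y h1 h2 => ?_),
    A.evalsTo.subst hS⟩
  · rw [hn]
    split_ifs with e
    · exact (List.nodup_finRange _).map Sum.inr_injective
    · exact List.nodup_singleton _
  · rcases y with q | r
    · exact ⟨q.1, by rw [hn, dif_neg q.2]; simp⟩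
    · exact ⟨p, by rw [hn, dif_pos rfl]; simp⟩
  · rw [hn] at h1 h2
    split_ifs at h1 h2 with e e' e'
    · rw [e, e']
    · rcases y with q | r <;> simp at h1 h2
    · rcases y with q | r <;> simp at h1 h2
    · rw [List.mem_singleton] at h1 h2
      simpa using h1.symm.trans h2

variable (M) in
/-- The data of the slice `M₊`. The composite `A ∘_p B` replaces the node `p` of `A` by `B`. -/
@[reducible] noncomputable def sliceData : GenMulticatData.{u} where
  Obj := M.Arr
  Arr := Conf M
  arity := Conf.n
  src := Conf.label
  tgt := Conf.res
  comp A B p h := Conf.ofTree _ A.res (compTree A B p h) (compTree_aux A B p h).1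
    (compTree_aux A B p h).2
  amal A B p h := (number _ A.res (compTree A B p h) (compTree_aux A B p h).1).symm
  tgt_comp _ _ _ _ := rfl
  src_inl A B p h q := congrArg (compLabel A B p)
    ((number _ A.res (compTree A B p h) (compTree_aux A B p h).1).apply_symm_apply (.inl q))
  src_inr A B p h q := congrArg (compLabel A B p)
    ((number _ A.res (compTree A B p h) (compTree_aux A B p h).1).apply_symm_apply (.inr q))
  id f := ⟨1, fun _ => f, f, corolla _ 0, nodes_corolla _ _,
    evalsTo_corolla (fun _ => M.elt f) 0⟩
  arity_id _ := rfl
  src_id _ _ := rfl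
  tgt_id _ := rfl

end GenMulticat

namespace SymMulticat.Tree

variable {Q : SymMulticat.{u}} {N L : Type} [DecidableEq N] {F : N → Q.Elt} {x : L → Q.Obj}
  {z : Q.Obj}

/-- The trees replacing the node `ν₀` by `E` and all the other nodes by themselves. -/
def plug (F : N → Q.Elt) (ν₀ : N) {e : Q.Elt} (he : e = F ν₀) (E : Tree F e.src e.tgt) (ν : N) :
    Tree F (F ν).src (F ν).tgt :=
  if h : ν = ν₀ then castT (he.trans (congrArg F h.symm)) E else corolla F ν

theorem plug_self (ν₀ : N) {e : Q.Elt} (he : e = F ν₀) (E : Tree F e.src e.tgt) :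
    plug F ν₀ he E ν₀ = castT he E := dif_pos rfl

theorem plug_ne {ν₀ : N} {e : Q.Elt} (he : e = F ν₀) (E : Tree F e.src e.tgt) {ν : N}
    (h : ν ≠ ν₀) : plug F ν₀ he E ν = corolla F ν := dif_neg h

theorem subst_plug_of_notMem {ν₀ : N} {e : Q.Elt} (he : e = F ν₀) (E : Tree F e.src e.tgt)
    (T : Tree F x z) (h : ν₀ ∉ T.nodes) : T.subst (plug F ν₀ he E) = T :=
  (subst_congr T fun _ hν => plug_ne he E fun e => h (e ▸ hν)).trans (subst_corolla T)

theorem plug_assoc {ν₁ ν₂ : N} {e₁ e₂ : Q.Elt} (h₁ : e₁ = F ν₁) (h₂ : e₂ = F ν₂)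
    (E₁ : Tree F e₁.src e₁.tgt) (E₂ : Tree F e₂.src e₂.tgt) (T : Tree F x z)
    (h : ν₂ ∉ T.nodes) :
    (T.subst (plug F ν₁ h₁ E₁)).subst (plug F ν₂ h₂ E₂)
      = T.subst (plug F ν₁ h₁ (E₁.subst (plug F ν₂ h₂ E₂))) := by
  rw [subst_subst]
  refine subst_congr T fun ν hν => ?_
  rcases eq_or_ne ν ν₁ with rfl | e
  · rw [plug_self, plug_self, castT_subst]
  · rw [plug_ne _ _ e, plug_ne _ _ e, corolla_subst, plug_ne _ _ (fun e' : ν = ν₂ => h (e' ▸ hν))]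

theorem plug_comm {ν₁ ν₂ : N} {e₁ e₂ : Q.Elt} (h₁ : e₁ = F ν₁) (h₂ : e₂ = F ν₂)
    (E₁ : Tree F e₁.src e₁.tgt) (E₂ : Tree F e₂.src e₂.tgt) (T : Tree F x z) (hne : ν₁ ≠ ν₂)
    (h : ν₂ ∉ E₁.nodes) (h' : ν₁ ∉ E₂.nodes) :
    (T.subst (plug F ν₁ h₁ E₁)).subst (plug F ν₂ h₂ E₂)
      = (T.subst (plug F ν₂ h₂ E₂)).subst (plug F ν₁ h₁ E₁) := by
  rw [subst_subst, subst_subst]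
  refine congrArg (fun S => T.subst S) (funext fun ν => ?_)
  rcases eq_or_ne ν ν₁ with rfl | e
  · rw [plug_self, plug_ne _ _ hne, corolla_subst, plug_self, castT_subst,
      subst_plug_of_notMem _ _ _ h]
  · rw [plug_ne _ _ e, corolla_subst]
    rcases eq_or_ne ν ν₂ with rfl | e'
    · rw [plug_self, castT_subst, subst_plug_of_notMem _ _ _ h']
    · rw [plug_ne _ _ e', corolla_subst, plug_ne _ _ e]

end SymMulticat.Tree

namespace GenMulticat

open SymMulticat SymMulticat.Tree

variable {M : GenMulticat.{u}}

section Rep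

variable {Z : Type} {G : Z → M.Arr}

/-- The configuration `A` is obtained by numbering the nodes of the tree `D`, and `lab` maps the
numbers to the original labels. -/
structure Rep (A : Conf M) (lab : Fin A.n → Z) (f : M.Arr)
    (D : Tree (fun z => M.elt (G z)) (M.elt f).src (M.elt f).tgt) : Prop where
  inj : Function.Injective lab
  label : ∀ i, A.label i = G (lab i)
  res : A.res = f
  tree : castT (congrArg M.elt res) (A.tree.reN lab (fun i => congrArg M.elt (label i))) = D

theorem Rep.nodes {A : Conf M} {lab : Fin A.n → Z} {f : M.Arr}
    {D : Tree (fun z => M.elt (G z)) (M.elt f).src (M.elt f).tgt} (h : Rep A lab f D) :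
    D.nodes = List.ofFn lab := by
  rw [← h.tree, nodes_castT, nodes_reN, A.nodes_eq, List.ofFn_eq_map]

theorem Rep.notMem {A : Conf M} {lab : Fin A.n → Z} {f : M.Arr}
    {D : Tree (fun z => M.elt (G z)) (M.elt f).src (M.elt f).tgt} (h : Rep A lab f D) {z : Z}
    (hz : ∀ i, lab i ≠ z) : z ∉ D.nodes := by
  rw [h.nodes, List.mem_ofFn]
  rintro ⟨i, hi⟩
  exact hz i hi

theorem Rep.unique {A A' : Conf M} {lab : Fin A.n → Z} {lab' : Fin A'.n → Z} {f : M.Arr}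
    {D : Tree (fun z => M.elt (G z)) (M.elt f).src (M.elt f).tgt} (h : Rep A lab f D)
    (h' : Rep A' lab' f D) :
    A = A' ∧ ∀ (i : Fin A.n) (j : Fin A'.n), lab i = lab' j → (i : ℕ) = j := by
  have hn := h.nodes.symm.trans h'.nodes
  obtain ⟨inj, hl, hr, ht⟩ := h
  obtain ⟨inj', hl', hr', ht'⟩ := h'
  obtain ⟨n, l, r, T, e, v⟩ := A
  obtain ⟨n', l', r', T', e', v'⟩ := A'
  dsimp only at *
  subst hr
  obtain rfl : r' = r := hr'
  obtain rfl : n = n' := by simpa using congrArg List.length hn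
  obtain rfl : lab = lab' := List.ofFn_injective hn
  obtain rfl : l = l' := funext fun i => (hl i).trans (hl' i).symm
  obtain rfl : T = T' := reN_injective inj
    (fun i => congrArg M.elt (hl i)) (ht.trans ht'.symm)
  exact ⟨rfl, fun i j h => congrArg Fin.val (inj h)⟩

theorem Rep.of (A : Conf M) {lab : Fin A.n → Z} (inj : Function.Injective lab)
    (h : ∀ i, A.label i = G (lab i)) :
    Rep A lab A.res (A.tree.reN lab (fun i => congrArg M.elt (h i))) := ⟨inj, h, rfl, rfl⟩

/-- The labels for a composite. -/
noncomputable def compLab {A B : Conf M} (labA : Fin A.n → Z) (labB : Fin B.n → Z)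
    (p : Fin A.n) (h : M.sliceData.tgt B = M.sliceData.src A p) :
    Fin (M.sliceData.comp A B p h).n → Z := fun r =>
  Sum.elim (fun q => labA q.1) labB ((M.sliceData.amal A B p h).symm r)

theorem compLab_ψ {A B : Conf M} (labA : Fin A.n → Z) (labB : Fin B.n → Z)
    (p : Fin A.n) (h : M.sliceData.tgt B = M.sliceData.src A p) (q : Fin A.n) (hq : q ≠ p) :
    compLab labA labB p h (M.sliceData.ψ A B p h q hq) = labA q :=
  congrArg (Sum.elim (fun q : {q // q ≠ p} => labA q.1) labB)
    ((M.sliceData.amal A B p h).symm_apply_apply (.inl ⟨q, hq⟩))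

theorem compLab_φ {A B : Conf M} (labA : Fin A.n → Z) (labB : Fin B.n → Z)
    (p : Fin A.n) (h : M.sliceData.tgt B = M.sliceData.src A p) (r : Fin B.n) :
    compLab labA labB p h (M.sliceData.φ A B p h r) = labB r :=
  congrArg (Sum.elim (fun q : {q // q ≠ p} => labA q.1) labB)
    ((M.sliceData.amal A B p h).symm_apply_apply (.inr r))

theorem compLab_cases {A B : Conf M} (labA : Fin A.n → Z) (labB : Fin B.n → Z)
    (p : Fin A.n) (h : M.sliceData.tgt B = M.sliceData.src A p)
    (i : Fin (M.sliceData.comp A B p h).n) :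
    (∃ q, q ≠ p ∧ compLab labA labB p h i = labA q) ∨ ∃ r, compLab labA labB p h i = labB r := by
  obtain ⟨s, rfl⟩ := (M.sliceData.amal A B p h).surjective i
  rcases s with ⟨q, hq⟩ | r
  · exact .inl ⟨q, hq, compLab_ψ labA labB p h q hq⟩
  · exact .inr ⟨r, compLab_φ labA labB p h r⟩

theorem Rep.comp [DecidableEq Z] {A B : Conf M} {labA : Fin A.n → Z} {labB : Fin B.n → Z}
    {f g : M.Arr} {D : Tree (fun z => M.elt (G z)) (M.elt f).src (M.elt f).tgt}
    {E : Tree (fun z => M.elt (G z)) (M.elt g).src (M.elt g).tgt} (hA : Rep A labA f D)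
    (hB : Rep B labB g E) (p : Fin A.n) (h : M.sliceData.tgt B = M.sliceData.src A p)
    (hAB : ∀ q, q ≠ p → ∀ r, labA q ≠ labB r) {z : Z} (hz : labA p = z)
    (hg : M.elt g = M.elt (G z)) :
    Rep (M.sliceData.comp A B p h) (compLab labA labB p h) f
      (D.subst (plug (fun z => M.elt (G z)) z hg E)) := by
  subst hz
  obtain ⟨injA, lA, rfl, rfl⟩ := hA
  obtain ⟨injB, lB, rfl, rfl⟩ := hB
  have hl : ∀ y, compLabel A B p y = G (Sum.elim (fun q => labA q.1) labB y) := by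
    rintro (q | r)
    · exact lA q.1
    · exact lB r
  refine ⟨fun i j hij => ?_, fun i => hl _, rfl, ?_⟩
  · obtain ⟨s, rfl⟩ := (M.sliceData.amal A B p h).surjective i
    obtain ⟨s', rfl⟩ := (M.sliceData.amal A B p h).surjective j
    simp only [compLab, Equiv.symm_apply_apply] at hij
    congr 1
    rcases s with q | r <;> rcases s' with q' | r'
    · exact congrArg Sum.inl (Subtype.ext (injA hij))
    · exact absurd hij (hAB q.1 q.2 r')
    · exact absurd hij.symm (hAB q'.1 q'.2 r)
    · exact congrArg Sum.inr (injB hij)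
  · have e1 : (M.sliceData.comp A B p h).tree.reN (F' := fun z => M.elt (G z))
        (compLab labA labB p h) (fun i => congrArg M.elt (hl _))
        = (compTree A B p h).reN (Sum.elim (fun q => labA q.1) labB)
          (fun y => congrArg M.elt (hl y)) := by
      refine (reN_reN (F' := fun i => M.elt ((M.sliceData.comp A B p h).label i))
        (F'' := fun z => M.elt (G z)) _
        (fun y => congrArg (fun y => M.elt (compLabel A B p y))
          (((M.sliceData.amal A B p h).symm_apply_apply y).symm)) (compLab labA labB p h)
        (fun i => congrArg M.elt (hl _)) _).trans (reN_congr (fun y => ?_) _ _ _)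
      exact congrArg (Sum.elim (fun q : {q // q ≠ p} => labA q.1) labB)
        ((M.sliceData.amal A B p h).symm_apply_apply y)
    refine e1.trans ((reN_subst _ _ _ _).trans (Eq.trans ?_
      (subst_reN labA (fun i => congrArg M.elt (lA i)) _ _).symm))
    refine congrArg (fun S => A.tree.subst S) (funext fun ν => ?_)
    rcases eq_or_ne ν p with rfl | e
    · rw [compStep_self, plug_self, castT_castT, castT_reN, reN_reN]
      rfl
    · rw [compStep_ne A B p h e, plug_ne _ _ (fun e' => e (injA e')), castT_reN, reN_corolla,
        castT_castT]
      rfl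

end Rep

end GenMulticat

namespace GenMulticat

open SymMulticat SymMulticat.Tree

variable {M : GenMulticat.{u}}

theorem id_comp_aux (y : M.Arr) (f : Conf M) (p : Fin 1) (h : f.res = y) :
    M.sliceData.comp (M.sliceData.id y) f p h = f ∧
      ∀ q, (M.sliceData.φ (M.sliceData.id y) f p h q : ℕ) = q := by
  subst h
  have hp : p = 0 := Subsingleton.elim _ _
  let G : Fin 1 ⊕ Fin f.n → M.Arr := Sum.elim (fun _ => f.res) f.label
  have R1 := Rep.of (G := G) (M.sliceData.id f.res) (lab := Sum.inl) Sum.inl_injective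
    (fun _ => rfl)
  have R2 := Rep.of (G := G) f (lab := Sum.inr) Sum.inr_injective (fun _ => rfl)
  have R := R1.comp R2 p rfl (by simp) rfl rfl
  have e : (Tree.reN (F' := fun z => M.elt (G z)) Sum.inl (fun _ => rfl)
      (M.sliceData.id f.res).tree).subst (plug (fun z => M.elt (G z)) (.inl p) rfl
        (f.tree.reN Sum.inr (fun _ => rfl))) = f.tree.reN Sum.inr (fun _ => rfl) := by
    refine (subst_reN _ _ _ _).trans ((corolla_subst _ _).trans ?_)
    subst hp
    rw [plug_self]
    rfl
  have R' : Rep (M.sliceData.comp (M.sliceData.id f.res) f p rfl)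
      (compLab (A := M.sliceData.id f.res) (B := f) Sum.inl Sum.inr p rfl)
      f.res (f.tree.reN (F' := fun z => M.elt (G z)) Sum.inr (fun _ => rfl)) := e ▸ R
  obtain ⟨h1, h2⟩ := R'.unique R2
  exact ⟨h1, fun q => h2 _ _ (compLab_φ _ _ _ _ _)⟩

theorem comp_id_aux (f : Conf M) (x : M.Arr) (p : Fin f.n) (h : x = f.label p) :
    M.sliceData.comp f (M.sliceData.id x) p h = f ∧
      (∀ q hq, (M.sliceData.ψ f (M.sliceData.id x) p h q hq : ℕ) = q) ∧
      ∀ q, (M.sliceData.φ f (M.sliceData.id x) p h q : ℕ) = p := by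
  subst h
  have R1 := Rep.of (G := f.label) f (lab := id) Function.injective_id (fun _ => rfl)
  have R2 := Rep.of (G := f.label) (M.sliceData.id (f.label p)) (lab := fun _ => p)
    (fun (i : Fin 1) j _ => Subsingleton.elim i j) (fun _ => rfl)
  have R := R1.comp R2 p rfl (fun q hq _ => hq) rfl rfl
  have e : (Tree.reN (F' := fun z => M.elt (f.label z)) id (fun _ => rfl) f.tree).subst
      (plug (fun z => M.elt (f.label z)) p rfl
        ((M.sliceData.id (f.label p)).tree.reN (fun _ => p) (fun _ => rfl)))
      = f.tree.reN id (fun _ => rfl) := by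
    refine (congrArg (fun S => Tree.subst S _) (funext fun ν => ?_)).trans (subst_corolla _)
    rcases eq_or_ne ν p with rfl | hν
    · rw [plug_self]
      exact reN_corolla (F := fun _ : Fin 1 => M.elt (f.label ν))
        (F' := fun z => M.elt (f.label z)) (fun _ => ν) (fun _ => rfl) 0
    · exact plug_ne _ _ hν
  have R' : Rep _ _ f.res (f.tree.reN id (fun _ => rfl)) := e ▸ R
  obtain ⟨h1, h2⟩ := R'.unique R1
  exact ⟨h1, fun q hq => h2 _ q (compLab_ψ _ _ _ _ _ _), fun q => h2 _ p (compLab_φ _ _ _ _ _)⟩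

theorem assoc_aux (f g h : Conf M) (p : Fin f.n) (q : Fin g.n) (hg : g.res = f.label p)
    (hh : h.res = g.label q)
    (hh' : h.res = (M.sliceData.comp f g p hg).label (M.sliceData.φ f g p hg q)) :
    M.sliceData.comp (M.sliceData.comp f g p hg) h (M.sliceData.φ f g p hg q) hh'
        = M.sliceData.comp f (M.sliceData.comp g h q hh) p hg ∧
      (∀ r hr hr', (M.sliceData.ψ (M.sliceData.comp f g p hg) h (M.sliceData.φ f g p hg q) hh'
        (M.sliceData.ψ f g p hg r hr) hr' : ℕ)
          = M.sliceData.ψ f (M.sliceData.comp g h q hh) p hg r hr) ∧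
      (∀ r hr hr', (M.sliceData.ψ (M.sliceData.comp f g p hg) h (M.sliceData.φ f g p hg q) hh'
        (M.sliceData.φ f g p hg r) hr' : ℕ)
          = M.sliceData.φ f (M.sliceData.comp g h q hh) p hg (M.sliceData.ψ g h q hh r hr)) ∧
      ∀ r, (M.sliceData.φ (M.sliceData.comp f g p hg) h (M.sliceData.φ f g p hg q) hh' r : ℕ)
        = M.sliceData.φ f (M.sliceData.comp g h q hh) p hg (M.sliceData.φ g h q hh r) := by
  let G : Fin f.n ⊕ Fin g.n ⊕ Fin h.n → M.Arr := Sum.elim f.label (Sum.elim g.label h.label)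
  have Rf := Rep.of (G := G) f (lab := Sum.inl) Sum.inl_injective (fun _ => rfl)
  have Rg := Rep.of (G := G) g (lab := fun r => Sum.inr (Sum.inl r))
    (Sum.inr_injective.comp Sum.inl_injective) (fun _ => rfl)
  have Rh := Rep.of (G := G) h (lab := fun r => Sum.inr (Sum.inr r))
    (Sum.inr_injective.comp Sum.inr_injective) (fun _ => rfl)
  have Rfg := Rf.comp Rg p hg (by simp) rfl (congrArg M.elt hg)
  have Rgh := Rg.comp Rh q hh (by simp) rfl (congrArg M.elt hh)
  have R1 := Rfg.comp Rh (M.sliceData.φ f g p hg q) hh' (fun i _ r => by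
      rcases compLab_cases (Sum.inl : _ → Fin f.n ⊕ Fin g.n ⊕ Fin h.n)
        (fun r => Sum.inr (Sum.inl r)) p hg i with ⟨_, _, e⟩ | ⟨_, e⟩ <;> rw [e] <;> simp)
    (compLab_φ _ _ _ _ _) (congrArg M.elt hh)
  have R2 := Rf.comp Rgh p hg (fun i _ r => by
      rcases compLab_cases (fun r => (Sum.inr (Sum.inl r) : Fin f.n ⊕ Fin g.n ⊕ Fin h.n))
        (fun r => Sum.inr (Sum.inr r)) q hh r with ⟨_, _, e⟩ | ⟨_, e⟩ <;> rw [e] <;> simp)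
    rfl (congrArg M.elt hg)
  rw [plug_assoc _ _ _ _ _ (Rf.notMem (by simp))] at R1
  obtain ⟨h1, h2⟩ := R1.unique R2
  refine ⟨h1, fun r hr hr' => h2 _ _ ?_, fun r hr hr' => h2 _ _ ?_, fun r => h2 _ _ ?_⟩
  · rw [compLab_ψ, compLab_ψ, compLab_ψ]
  · rw [compLab_ψ, compLab_φ, compLab_φ, compLab_ψ]
  · rw [compLab_φ, compLab_φ, compLab_φ]

theorem comm_aux (f g h : Conf M) (p q : Fin f.n) (hpq : p ≠ q) (hg : g.res = f.label p)
    (hh : h.res = f.label q)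
    (hh' : h.res = (M.sliceData.comp f g p hg).label (M.sliceData.ψ f g p hg q hpq.symm))
    (hg' : g.res = (M.sliceData.comp f h q hh).label (M.sliceData.ψ f h q hh p hpq)) :
    M.sliceData.comp (M.sliceData.comp f g p hg) h (M.sliceData.ψ f g p hg q hpq.symm) hh'
        = M.sliceData.comp (M.sliceData.comp f h q hh) g (M.sliceData.ψ f h q hh p hpq) hg' ∧
      (∀ r hp hq hr hr', (M.sliceData.ψ (M.sliceData.comp f g p hg) h
          (M.sliceData.ψ f g p hg q hpq.symm) hh' (M.sliceData.ψ f g p hg r hp) hr : ℕ)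
        = M.sliceData.ψ (M.sliceData.comp f h q hh) g (M.sliceData.ψ f h q hh p hpq) hg'
          (M.sliceData.ψ f h q hh r hq) hr') ∧
      (∀ r hr, (M.sliceData.ψ (M.sliceData.comp f g p hg) h
          (M.sliceData.ψ f g p hg q hpq.symm) hh' (M.sliceData.φ f g p hg r) hr : ℕ)
        = M.sliceData.φ (M.sliceData.comp f h q hh) g (M.sliceData.ψ f h q hh p hpq) hg' r) ∧
      ∀ r hr, (M.sliceData.φ (M.sliceData.comp f g p hg) h
          (M.sliceData.ψ f g p hg q hpq.symm) hh' r : ℕ)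
        = M.sliceData.ψ (M.sliceData.comp f h q hh) g (M.sliceData.ψ f h q hh p hpq) hg'
          (M.sliceData.φ f h q hh r) hr := by
  let G : Fin f.n ⊕ Fin g.n ⊕ Fin h.n → M.Arr := Sum.elim f.label (Sum.elim g.label h.label)
  have Rf := Rep.of (G := G) f (lab := Sum.inl) Sum.inl_injective (fun _ => rfl)
  have Rg := Rep.of (G := G) g (lab := fun r => Sum.inr (Sum.inl r))
    (Sum.inr_injective.comp Sum.inl_injective) (fun _ => rfl)
  have Rh := Rep.of (G := G) h (lab := fun r => Sum.inr (Sum.inr r))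
    (Sum.inr_injective.comp Sum.inr_injective) (fun _ => rfl)
  have Rfg := Rf.comp Rg p hg (by simp) rfl (congrArg M.elt hg)
  have Rfh := Rf.comp Rh q hh (by simp) rfl (congrArg M.elt hh)
  have R1 := Rfg.comp Rh (M.sliceData.ψ f g p hg q hpq.symm) hh' (fun i _ r => by
      rcases compLab_cases (Sum.inl : _ → Fin f.n ⊕ Fin g.n ⊕ Fin h.n)
        (fun r => Sum.inr (Sum.inl r)) p hg i with ⟨_, _, e⟩ | ⟨_, e⟩ <;> rw [e] <;> simp)
    (compLab_ψ _ _ _ _ _ _) (congrArg M.elt hh)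
  have R2 := Rfh.comp Rg (M.sliceData.ψ f h q hh p hpq) hg' (fun i _ r => by
      rcases compLab_cases (Sum.inl : _ → Fin f.n ⊕ Fin g.n ⊕ Fin h.n)
        (fun r => Sum.inr (Sum.inr r)) q hh i with ⟨_, _, e⟩ | ⟨_, e⟩ <;> rw [e] <;> simp)
    (compLab_ψ _ _ _ _ _ _) (congrArg M.elt hg)
  rw [plug_comm _ _ _ _ _ (by simpa using hpq) (Rg.notMem (by simp)) (Rh.notMem (by simp))] at R1
  obtain ⟨h1, h2⟩ := R1.unique R2
  refine ⟨h1, fun r hp hq hr hr' => h2 _ _ ?_, fun r hr => h2 _ _ ?_, fun r hr => h2 _ _ ?_⟩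
  · rw [compLab_ψ, compLab_ψ, compLab_ψ, compLab_ψ]
  · rw [compLab_ψ, compLab_φ, compLab_φ]
  · rw [compLab_φ, compLab_ψ, compLab_φ]

variable (M) in
/-- The slice `M₊`. -/
noncomputable def slice : GenMulticat.{u} where
  toGenMulticatData := M.sliceData
  id_comp y f p h := (id_comp_aux y f p h).1
  id_comp_φ y f p h := (id_comp_aux y f p h).2
  comp_id f x p h := (comp_id_aux f x p h).1
  comp_id_ψ f x p h := (comp_id_aux f x p h).2.1
  comp_id_φ f x p h := (comp_id_aux f x p h).2.2
  assoc f g h p q hg hh := (assoc_aux f g h p q hg hh _).1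
  assoc_ψψ f g h p q hg hh r hr := (assoc_aux f g h p q hg hh _).2.1 r hr _
  assoc_ψφ f g h p q hg hh r hr := (assoc_aux f g h p q hg hh _).2.2.1 r hr _
  assoc_φ f g h p q hg hh := (assoc_aux f g h p q hg hh _).2.2.2
  comm f g h p q hpq hg hh := (comm_aux f g h p q hpq hg hh _ _).1
  comm_ψψ f g h p q hpq hg hh r hp hq := (comm_aux f g h p q hpq hg hh _ _).2.1 r hp hq _ _
  comm_ψφ f g h p q hpq hg hh r := (comm_aux f g h p q hpq hg hh _ _).2.2.1 r _
  comm_φψ f g h p q hpq hg hh r := (comm_aux f g h p q hpq hg hh _ _).2.2.2 r _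

end GenMulticat

/-! ### Opetopes and multitopes -/

/-- The symmetric multicategory with one object, one object-morphism and one arrow. -/
def I : SymMulticat.{0} where
  Obj := Discrete Unit
  Hom {n} _ _ := PLift (n = 1)
  ι _ := ⟨rfl⟩
  comp f g := ⟨by
    obtain ⟨rfl⟩ := f
    simpa using (g 0).down⟩
  act σ f := ⟨(Fin.equiv_iff_eq.1 ⟨σ⟩).trans f.down⟩
  id_comp _ := Subsingleton.elim _ _
  comp_id _ := Subsingleton.elim _ _
  assoc _ _ _ := Subsingleton.elim _ _
  act_refl _ := Subsingleton.elim _ _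
  act_act _ _ _ := Subsingleton.elim _ _
  act_comp _ _ _ := Subsingleton.elim _ _
  comp_act _ _ _ := Subsingleton.elim _ _
  ι_comp _ _ := Subsingleton.elim _ _

/-- The generalised multicategory with one object and one arrow. -/
def J : GenMulticat.{0} where
  Obj := Unit
  Arr := Unit
  arity _ := 1
  src _ _ := ()
  tgt _ := ()
  comp _ _ _ _ := ()
  amal _ _ p _ :=
    haveI : IsEmpty {q : Fin 1 // q ≠ p} := ⟨fun q => q.2 (Subsingleton.elim _ _)⟩
    Equiv.emptySum _ _
  tgt_comp _ _ _ _ := rfl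
  src_inl _ _ _ _ _ := rfl
  src_inr _ _ _ _ _ := rfl
  id _ := ()
  arity_id _ := rfl
  src_id _ _ := rfl
  tgt_id _ := rfl
  id_comp _ _ _ _ := rfl
  id_comp_φ _ _ _ _ _ := congrArg Fin.val (Subsingleton.elim (α := Fin 1) _ _)
  comp_id _ _ _ _ := rfl
  comp_id_ψ _ _ _ _ _ _ := congrArg Fin.val (Subsingleton.elim (α := Fin 1) _ _)
  comp_id_φ _ _ _ _ _ := congrArg Fin.val (Subsingleton.elim (α := Fin 1) _ _)
  assoc _ _ _ _ _ _ _ := rfl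
  assoc_ψψ _ _ _ _ _ _ _ _ _ := congrArg Fin.val (Subsingleton.elim (α := Fin 1) _ _)
  assoc_ψφ _ _ _ _ _ _ _ _ _ := congrArg Fin.val (Subsingleton.elim (α := Fin 1) _ _)
  assoc_φ _ _ _ _ _ _ _ _ := congrArg Fin.val (Subsingleton.elim (α := Fin 1) _ _)
  comm _ _ _ _ _ _ _ _ := rfl
  comm_ψψ _ _ _ _ _ _ _ _ _ _ _ := congrArg Fin.val (Subsingleton.elim (α := Fin 1) _ _)
  comm_ψφ _ _ _ _ _ _ _ _ _ := congrArg Fin.val (Subsingleton.elim (α := Fin 1) _ _)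
  comm_φψ _ _ _ _ _ _ _ _ _ := congrArg Fin.val (Subsingleton.elim (α := Fin 1) _ _)

/-- The iterated slices `Q^{k+}`. -/
def SymMulticat.iterSlice (Q : SymMulticat.{u}) : ℕ → SymMulticat.{u}
  | 0 => Q
  | k + 1 => (Q.iterSlice k).slice

/-- The iterated slices `M_{k+}`. -/
noncomputable def GenMulticat.iterSlice (M : GenMulticat.{u}) : ℕ → GenMulticat.{u}
  | 0 => M
  | k + 1 => (M.iterSlice k).slice

end Opetopic

/-! The proof constructs, by induction on `k`, an equivalence from `ξ(J_{k+})` to `I^{k+}`; the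
opposite equivalence is then obtained by inverting it. The induction step is the composite
`ξ(J_{(k+1)+}) → ξ(J_{k+})⁺ → I^{(k+1)+}`, and its two factors come from facts about arbitrary
multicategories.

Slicing preserves equivalences (`IsEquivalence.slice`). A morphism acts on the objects of the slice,
which are arrows, and on its arrows, which are trees. The shape of a tree and the labels of its
nodes and leaves are untouched; only the object-morphisms on the edges and the arrows at the nodes
are moved. Full faithfulness on objects lifts the edge labels uniquely, and injectivity on arrows
reflects the value of the composite.

The constructions `ξ` and slice commute up to equivalence (`xiSlice_isEquivalence`). Every arrow
`(f, σ)` of `ξ(M)` is isomorphic to `(f, 1)`, and the category of elements of `ξ(M)` is thin, so the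
arrows of `M`, as a discrete category, are equivalent to it. An arrow of `ξ(M₊)` is a tree with
nodes numbered in depth-first order, together with a bijection from these numbers to the source
positions; this is the same as a tree whose nodes are labelled by the source positions, each once.
The two compositions look different, since `ξ(M₊)` iterates `∘_p` while the slice of `ξ(M)`
substitutes for all nodes at once; `Lab.tree_bind` shows that they agree.

For `k = 0` both sides have exactly one arrow in arity one and none in the other arities. An
equivalence is inverted by conjugating an arrow with the counit isomorphisms and lifting the result
(`IsEquivalence.exists_inverse`). -/

namespace Opetopic

/-! ### Morphisms of symmetric multicategories: composition and preservation of derived operations.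
-/

namespace SymMulticat.Mor

variable {Q R P : SymMulticat.{u}}

/-- The composite of two morphisms. -/
def comp (F : Q.Mor R) (G : R.Mor P) : Q.Mor P where
  obj := F.obj ⋙ G.obj
  map f := G.map (F.map f)
  map_ι a := by rw [F.map_ι, G.map_ι]; rfl
  map_comp f g := by rw [F.map_comp, G.map_comp]
  map_act σ f := by rw [F.map_act, G.map_act]

theorem IsEquivalence.comp {F : Q.Mor R} {G : R.Mor P} (hF : F.IsEquivalence)
    (hG : G.IsEquivalence) : (F.comp G).IsEquivalence := by
  have := hF.1
  have := hG.1
  refine ⟨inferInstanceAs (F.obj ⋙ G.obj).IsEquivalence, fun n x y => ?_⟩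
  exact (hG.2 n _ _).comp (hF.2 n x y)

variable (F : Q.Mor R)

/-- Once the equality of sequences is substituted, the cast in `reindex` disappears and `map_act`
remains. -/
theorem map_reindex {m n : ℕ} {x : Fin n → Q.Obj} {x' : Fin m → Q.Obj} {y : Q.Obj}
    (σ : Fin m ≃ Fin n) (h : ∀ i, x' i = x (σ i)) (f : Q.Hom x y) :
    F.map (Q.reindex σ h f) = R.reindex σ (fun i => congrArg F.obj.obj (h i)) (F.map f) := by
  obtain rfl : x' = fun i => x (σ i) := funext h
  exact F.map_act σ f

theorem map_post {n : ℕ} {x : Fin n → Q.Obj} {y z : Q.Obj} (a : y ⟶ z) (f : Q.Hom x y) :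
    F.map (Q.post a f) = R.post (F.obj.map a) (F.map f) := by
  have e := (F.map_comp (Q.ι a) (fun _ => f)).trans
    (congrArg (fun w => R.comp w (fun _ => F.map f)) (F.map_ι a))
  exact (F.map_reindex _ _ _).trans (congrArg (R.reindex _ _) e)

/-- This is what lets a morphism act on the category of elements: the condition `w` of an `Elt.Mor`
is carried to the same condition on the images. -/
theorem map_transport {n n' : ℕ} {x : Fin n → Q.Obj} {x' : Fin n' → Q.Obj} {y y' : Q.Obj}
    (σ : Fin n ≃ Fin n') (l : ∀ i, x' (σ i) ⟶ x i) (r : y ⟶ y') (g : Q.Hom x y) :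
    F.map (transport σ l r g)
      = transport σ (fun i => F.obj.map (l i)) (F.obj.map r) (F.map g) := by
  refine (F.map_reindex _ _ _).trans (congrArg (R.reindex _ _) ?_)
  refine (F.map_post _ _).trans (congrArg (R.post _) ?_)
  refine (F.map_comp _ _).trans (congrArg (R.comp _) (funext fun i => F.map_ι _))

/-- The action of a morphism on the objects of the slices. -/
abbrev elt (e : Q.Elt) : R.Elt :=
  ⟨e.arity, fun i => F.obj.obj (e.src i), F.obj.obj e.tgt, F.map e.hom⟩

end SymMulticat.Mor

/-! ### The action of a morphism on trees, and its lifting properties. -/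

namespace SymMulticat.Tree

variable {Q R : SymMulticat.{u}} (Φ : Q.Mor R) {N L : Type} {F : N → Q.Elt} {x : L → Q.Obj}
  {z : Q.Obj}

/-- The action of a morphism on trees. -/
def map : {z : Q.Obj} → Tree F x z →
    Tree (fun ν => Φ.elt (F ν)) (fun ℓ => Φ.obj.obj (x ℓ)) (Φ.obj.obj z)
  | _, edge ℓ a => edge ℓ (Φ.obj.map a)
  | _, node ν a t => node ν (Φ.obj.map a) fun i => (t i).map

theorem nodes_map (T : Tree F x z) : (T.map Φ).nodes = T.nodes := by
  induction T with
  | edge ℓ a => rfl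
  | node ν a t ih => simp only [map, nodes, ih]

theorem map_post {w : Q.Obj} (T : Tree F x z) (a : z ⟶ w) :
    (T.post a).map Φ = (T.map Φ).post (Φ.obj.map a) := by
  cases T <;> simp [post, map]

theorem map_graft {L' : Type} {x' : L' → Q.Obj} (T : Tree F x z) (s : ∀ ℓ, Tree F x' (x ℓ)) :
    (T.graft s).map Φ = (T.map Φ).graft fun ℓ => (s ℓ).map Φ := by
  induction T with
  | edge ℓ a => exact map_post Φ _ _
  | node ν a t ih => exact congrArg (node ν _) (funext ih)

/-- Substitution at a node is a graft followed by a composition at the root edge, so the claim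
reduces to `map_graft` and `map_post`. It is the compatibility of the sliced morphism with
composition. -/
theorem map_subst {N' : Type} {F' : N' → Q.Elt} (S : ∀ ν, Tree F' (F ν).src (F ν).tgt)
    (T : Tree F x z) : (T.subst S).map Φ = (T.map Φ).subst fun ν => (S ν).map Φ := by
  induction T with
  | edge ℓ a => rfl
  | node ν a t ih =>
    refine (map_post Φ _ _).trans (congrArg (fun T => post T (Φ.obj.map a)) ?_)
    exact (map_graft Φ _ _).trans (congrArg (graft ((S ν).map Φ)) (funext ih))

theorem map_castT {e e' : Q.Elt} (h : e = e') (T : Tree F e.src e.tgt) :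
    (castT h T).map Φ = castT (congrArg Φ.elt h) (T.map Φ) := by subst h; rfl

theorem map_corolla (ν : N) :
    (corolla F ν).map Φ = corolla (fun ν => Φ.elt (F ν)) ν := by
  simp [corolla, map]

theorem map_reN {N' : Type} {F' : N' → Q.Elt} (φ : N → N') (h : ∀ ν, F ν = F' (φ ν))
    (T : Tree F x z) :
    (T.reN φ h).map Φ = (T.map Φ).reN φ fun ν => congrArg Φ.elt (h ν) := by
  refine (map_subst Φ _ _).trans (congrArg (fun S => subst S (T.map Φ)) (funext fun ν => ?_))
  rw [map_castT, map_corolla]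

theorem Full.map {T : Tree F x z} (hT : T.Full) : (T.map Φ).Full := by
  rw [Full, nodes_map]
  exact hT

/-- The composite of a tree is built from `ι`, `post` and `comp`, all of which a morphism preserves.
The comparison goes through `EvalsTo` and not through an equation of composites because `T` and
`T.map Φ` have the same number of leaves only propositionally. -/
theorem EvalsTo.map {T : Tree F x z} {n : ℕ} {l : Fin n → L}
    {f : Q.Hom (fun i => x (l i)) z} (hf : T.EvalsTo l f) : (T.map Φ).EvalsTo l (Φ.map f) := by
  have key : (T.map Φ).EvalsTo T.leaf (Φ.map T.eval) := by
    clear hf f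
    induction T with
    | edge ℓ a =>
      have h := EvalsTo.edge (F := fun ν => Φ.elt (F ν)) (x := fun ℓ => Φ.obj.obj (x ℓ)) ℓ
        (Φ.obj.map a)
      rw [← Φ.map_ι] at h
      exact h
    | node ν a t ih =>
      have h := EvalsTo.node (F := fun ν => Φ.elt (F ν)) ν (Φ.obj.map a) _ ih
      have e := (Φ.map_post a (Q.comp (F ν).hom fun i => (t i).eval)).trans
        (congrArg (R.post _) (Φ.map_comp (F ν).hom fun i => (t i).eval))
      exact e ▸ h
  obtain ⟨ρ, hρ, rfl⟩ := hf
  rw [Φ.map_reindex]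
  exact key.reindex ρ hρ

section Equivalence

variable {Φ}

/-- The shape and the labels of nodes and leaves can be read off from the image; the edge labels are
recovered by faithfulness. -/
theorem map_injective (hΦ : Φ.obj.Faithful) {T T' : Tree F x z} (h : T.map Φ = T'.map Φ) :
    T = T' := by
  induction T with
  | edge ℓ a =>
    cases T' with
    | edge ℓ' a' =>
      injection h with h1 _ h2
      subst h1
      exact congrArg (edge ℓ) (Φ.obj.map_injective (eq_of_heq h2))
    | node ν' a' t' => cases h
  | node ν a t ih =>
    cases T' with
    | edge ℓ' a' => cases h
    | node ν' a' t' =>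
      injection h with h1 _ h2 h3
      subst h1
      rw [Φ.obj.map_injective (eq_of_heq h2)]
      exact congrArg (node ν a') (funext fun i => ih i (congrFun (eq_of_heq h3) i))

/-- The morphism `a` is there for the induction: the root object `w` is a variable of the induction
and need not be an image object, but after composition with `a` the root edge runs between two image
objects and lifts by fullness. The case of interest is `a = 𝟙`. -/
theorem exists_map_eq (hΦ : Φ.obj.Full) {w : R.Obj}
    (T : Tree (fun ν => Φ.elt (F ν)) (fun ℓ => Φ.obj.obj (x ℓ)) w) {z : Q.Obj}
    (a : w ⟶ Φ.obj.obj z) : ∃ T' : Tree F x z, T'.map Φ = T.post a := by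
  induction T generalizing z with
  | edge ℓ b =>
    obtain ⟨c, hc⟩ := Φ.obj.map_surjective (b ≫ a)
    exact ⟨edge ℓ c, congrArg (edge ℓ) hc⟩
  | node ν b t ih =>
    obtain ⟨c, hc⟩ := Φ.obj.map_surjective (b ≫ a)
    -- The subtrees above a node already end at image objects, so the identity suffices for them,
    -- and `post_id` removes it again.
    choose t' ht' using fun i => ih i (𝟙 (Φ.obj.obj ((F ν).src i)))
    refine ⟨node ν c t', ?_⟩
    have e : (fun i => (t' i).map Φ) = t := funext fun i => (ht' i).trans (post_id _)
    simp only [map, post, hc, e]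

/-- The hypothesis supplies a matching of `l` with the leaves. Reordering the composite of `T`
accordingly gives some value of `T`; its image is a value of `T.map Φ` with the same distinct
labels, hence equals `Φ.map f`, and injectivity of `Φ` on arrows identifies the value with `f`. -/
theorem EvalsTo.of_map {T : Tree F x z} {n : ℕ} {l : Fin n → L} (hl : Function.Injective l)
    {f : Q.Hom (fun i => x (l i)) z}
    (hΦ : Function.Injective fun f : Q.Hom (fun i => x (l i)) z => Φ.map f)
    (hf : (T.map Φ).EvalsTo l (Φ.map f)) : T.EvalsTo l f := by
  -- Here `ρ₁` matches the leaves of `T` with those of `T.map Φ`; only the labels matter, not the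
  -- equation of composites.
  obtain ⟨ρ₁, h₁, -⟩ := (EvalsTo.eval T).map Φ
  obtain ⟨ρ₂, h₂, -⟩ := id hf
  have h := (EvalsTo.eval T).reindex (ρ₂.trans ρ₁.symm)
    (l' := l) (fun i => by rw [h₁]; simpa using h₂ i)
  exact hΦ ((h.map Φ).unique hl hf) ▸ h

end Equivalence

end SymMulticat.Tree

/-! ### Slices of morphisms, and the slice of an equivalence. -/

namespace SymMulticat

variable {Q R : SymMulticat.{u}}

/-- A morphism between arrows with isomorphisms as components is an isomorphism. -/
def Elt.isoMk {n : ℕ} {x x' : Fin n → Q.Obj} {y y' : Q.Obj} (l : ∀ i, x' i ≅ x i) (r : y ≅ y')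
    (g : Q.Hom x y) : (⟨n, x, y, g⟩ : Q.Elt) ≅
      ⟨n, x', y', transport (Equiv.refl _) (fun i => (l i).hom) r.hom g⟩ where
  hom := Elt.Mor.mk (g := ⟨n, x, y, g⟩)
    (g' := ⟨n, x', y', transport (Equiv.refl _) (fun i => (l i).hom) r.hom g⟩)
    (Equiv.refl _) (fun i => (l i).hom) r.hom rfl
  inv := Elt.Mor.mk (g' := ⟨n, x, y, g⟩)
    (g := ⟨n, x', y', transport (Equiv.refl _) (fun i => (l i).hom) r.hom g⟩)
    (Equiv.refl _) (fun i => (l i).inv) r.inv (by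
      -- The two successive actions combine into the action of `inv ≫ hom` on each source element
      -- and `hom ≫ inv` on the target, which is trivial.
      refine (transport_transport (Equiv.refl _) (fun i => (l i).hom) r.hom (Equiv.refl _)
        (fun i => (l i).inv) r.inv g).trans ?_
      refine Eq.trans ?_ (transport_id g)
      congr 1
      · exact funext fun i => (l i).inv_hom_id
      · exact r.hom_inv_id)
  hom_inv_id := Elt.Mor.ext (Equiv.ext fun _ => rfl)
    (heq_of_eq (funext fun i => (l i).inv_hom_id)) r.hom_inv_id
  inv_hom_id := Elt.Mor.ext (Equiv.ext fun _ => rfl)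
    (heq_of_eq (funext fun i => (l i).hom_inv_id)) r.inv_hom_id

namespace Mor

variable (F : Q.Mor R)

/-- The action of a morphism on the categories of elements. -/
def eltFunctor : Q.Elt ⥤ R.Elt where
  obj := F.elt
  map {g g'} α := (⟨α.perm, fun i => F.obj.map (α.left i), F.obj.map α.right, by
    rw [← F.map_transport, α.w]⟩ : Elt.Mor (F.elt g) (F.elt g'))
  map_id g := Elt.Mor.ext rfl (heq_of_eq (funext fun _ => F.obj.map_id _)) (F.obj.map_id _)
  map_comp α β := Elt.Mor.ext rfl (heq_of_eq (funext fun _ => F.obj.map_comp _ _))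
    (F.obj.map_comp _ _)

/-- The action of a morphism on the slices. -/
def slice : Q.slice.Mor R.slice where
  obj := F.eltFunctor
  map f := ⟨f.1.map F, f.2.1.map F, f.2.2.map F⟩
  map_ι _ := rfl
  map_comp f g := by
    refine Subtype.ext ((Tree.map_subst F _ _).trans ?_)
    exact congrArg (fun S => Tree.subst S (f.1.map F)) (funext fun i => Tree.map_reN F _ _ _)
  map_act {m n x y} σ f := Subtype.ext (Tree.map_reN F (F' := fun i => x (σ i)) σ.symm
    (fun i => by rw [Equiv.apply_symm_apply]) f.1)

variable {F}

/-- A morphism of elements is a permutation with object-morphisms satisfying one equation of arrows.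
The permutation is kept, the components lift uniquely, and the equation is reflected because `F` is
injective on arrows. For essential surjectivity an arrow is first moved to source and target objects
in the image. -/
theorem IsEquivalence.eltFunctor (hF : F.IsEquivalence) : F.eltFunctor.IsEquivalence where
  faithful := ⟨fun {g g'} α β h => by
    have := hF.1
    obtain ⟨p, l, r, w⟩ := α
    obtain ⟨p', l', r', w'⟩ := β
    obtain rfl : p = p' := congrArg Elt.Mor.perm (show (_ : Elt.Mor _ _) = _ from h)
    injection h with _ h2 h3
    exact Elt.Mor.ext rfl (heq_of_eq (funext fun i => F.obj.map_injective (congrFun h2 i)))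
      (F.obj.map_injective h3)⟩
  full := ⟨fun {g g'} α => by
    have := hF.1
    refine ⟨(⟨α.perm, fun i => F.obj.preimage (α.left i), F.obj.preimage α.right,
      (hF.2 _ _ _).1 ?_⟩ : Elt.Mor g g'), ?_⟩
    · refine (F.map_transport _ _ _ _).trans ?_
      refine Eq.trans ?_ (Elt.Mor.w α)
      congr 1
      · exact funext fun i => F.obj.map_preimage _
      · exact F.obj.map_preimage _
    · exact Elt.Mor.ext rfl (heq_of_eq (funext fun _ => F.obj.map_preimage _))
        (F.obj.map_preimage _)⟩
  essSurj := ⟨fun e => by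
    have := hF.1
    obtain ⟨n, x, y, g⟩ := e
    -- Sources are contravariant and the target covariant in `transport`, hence `hom` on the sources
    -- and `inv` on the target.
    obtain ⟨f, hf⟩ := (hF.2 n (fun i => F.obj.objPreimage (x i)) (F.obj.objPreimage y)).2
      (transport (Equiv.refl _) (fun i => (F.obj.objObjPreimageIso (x i)).hom)
        (F.obj.objObjPreimageIso y).inv g)
    refine ⟨⟨n, _, _, f⟩, ⟨?_⟩⟩
    have i := Elt.isoMk (fun i => F.obj.objObjPreimageIso (x i))
      (F.obj.objObjPreimageIso y).symm g
    exact eqToIso (congrArg (Elt.mk n _ _) hf) ≪≫ i.symm⟩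

/-- Trees lift uniquely because the functor on objects is fully faithful. The lift is again a
configuration: its node labels are the same, and its value is reflected by `EvalsTo.of_map`, for
which injectivity on arrows is needed. -/
theorem IsEquivalence.slice (hF : F.IsEquivalence) : F.slice.IsEquivalence := by
  have := hF.1
  refine ⟨hF.eltFunctor, fun n x y => ⟨fun f g h => ?_, fun T => ?_⟩⟩
  · exact Subtype.ext (Tree.map_injective inferInstance (congrArg Subtype.val h))
  · obtain ⟨T, h1, h2⟩ := T
    obtain ⟨T', hT'⟩ := Tree.exists_map_eq (F := x) (Φ := F) inferInstance T (𝟙 _)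
    obtain rfl : T'.map F = T := hT'.trans (Tree.post_id _)
    refine ⟨⟨T', ?_, ?_⟩, rfl⟩
    · exact ⟨Tree.nodes_map F T' ▸ h1.1, Tree.nodes_map F T' ▸ h1.2⟩
    · exact Tree.EvalsTo.of_map Function.injective_id (hF.2 _ _ _).1 h2

end Mor

end SymMulticat

/-! ### Conjugation of arrows by object-morphisms, and the inverse of an equivalence. -/

namespace SymMulticat

variable {Q R : SymMulticat.{u}}

/-- Composition of the sources and the target with object-morphisms. -/
abbrev conj {n : ℕ} {x x' : Fin n → Q.Obj} {y y' : Q.Obj} (l : ∀ i, x' i ⟶ x i) (r : y ⟶ y')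
    (g : Q.Hom x y) : Q.Hom x' y' :=
  transport (Equiv.refl _) l r g

theorem conj_conj {n : ℕ} {x x' x'' : Fin n → Q.Obj} {y y' y'' : Q.Obj} (l : ∀ i, x' i ⟶ x i)
    (r : y ⟶ y') (l' : ∀ i, x'' i ⟶ x' i) (r' : y' ⟶ y'') (g : Q.Hom x y) :
    conj l' r' (conj l r g) = conj (fun i => l' i ≫ l i) (r ≫ r') g :=
  transport_transport _ _ _ _ _ _ _

theorem conj_eq_self {n : ℕ} {x : Fin n → Q.Obj} {y : Q.Obj} {l : ∀ i, x i ⟶ x i} {r : y ⟶ y}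
    (hl : ∀ i, l i = 𝟙 (x i)) (hr : r = 𝟙 y) (g : Q.Hom x y) : conj l r g = g := by
  obtain rfl : l = fun i => 𝟙 (x i) := funext hl
  subst hr
  exact transport_id g

theorem conj_bijective {n : ℕ} {x x' : Fin n → Q.Obj} {y y' : Q.Obj} (l : ∀ i, x' i ≅ x i)
    (r : y ≅ y') : Function.Bijective
      (fun g : Q.Hom x y => conj (fun i => (l i).hom) r.hom g) := by
  refine Function.bijective_iff_has_inverse.2
    ⟨fun g => conj (fun i => (l i).inv) r.inv g, fun g => ?_, fun g => ?_⟩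
  · exact (conj_conj _ _ _ _ _).trans
      (conj_eq_self (fun i => (l i).inv_hom_id) r.hom_inv_id g)
  · exact (conj_conj _ _ _ _ _).trans
      (conj_eq_self (fun i => (l i).hom_inv_id) r.inv_hom_id g)

/-- Together with `conj_act` and `conj_comp` this is what the axioms of the inverse morphism reduce
to. -/
theorem conj_ι {x x' y y' : Q.Obj} (l : x' ⟶ x) (r : y ⟶ y') (a : x ⟶ y) :
    conj (x' := fun _ : Fin 1 => x') (fun _ => l) r (Q.ι a) = Q.ι (l ≫ a ≫ r) := by
  rw [conj, transport, Q.ι_comp, Q.post_reindex, Q.post_ι, Q.reindex_reindex, Category.assoc]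
  exact (Q.reindex_congr (σ' := Equiv.refl _) (fun i => Subsingleton.elim (α := Fin 1) _ _) _
    (fun _ => rfl) _).trans (Q.reindex_refl _ _)

theorem conj_eq_reindex {n : ℕ} {x x' : Fin n → Q.Obj} {y y' : Q.Obj} (l : ∀ i, x' i ⟶ x i)
    (r : y ⟶ y') (g : Q.Hom x y) :
    conj l r g = Q.reindex (sumOneEquiv n).symm (concat_sumOne_symm x')
      (Q.post r (Q.comp g (fun i => Q.ι (l i)))) := rfl

theorem conj_act {m n : ℕ} {x x' : Fin n → Q.Obj} {y y' : Q.Obj} (l : ∀ i, x' i ⟶ x i)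
    (r : y ⟶ y') (σ : Fin m ≃ Fin n) (g : Q.Hom x y) :
    conj (fun i => l (σ i)) r (Q.act σ g) = Q.act σ (conj l r g) := by
  have e := Q.act_comp g (fun i => Q.ι (l i)) σ
  rw [conj_eq_reindex, conj_eq_reindex]
  refine (congrArg (fun w => Q.reindex _ _ (Q.post r w)) e).trans ?_
  rw [Q.post_reindex, Q.reindex_reindex]
  refine Eq.trans ?_ (Q.reindex_reindex (sumOneEquiv n).symm (concat_sumOne_symm x') σ
    (fun _ => rfl) (Q.post r (Q.comp g (fun i => Q.ι (l i))))).symm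
  -- When all blocks have length one, the block permutation induced by `σ` is `σ` itself.
  exact Q.reindex_congr (fun i => by simp [blockEquiv, sumOneEquiv]) _ _ _

theorem post_conj {n : ℕ} {x x' : Fin n → Q.Obj} {y y' z : Q.Obj} (l : ∀ i, x' i ⟶ x i)
    (r : y ⟶ y') (a : y' ⟶ z) (g : Q.Hom x y) :
    Q.post a (conj l r g) = conj l (r ≫ a) g := by
  rw [conj_eq_reindex, conj_eq_reindex, Q.post_reindex, Q.post_post]

/-- The leaf labels `c` are arbitrary, so that such a node can serve as one layer of a larger tree.
-/
theorem Tree.evalsTo_conj {N L : Type} {F : N → Q.Elt} {x : L → Q.Obj} {z : Q.Obj} (ν : N)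
    (c : Fin (F ν).arity → L) (l : ∀ i, x (c i) ⟶ (F ν).src i) (r : (F ν).tgt ⟶ z) :
    (node ν r (fun i => edge (c i) (l i)) : Tree F x z).EvalsTo c (conj l r (F ν).hom) :=
  ⟨(sumOneEquiv _).symm, concat_sumOne_symm c, rfl⟩

/-- Both sides are values of one tree of height two, with `f` at the root, the `g i` above it and
the `l i` on the edges between: the left side by grafting the upper layer onto the lower one, the
right side by building the tree from its root. Labelling the leaves by pairs `(i, j)` makes the
labels distinct, so `EvalsTo.unique` applies and no permutation has to be computed. -/
theorem conj_comp_eq_post {k : ℕ} {x x' : Fin k → Q.Obj} {y y' : Q.Obj} {m : Fin k → ℕ}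
    {u : ∀ i, Fin (m i) → Q.Obj} (l : ∀ i, x' i ⟶ x i) (r : y ⟶ y') (f : Q.Hom x y)
    (g : ∀ i, Q.Hom (u i) (x' i)) :
    Q.comp (conj l r f) g = Q.post r (Q.comp f fun i => Q.post (l i) (g i)) := by
  let F : Option (Fin k) → Q.Elt := fun o => o.elim ⟨k, x, y, f⟩ fun i => ⟨m i, u i, x' i, g i⟩
  let w : ((i : Fin k) × Fin (m i)) → Q.Obj := fun p => u p.1 p.2
  let s : ∀ i, Tree F w (x' i) := fun i =>
    .node (some i) (𝟙 (x' i)) fun j => .edge ⟨i, j⟩ (𝟙 (u i j))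
  have hs : ∀ i, (s i).EvalsTo (fun j => ⟨i, j⟩) (g i) := fun i => by
    have h := Tree.evalsTo_conj (F := F) (x := w) (some i) (fun j => ⟨i, j⟩)
      (fun j => 𝟙 (u i j)) (𝟙 (x' i))
    exact conj_eq_self (fun _ => rfl) rfl (g i) ▸ h
  -- The grafted tree unfolds to the tree of `h2`: each `l i` is absorbed into the root edge of `s
  -- i`.
  have h1 := Tree.EvalsTo.graft (Tree.evalsTo_conj (F := F) (x := x') none id l r) hs
  have h2 := Tree.EvalsTo.node (F := F) none r _ fun i => (hs i).post (l i)
  exact h1.unique finSigmaFinEquiv.symm.injective h2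

/-- At the objects along which the arrows are composed, the conjugations contribute `(l i).inv`
followed by `(l i).hom`, which cancel; the outer morphisms remain. -/
theorem conj_comp {k : ℕ} {x x' : Fin k → Q.Obj} {y y' : Q.Obj} {m : Fin k → ℕ}
    {u v : ∀ i, Fin (m i) → Q.Obj} (l : ∀ i, x' i ≅ x i) (r : y ⟶ y')
    (l' : ∀ i j, v i j ⟶ u i j) (f : Q.Hom x y) (g : ∀ i, Q.Hom (u i) (x i)) :
    conj (x := concat u) (x' := concat v)
        (fun q => l' (finSigmaFinEquiv.symm q).1 (finSigmaFinEquiv.symm q).2) r (Q.comp f g)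
      = Q.comp (conj (fun i => (l i).hom) r f) fun i => conj (l' i) (l i).inv (g i) := by
  -- The cancellation at the inner objects, leaving only the action of `l'` on the sources of the `g
  -- i`.
  have e1 : (fun i => Q.post (l i).hom (conj (l' i) (l i).inv (g i)))
      = fun i => Q.reindex (sumOneEquiv _).symm (concat_sumOne_symm (v i))
        (Q.comp (g i) fun j => Q.ι (l' i j)) := funext fun i => by
    rw [post_conj, Iso.inv_hom_id, conj_eq_reindex, Q.post_id]
  have e2 := Q.assoc f g fun i j => Q.ι (l' i j)
  rw [conj_comp_eq_post, e1, Q.comp_reindex, Q.post_reindex, conj_eq_reindex]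
  refine (congrArg (fun w => Q.reindex _ _ (Q.post r w)) e2).trans ?_
  rw [Q.post_reindex, Q.reindex_reindex]
  -- The remaining permutations are the canonical identifications of positions for a third layer of
  -- arity one, so they agree by `assocEquiv_mk`.
  exact Q.reindex_congr (fun q => (assocEquiv_mk (fun i (_ : Fin (m i)) => 1) q 0).symm) _ _ _

namespace Mor

variable {F : Q.Mor R}

theorem IsEquivalence.map_injective (hF : F.IsEquivalence) {n : ℕ} {x : Fin n → Q.Obj}
    {y : Q.Obj} {f g : Q.Hom x y} (h : F.map f = F.map g) : f = g :=
  (hF.2 n x y).1 h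

/-- The preimage of an arrow of `R`, with its source and target replaced by isomorphic ones, under
an equivalence. -/
theorem IsEquivalence.exists_preimage (hF : F.IsEquivalence) [F.obj.IsEquivalence] {n : ℕ}
    {x : Fin n → R.Obj} {y : R.Obj} (g : R.Hom x y) :
    ∃ f : Q.Hom (fun i => F.obj.inv.obj (x i)) (F.obj.inv.obj y),
      F.map f = conj (fun i => (F.obj.asEquivalence.counitIso.app (x i)).hom)
        (F.obj.asEquivalence.counitIso.app y).inv g :=
  (hF.2 _ _ _).2 _

/-- An arrow of `Q` representing an arrow of `R` under an equivalence. -/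
noncomputable def IsEquivalence.preimage (hF : F.IsEquivalence) [F.obj.IsEquivalence] {n : ℕ}
    {x : Fin n → R.Obj} {y : R.Obj} (g : R.Hom x y) :
    Q.Hom (fun i => F.obj.inv.obj (x i)) (F.obj.inv.obj y) :=
  (hF.exists_preimage g).choose

theorem IsEquivalence.map_preimage (hF : F.IsEquivalence) [F.obj.IsEquivalence] {n : ℕ}
    {x : Fin n → R.Obj} {y : R.Obj} (g : R.Hom x y) :
    F.map (hF.preimage g) = conj (fun i => (F.obj.asEquivalence.counitIso.app (x i)).hom)
      (F.obj.asEquivalence.counitIso.app y).inv g :=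
  (hF.exists_preimage g).choose_spec

/-- The inverse of an equivalence. -/
noncomputable def IsEquivalence.inverse (hF : F.IsEquivalence) [F.obj.IsEquivalence] :
    R.Mor Q where
  obj := F.obj.inv
  map := hF.preimage
  -- Each axiom is checked after applying `F`, which is injective on arrows. There `preimage`
  -- becomes conjugation by the counit, and the axiom becomes the corresponding law of `conj`.
  map_ι {x y} a := hF.map_injective <| by
    refine (hF.map_preimage _).trans ((conj_ι _ _ _).trans ?_)
    refine Eq.trans ?_ (F.map_ι _).symm
    congr 1
    -- Naturality of the counit: the image of `inv.map a` is `a` conjugated by the counit.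
    exact (F.obj.asEquivalence.fun_inv_map _ _ a).symm
  map_comp f g := hF.map_injective <| by
    refine (hF.map_preimage _).trans (Eq.trans ?_
      (F.map_comp (hF.preimage f) fun i => hF.preimage (g i)).symm)
    refine (conj_comp (fun i => F.obj.asEquivalence.counitIso.app _) _
      (fun i j => (F.obj.asEquivalence.counitIso.app _).hom) f g).trans ?_
    exact congr (congrArg _ (hF.map_preimage f).symm)
      (funext fun i => (hF.map_preimage (g i)).symm)
  map_act σ f := hF.map_injective <| by
    refine (hF.map_preimage _).trans (Eq.trans ?_ (F.map_act σ (hF.preimage f)).symm)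
    exact (conj_act _ _ σ f).trans (congrArg (R.act σ) (hF.map_preimage f).symm)

/-- On arrows, the inverse followed by `F` is conjugation by the counit isomorphisms, which is
bijective; since `F` is bijective on arrows, so is the inverse. -/
theorem IsEquivalence.exists_inverse (hF : F.IsEquivalence) :
    ∃ G : R.Mor Q, G.IsEquivalence := by
  have := hF.1
  refine ⟨hF.inverse, inferInstanceAs F.obj.inv.IsEquivalence, fun n x y => ?_⟩
  have h := conj_bijective (fun i => F.obj.asEquivalence.counitIso.app (x i))
    (F.obj.asEquivalence.counitIso.app y).symm
  refine (Function.Bijective.of_comp_iff' (hF.2 n _ _) _).1 ?_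
  have e : (fun f => F.map f) ∘ (fun g : R.Hom x y => hF.inverse.map g) = _ :=
    funext fun g => hF.map_preimage g
  rw [e]
  exact h

end Mor

end SymMulticat

/-! ### The category of elements of `ξ(M)`. -/

namespace GenMulticat

open SymMulticat SymMulticat.Tree

variable {M : GenMulticat.{u}}

theorem xi_reindex_val {m n : ℕ} {x : Fin n → M.xi.Obj} {x' : Fin m → M.xi.Obj} {y : M.xi.Obj}
    (σ : Fin m ≃ Fin n) (h : ∀ i, x' i = x (σ i)) (f : M.xi.Hom x y) :
    (M.xi.reindex σ h f).1 = f.1.map σ.symm (by simp [h]) := by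
  obtain rfl : x' = fun i => x (σ i) := funext h
  rfl

/-- The category of objects is discrete; hence the object-morphisms occurring as components of
morphisms of elements never need to be compared. -/
instance {x y : M.xi.Obj} : Subsingleton (x ⟶ y) :=
  ⟨fun a b => Subsingleton.elim (α := Discrete.mk x.as ⟶ Discrete.mk y.as) a b⟩

/-- Discreteness turns all of `l` and `r` into identities, so only the permutation acts. The labels
move along `σ` itself because `transport` acts by `σ.symm`, and the action relabels by the inverse.
-/
theorem xi_transport_val {n n' : ℕ} {x : Fin n → M.xi.Obj} {x' : Fin n' → M.xi.Obj}
    {y y' : M.xi.Obj} (σ : Fin n ≃ Fin n') (l : ∀ i, x' (σ i) ⟶ x i) (r : y ⟶ y')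
    (g : M.xi.Hom x y) : (transport σ l r g).1
      = g.1.map σ fun i => (Discrete.eq_of_hom (l i)).symm := by
  obtain rfl : x = fun i => x' (σ i) := funext fun i => Discrete.ext (Discrete.eq_of_hom (l i)).symm
  obtain rfl : y = y' := Discrete.ext (Discrete.eq_of_hom r)
  have e : M.xi.post r (M.xi.comp g fun i => M.xi.ι (l i))
      = M.xi.reindex (sumOneEquiv n) (concat_sumOne _) g := by
    obtain rfl : l = fun i => 𝟙 (x' (σ i)) := funext fun i => Subsingleton.elim _ _
    obtain rfl : r = 𝟙 y := Subsingleton.elim _ _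
    rw [M.xi.post_id, M.xi.comp_id]
  rw [transport, e, M.xi.reindex_reindex, xi_reindex_val]
  exact Lab.map_congr (fun i => by simp) _ _ _

/-- A compatible permutation is a morphism in the category of elements of `ξ(M)`. -/
def eltMor {e e' : M.xi.Elt} (σ : Fin e.arity ≃ Fin e'.arity)
    (hs : ∀ i, (e.src i).as = (e'.src (σ i)).as) (ht : e.tgt.as = e'.tgt.as)
    (h : e.hom.1.map σ hs = e'.hom.1) : Elt.Mor e e' where
  perm := σ
  left i := Discrete.eqToHom (hs i).symm
  right := Discrete.eqToHom ht
  w := Subtype.ext ((xi_transport_val _ _ _ _).trans h)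

/-- The condition `w` prescribes the permutation on every label occurring in the source of the
underlying arrow, and the labelling is surjective. -/
theorem eltMor_unique {e e' : M.xi.Elt} (α β : Elt.Mor e e') : α = β := by
  have h := (congrArg Subtype.val (α.w.trans β.w.symm))
  rw [xi_transport_val, xi_transport_val] at h
  obtain ⟨p, l, r, w⟩ := α
  obtain ⟨p', l', r', w'⟩ := β
  obtain rfl : p = p' := Equiv.ext fun i => by
    obtain ⟨j, rfl⟩ := e.hom.2.1.2 i
    injection h with _ h2
    exact congrFun h2 j
  exact Elt.Mor.ext rfl (heq_of_eq (funext fun _ => Subsingleton.elim _ _))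
    (Subsingleton.elim _ _)

theorem arr_eq_of_eltMor {e e' : M.xi.Elt} (α : Elt.Mor e e') :
    e.hom.1.arr = e'.hom.1.arr := by
  have h := congrArg Subtype.val α.w
  rw [xi_transport_val] at h
  exact congrArg Lab.arr h

variable (M) in
/-- The functor sending an arrow `f` of `M` to the arrow `(f, 1)` of `ξ(M)`. -/
noncomputable def eltFunctor : Discrete M.Arr ⥤ M.xi.Elt := Discrete.functor M.elt

/-- Morphisms of elements only relabel, so they preserve the underlying arrow of `M`, and there is
at most one between two given elements; this gives fullness and faithfulness. A pair `(f, σ)` is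
isomorphic to `(f, 1)` through its own labelling. -/
instance : M.eltFunctor.IsEquivalence where
  faithful := ⟨fun _ => Subsingleton.elim _ _⟩
  full := ⟨fun {f g} α => ⟨Discrete.eqToHom (arr_eq_of_eltMor (e := M.elt f.as)
    (e' := M.elt g.as) α), eltMor_unique _ _⟩⟩
  essSurj := ⟨fun e => by
    obtain ⟨n, x, y, ⟨A, hA, ht⟩⟩ := e
    have h : ∀ i, A.lab ((Equiv.ofBijective A.lab hA).symm i) = i :=
      (Equiv.ofBijective A.lab hA).apply_symm_apply
    refine ⟨⟨A.arr⟩, ⟨⟨?_, ?_, eltMor_unique _ _, eltMor_unique _ _⟩⟩⟩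
    · exact eltMor (e := M.elt A.arr) (e' := ⟨n, x, y, ⟨A, hA, ht⟩⟩)
        (Equiv.ofBijective A.lab hA) A.src_eq ht (Lab.ext_of rfl fun p => ⟨p, rfl, rfl⟩)
    · exact eltMor (e := ⟨n, x, y, ⟨A, hA, ht⟩⟩) (e' := M.elt A.arr)
        (Equiv.ofBijective A.lab hA).symm
        (fun i => (congrArg (fun i => (x i).as) (h i).symm).trans (A.src_eq _).symm) ht.symm
        (Lab.ext_of rfl fun p => ⟨p, rfl,
          (Equiv.ofBijective A.lab hA).symm_apply_apply p⟩)⟩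

/-- This and `compStep_ne_subst` compute, node by node, a substitution following the insertion of
`B` into `A`. -/
theorem compStep_self_subst {N : Type} {F : N → M.xi.Elt} (A B : Conf M) (p : Fin A.n)
    (h : B.res = A.label p)
    (V : ∀ y, Tree F (M.elt (compLabel A B p y)).src (M.elt (compLabel A B p y)).tgt) :
    (compStep A B p h p).subst V
      = castT (congrArg M.elt h) (B.tree.subst fun r => V (.inr r)) := by
  rw [compStep_self, castT_subst, subst_reN]
  rfl

theorem compStep_ne_subst {N : Type} {F : N → M.xi.Elt} (A B : Conf M) (p : Fin A.n)
    (h : B.res = A.label p)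
    (V : ∀ y, Tree F (M.elt (compLabel A B p y)).src (M.elt (compLabel A B p y)).tgt)
    {ν : Fin A.n} (e : ν ≠ p) : (compStep A B p h ν).subst V = V (.inl ⟨ν, e⟩) := by
  rw [compStep_ne _ _ _ _ e, castT_subst, corolla_subst]
  rfl

/-! ### The tree of a labelled configuration -/

namespace Lab

variable {Y Y' : Type} {ob : Y → M.Arr} {ob' : Y' → M.Arr}

/-- The tree of a labelled configuration, its nodes carrying the given labels. -/
noncomputable def tree {f : M.Arr} (A : M.slice.Lab ob) (h : M.slice.tgt A.arr = f) :
    Tree (fun y => M.elt (ob y)) (M.elt f).src (M.elt f).tgt :=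
  castT (congrArg M.elt h)
    ((Conf.tree A.arr).reN A.lab fun i => congrArg M.elt (A.src_eq i))

theorem tree_congr {f : M.Arr} {A B : M.slice.Lab ob} (e : A = B) (h : M.slice.tgt A.arr = f)
    (h' : M.slice.tgt B.arr = f) : A.tree h = B.tree h' := by subst e; rfl

theorem tree_map {f : M.Arr} (g : Y → Y') (hg : ∀ y, ob y = ob' (g y)) (A : M.slice.Lab ob)
    (h : M.slice.tgt A.arr = f) :
    (A.map g hg).tree h = (A.tree h).reN g fun y => congrArg M.elt (hg y) := by
  subst h
  exact (reN_reN (F' := fun y => M.elt (ob y)) _ (fun i => congrArg M.elt (A.src_eq i)) _ _ _).symm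

/-- Pulls a substitution indexed by labels back to the node numbers, where two substitutions can be
compared node by node. -/
theorem tree_subst {N : Type} {F : N → M.xi.Elt}
    (V : ∀ y, Tree F (M.elt (ob y)).src (M.elt (ob y)).tgt) {f : M.Arr} (A : M.slice.Lab ob)
    (h : M.slice.tgt A.arr = f) :
    (A.tree h).subst V = castT (congrArg M.elt h) ((Conf.tree A.arr).subst fun ν =>
      castT (congrArg M.elt (A.src_eq ν)).symm (V (A.lab ν))) := by
  subst h
  exact subst_reN A.lab (fun i => congrArg M.elt (A.src_eq i)) V _

/-- If `V` assigns to the label of `p` what it makes of the tree of `B`, then inserting `B` at `p`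
before substituting `V` changes nothing. This is the invariance behind a single step of `fill`. -/
theorem tree_ins_subst {N : Type} {F : N → M.xi.Elt}
    (V : ∀ y, Tree F (M.elt (ob y)).src (M.elt (ob y)).tgt) {f : M.Arr} (A B : M.slice.Lab ob)
    (p : Fin (M.slice.arity A.arr)) (h : M.slice.tgt B.arr = ob (A.lab p))
    (hV : (B.tree h).subst V = V (A.lab p)) (hf : M.slice.tgt A.arr = f) :
    ((A.ins B p h).tree hf).subst V = (A.tree hf).subst V := by
  subst hf
  have hp := h.trans (A.src_eq p).symm
  have hl : ∀ y, compLabel A.arr B.arr p y = ob (Sum.elim (fun q => A.lab q.1) B.lab y) := by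
    rintro (q | r)
    · exact A.src_eq q.1
    · exact B.src_eq r
  -- The composite in `M₊` renumbers its nodes, and the amalgamating bijection carries the labels
  -- along; relabelling undoes the renumbering and leaves the plain substituted tree.
  have e1 : (A.ins B p h).tree rfl
      = (compTree A.arr B.arr p hp).reN (F' := fun y => M.elt (ob y))
        (Sum.elim (fun q => A.lab q.1) B.lab) (fun y => congrArg M.elt (hl y)) := by
    refine (reN_reN (F' := fun i => M.elt ((M.sliceData.comp A.arr B.arr p hp).label i))
      (F'' := fun y => M.elt (ob y)) _
      (fun y => congrArg (fun y => M.elt (compLabel A.arr B.arr p y))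
        (((M.sliceData.amal A.arr B.arr p hp).symm_apply_apply y).symm)) (A.ins B p h).lab
      (fun i => congrArg M.elt ((A.ins B p h).src_eq i)) _).trans (reN_congr (fun y => ?_) _ _ _)
    exact congrArg (Sum.elim (fun q : {q // q ≠ p} => A.lab q.1) B.lab)
      ((M.sliceData.amal A.arr B.arr p hp).symm_apply_apply y)
  refine (congrArg (Tree.subst V) e1).trans ((subst_reN _ _ _ _).trans ?_)
  refine (subst_subst _ _ _).trans (Eq.trans ?_ (tree_subst V A rfl).symm)
  refine congrArg (fun S => Tree.subst S (Conf.tree A.arr)) (funext fun ν => ?_)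
  rcases eq_or_ne ν p with rfl | e
  · refine (compStep_self_subst _ _ _ _ _).trans ?_
    refine Eq.trans ?_ (congrArg (castT _) (hV.symm.trans (tree_subst V B h))).symm
    exact (castT_castT _ _ _).symm
  · exact compStep_ne_subst _ _ _ _ _ e

section fill

variable {X X' : Type} {ob : X → M.Arr} {ob' : X' → M.Arr}

/-- The trees for the labels `x : X` filled by `S x`, and the other labels kept. -/
noncomputable def fillTree (S : Family M.slice ob ob') : ∀ y : X ⊕ X',
    Tree (fun x => M.elt (ob' x)) (M.elt (Sum.elim ob ob' y)).src (M.elt (Sum.elim ob ob' y)).tgt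
  | .inl x => (S x).1.tree (S x).2
  | .inr x => corolla (fun x => M.elt (ob' x)) x

theorem tree_inr_subst (S : Family M.slice ob ob') {f : M.Arr} (B : M.slice.Lab ob')
    (h : M.slice.tgt B.arr = f) :
    ((inr ob B).tree h).subst (fillTree S) = B.tree h := by
  refine (congrArg (Tree.subst _) (tree_map _ _ _ _)).trans ((subst_reN _ _ _ _).trans ?_)
  exact subst_corolla _

/-- The tree on the right is invariant under each step of `fill` by `tree_ins_subst`. When no label
in `X` is left, the substitution consists of corollas and is trivial. -/
theorem tree_fill (S : Family M.slice ob ob') (A : M.slice.Lab (Sum.elim ob ob')) {f : M.Arr}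
    (h : M.slice.tgt A.arr = f) :
    (fill S A).tree ((tgt_fill S A).trans h) = (A.tree h).subst (fillTree S) := by
  refine fill_induct S (P := fun A => ∀ h : M.slice.tgt A.arr = f,
    (fill S A).tree ((tgt_fill S A).trans h) = (A.tree h).subst (fillTree S)) ?_ ?_ A h
  · intro B h
    exact (tree_congr (fill_inr S B) _ _).trans (tree_inr_subst S B h).symm
  · intro A p x hp ih h
    refine (tree_congr (fill_step S A p x hp).symm _ _).trans ((ih h).trans ?_)
    refine tree_ins_subst _ _ _ _ _ ?_ _
    -- The label `A.lab p` is replaced by a variable so that its equality with `Sum.inl x` can be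
    -- substituted in the types.
    have key : ∀ y (hy : y = Sum.inl x) (h : M.slice.tgt (S x).1.arr = Sum.elim ob ob' y),
        ((inr ob (S x).1).tree h).subst (fillTree S) = fillTree S y := by
      rintro _ rfl h
      exact tree_inr_subst S _ _
    exact key _ hp _

/-- Iterated composition `∘_p` in `M₊` is simultaneous substitution of trees: this is the
compatibility of the comparison `xiSlice` with composition. -/
theorem tree_bind (S : Family M.slice ob ob') (A : M.slice.Lab ob) {f : M.Arr}
    (h : M.slice.tgt A.arr = f) :
    (bind S A).tree ((tgt_bind S A).trans h)
      = (A.tree h).subst fun x => (S x).1.tree (S x).2 := by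
  refine (tree_fill S (A.inl ob') h).trans ?_
  exact (congrArg (Tree.subst _) (tree_map _ _ _ _)).trans (subst_reN _ _ _ _)

end fill

/-- The nodes of a configuration are numbered in depth-first order, so the relabelled tree
determines the configuration, by `Rep.unique`, and its list of nodes is the labelling. -/
theorem tree_injective {f : M.Arr} {A B : M.slice.Lab ob} (hA : Function.Injective A.lab)
    (hB : Function.Injective B.lab) (h : M.slice.tgt A.arr = f) (h' : M.slice.tgt B.arr = f)
    (e : A.tree h = B.tree h') : A = B := by
  have r : Rep A.arr A.lab f (A.tree h) := ⟨hA, A.src_eq, h, rfl⟩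
  have r' : Rep B.arr B.lab f (B.tree h') := ⟨hB, B.src_eq, h', rfl⟩
  obtain ⟨h1, -⟩ := Rep.unique r (e ▸ r')
  have h2 : List.ofFn A.lab = List.ofFn B.lab :=
    r.nodes.symm.trans ((congrArg Tree.nodes e).trans r'.nodes)
  obtain ⟨a, l, s⟩ := A
  obtain ⟨a', l', s'⟩ := B
  obtain rfl : a = a' := h1
  obtain rfl : l = l' := List.ofFn_injective h2
  rfl

end Lab

end GenMulticat

/-! ### The equivalence of `ξ(M₊)` with `ξ(M)⁺`, and the induction. -/

theorem SymMulticat.Tree.reN_symm_reN {Q : SymMulticat.{u}} {N N' L : Type} {F : N → Q.Elt}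
    {x : L → Q.Obj} {z : Q.Obj} (e : N' ≃ N) (T : Tree F x z) :
    (T.reN (F' := fun i => F (e i)) e.symm (fun ν => by rw [Equiv.apply_symm_apply])).reN
      (F' := F) e (fun _ => rfl) = T := by
  refine (reN_reN _ _ _ _ _).trans ?_
  exact (reN_congr e.apply_symm_apply _ (fun _ => rfl) T).trans (reN_id T fun _ => rfl)

namespace GenMulticat

open SymMulticat SymMulticat.Tree

variable {M : GenMulticat.{u}}

theorem Lab.full_tree {Y : Type} {ob : Y → M.Arr} {f : M.Arr} (A : M.slice.Lab ob)
    (hA : Function.Bijective A.lab) (h : M.slice.tgt A.arr = f) : (A.tree h).Full := by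
  subst h
  exact (Conf.full A.arr).reN (Equiv.ofBijective A.lab hA) fun i => congrArg M.elt (A.src_eq i)

theorem Lab.evalsTo_tree {Y : Type} {ob : Y → M.Arr} {f : M.Arr} (A : M.slice.Lab ob)
    (h : M.slice.tgt A.arr = f) : (A.tree h).EvalsTo id (M.elt f).hom := by
  subst h
  exact (Conf.evalsTo A.arr).reN _ fun i => congrArg M.elt (A.src_eq i)

variable (M) in
/-- The comparison of `ξ(M₊)` with `ξ(M)⁺`. -/
noncomputable def xiSlice : M.slice.xi.Mor M.xi.slice where
  obj := M.eltFunctor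
  map f := ⟨f.1.tree f.2.2, f.1.full_tree f.2.1 _, f.1.evalsTo_tree _⟩
  map_ι {x y} a := by
    -- The only object-morphisms are identities, and both sides are the corolla.
    obtain ⟨x⟩ := x
    obtain ⟨y⟩ := y
    obtain rfl : x = y := Discrete.eq_of_hom a
    obtain rfl : a = 𝟙 (Discrete.mk x) :=
      Subsingleton.elim (α := Discrete.mk x ⟶ Discrete.mk x) _ _
    exact Subtype.ext (reN_corolla (F := fun _ : Fin 1 => M.elt x)
      (F' := fun _ : Fin 1 => M.elt x) (fun _ => 0) (fun _ => rfl) 0)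
  map_comp {k x y m u'} f g := by
    refine Subtype.ext ((Lab.tree_bind _ f.1 f.2.2).trans ?_)
    exact congrArg (fun S => Tree.subst S (f.1.tree f.2.2))
      (funext fun i => Lab.tree_map (fun j => finSigmaFinEquiv ⟨i, j⟩)
        (fun j => (congrArg Discrete.as (concat_mk u' ⟨i, j⟩)).symm) (g i).1 (g i).2.2)
  map_act {m n x y} σ f := Subtype.ext (Lab.tree_map (ob' := fun i => (x (σ i)).as) σ.symm
    (fun i => by rw [Equiv.apply_symm_apply]) f.1 f.2.2)

/-- A tree in which each source position labels exactly one node is the same as a depth-first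
numbered tree with a bijection from numbers to positions. Injectivity is `Lab.tree_injective`;
surjectivity comes from numbering the nodes. -/
theorem xiSlice_isEquivalence : M.xiSlice.IsEquivalence := by
  refine ⟨inferInstanceAs M.eltFunctor.IsEquivalence, fun n x y => ⟨fun f g h => ?_, fun T => ?_⟩⟩
  · exact Subtype.ext (Lab.tree_injective f.2.1.1 g.2.1.1 f.2.2 g.2.2 (congrArg Subtype.val h))
  · obtain ⟨T, h1, h2⟩ := T
    -- The configuration is `T` with its nodes renumbered in depth-first order, and its labelling is
    -- the numbering, which restores the labels of `T`.
    refine ⟨⟨⟨Conf.ofTree (fun i => (x i).as) y.as T h1 h2,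
      number (fun i => (x i).as) y.as T h1, fun _ => rfl⟩, Equiv.bijective _, rfl⟩, ?_⟩
    exact Subtype.ext (reN_symm_reN (number (fun i => (x i).as) y.as T h1) T)

/-- The comparison of `ξ(J)` with `I`. -/
noncomputable def xiJ : J.xi.Mor I where
  obj := 𝟭 (Discrete Unit)
  -- Every arrow of `J` has arity one, so the labelling is a bijection from `Fin 1` to `Fin n` and
  -- forces `n = 1`.
  map f := ⟨(Fin.equiv_iff_eq.1 ⟨Equiv.ofBijective f.1.lab f.2.1⟩).symm⟩
  map_ι _ := rfl
  map_comp _ _ := rfl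
  map_act _ _ := rfl

theorem xiJ_isEquivalence : xiJ.IsEquivalence := by
  refine ⟨inferInstanceAs (𝟭 (Discrete Unit)).IsEquivalence,
    fun n x y => ⟨fun f g _ => Subtype.ext ?_, fun h => ?_⟩⟩
  · obtain rfl : n = 1 := (xiJ.map f).down
    exact Lab.ext_lab rfl fun p q _ => Subsingleton.elim (α := Fin 1) _ _
  · obtain ⟨rfl⟩ := h
    exact ⟨⟨⟨(), fun p => p, fun _ => rfl⟩, Function.bijective_id, rfl⟩, rfl⟩

/-- Only this direction is carried through the induction: the comparison `xiSlice` and the slice of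
the previous equivalence compose, and inversion is needed only once, at the end. -/
theorem exists_xi_iterSlice_equivalence (k : ℕ) :
    ∃ G : (J.iterSlice k).xi.Mor (I.iterSlice k), G.IsEquivalence := by
  induction k with
  | zero => exact ⟨xiJ, xiJ_isEquivalence⟩
  | succ k ih =>
    obtain ⟨G, hG⟩ := ih
    exact ⟨(J.iterSlice k).xiSlice.comp G.slice, xiSlice_isEquivalence.comp hG.slice⟩

end GenMulticat

end Opetopic

theorem mainTheorem7 (k : ℕ) :
    (∃ F : (Opetopic.I.iterSlice k).Mor (Opetopic.J.iterSlice k).xi, F.IsEquivalence) ∧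
      ∃ G : (Opetopic.J.iterSlice k).xi.Mor (Opetopic.I.iterSlice k), G.IsEquivalence := by
  obtain ⟨G, hG⟩ := Opetopic.GenMulticat.exists_xi_iterSlice_equivalence k
  exact ⟨hG.exists_inverse, G, hG⟩
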